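/- Let $\mathfrak g\oplus\mathfrak t^2$ be the real $8$-dimensional Lie algebra with basis $\alpha^i,\beta_i$ ($0\le i\le 3$) whose only nonzero brackets are $[\beta_i,\beta_j]=\sum_k\varepsilon_{ijk}\alpha^k$ for $i,j,k\in\{1,2,3\}$, with the invariant symmetric pairing of signature $(4,4)$ given by $(\alpha^i,\beta_j)=\delta^i_j$, $(\alpha^i,\alpha^j)=(\beta_i,\beta_j)=0$. Let $G\times\mathbb R^2$ be its simply connected Lie group, in exponential coordinates $x\cdot y=x+y+\tfrac12[x,y]$, let $\Gamma\times\mathbb Z^2$ be the subgroup generated by the integral combinations of the $\alpha^i$ and by the integral combinations of the $\beta_i$, and let $X\times T^2=(\Gamma\times\mathbb Z^2)\backslash(G\times\mathbb R^2)$. For $a\in\mathfrak d:=(\mathfrak g\oplus\mathfrak t^2)\otimes\mathbb C$ let $a(z)=\sum_{n\in\mathbb Z}a_{(n)}z^{-n-1}$ (even) and $\bar a(z)=\sum_{n\in\mathbb Z}\bar a_{(n)}z^{-n-1}$ (odd) be the currents, linear in $a$, of the affine Lie superalgebra at level one, $$[a_{(m)},b_{(n)}]=[a,b]_{(m+n)}+m\,(a,b)\,\delta_{m,-n},\quad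 [a_{(m)},\bar b_{(n)}]=\overline{[a,b]}_{(m+n)},\quad [\bar a_{(m)},\bar b_{(n)}]=(a,b)\,\delta_{m+n,-1}.$$ Let $\mathscr H\otimes\mathscr H_{T^2}$ be the module induced from $C^\infty(X\times T^2,\mathbb C)$, on which $a_{(n)}$ $(n>0)$ and $\bar a_{(n)}$ $(n\ge0)$ act by zero and $a_{(0)}$ acts by the differential of the action of $G\times\mathbb R^2$ by right translations; it is $\mathbb Z/2$-graded with $C^\infty(X\times T^2,\mathbb C)$ even. Let $\mathscr J$ be a left-invariant complex structure on $X\times T^2$ (a smooth endomorphism of the tangent bundle, constant in the trivialization of the tangent bundle by left-invariant vector fields, with $\mathscr J^2=-1$ and vanishing Nijenhuis tensor) that is orthogonal for the left-invariant metric defined by $(\cdot\,,\cdot)$. Let $\mathfrak l,\overline{\mathfrak l}\subset\mathfrak d$ be the $\pm\sqrt{-1}$-eigenspaces of $\mathscr J$. Then: 1. $(\mathfrak d,\mathfrak l,\overline{\mathfrak l})$ is a Manin triple: $(\cdot\,,\cdot)$ is a nondegenerate invariant symmetric form on $\mathfrak d$, and $\mathfrak d=\mathfrak l\oplus\overline{\mathfrak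 l}$ with $\mathfrak l,\overline{\mathfrak l}$ isotropic Lie subalgebras. 2. There are unique fields $L,J$ (even) and $G^+,G^-$ (odd) on $\mathscr H\otimes\mathscr H_{T^2}$, belonging to the vertex superalgebra of fields generated by the currents, that satisfy the operator product expansions of the $N=2$ superconformal algebra of central charge $c=12$, namely: $L$ is a Virasoro field of central charge $c$; $J$ and $G^\pm$ are primary for $L$ of conformal weights $1$ and $\tfrac32$; $$J(z)J(w)\sim\frac{c/3}{(z-w)^2},\qquad J(z)G^\pm(w)\sim\pm\frac{G^\pm(w)}{z-w},\qquad G^\pm(z)G^\pm(w)\sim0,$$ $$G^+(z)G^-(w)\sim\frac{L(w)+\frac12\partial J(w)}{z-w}+\frac{J(w)}{(z-w)^2}+\frac{c/3}{(z-w)^3};$$ and such that, for every basis $e_1,\dots,e_4$ of $\mathfrak l$ with dual basis $e^1,\dots,e^4$ of $\overline{\mathfrak l}$ (that is, $(e_i,e^j)=\delta_i^j$), the superfield $J(z)+\theta\,(G^-(z)-G^+(z))$ equals $\sum_i\bar e^i\bar e_i$, i.e. $$J=\sum_i{:}\bar e^i\bar e_i{:},\qquad G^--G^+=\sum_i\left({:}e^i\bar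 e_i{:}-{:}\bar e^ie_i{:}\right).$$ -/

import Mathlib

open scoped TensorProduct ContDiff

noncomputable section

namespace DoubledTorus

/-! ### The Lie algebra `𝔤 ⊕ 𝔱²`

Index `0` is the direction of the auxiliary torus, indices `1, 2, 3` are those of `𝔤`.
A vector `(a, b)` stands for `∑ i, a i • αⁱ + b i • βᵢ`. -/

/-- The real `8`-dimensional vector space underlying `𝔤 ⊕ 𝔱²`. -/
def DLie : Type := (Fin 4 → ℝ) × (Fin 4 → ℝ)

instance : NormedAddCommGroup DLie :=
  inferInstanceAs (NormedAddCommGroup ((Fin 4 → ℝ) × (Fin 4 → ℝ)))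

instance : NormedSpace ℝ DLie :=
  inferInstanceAs (NormedSpace ℝ ((Fin 4 → ℝ) × (Fin 4 → ℝ)))

instance : FiniteDimensional ℝ DLie :=
  inferInstanceAs (FiniteDimensional ℝ ((Fin 4 → ℝ) × (Fin 4 → ℝ)))

/-- The covector `det(v, w, ·)`, where `det` is extended by zero in the direction `0`;
its `k`-th component is `∑ i j, ε_{ijk} vⁱ wʲ`. -/
def detForm (v w : Fin 4 → ℝ) : Fin 4 → ℝ :=
  ![0, v 2 * w 3 - v 3 * w 2, v 3 * w 1 - v 1 * w 3, v 1 * w 2 - v 2 * w 1]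

/-- The only nonzero brackets of basis vectors are `[βᵢ, βⱼ] = ε_{ijk} αᵏ`. -/
instance : Bracket DLie DLie where
  bracket x y := ((detForm x.2 y.2, 0) : (Fin 4 → ℝ) × (Fin 4 → ℝ))

theorem bracket_def (x y : DLie) :
    ⁅x, y⁆ = (((detForm x.2 y.2, 0) : (Fin 4 → ℝ) × (Fin 4 → ℝ)) : DLie) := rfl

theorem detForm_add_left (u v w : Fin 4 → ℝ) :
    detForm (u + v) w = detForm u w + detForm v w := by
  funext k; fin_cases k <;> simp [detForm] <;> ring

theorem detForm_add_right (u v w : Fin 4 → ℝ) :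
    detForm u (v + w) = detForm u v + detForm u w := by
  funext k; fin_cases k <;> simp [detForm] <;> ring

theorem detForm_smul_right (t : ℝ) (u v : Fin 4 → ℝ) :
    detForm u (t • v) = t • detForm u v := by
  funext k; fin_cases k <;> simp [detForm] <;> ring

theorem detForm_self (v : Fin 4 → ℝ) : detForm v v = 0 := by
  funext k; fin_cases k <;> simp [detForm] <;> ring

theorem detForm_zero_left (v : Fin 4 → ℝ) : detForm 0 v = 0 := by
  funext k; fin_cases k <;> simp [detForm]

theorem detForm_zero_right (v : Fin 4 → ℝ) : detForm v 0 = 0 := by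
  funext k; fin_cases k <;> simp [detForm]

instance : LieRing DLie where
  add_lie x y z := by
    refine Prod.ext (detForm_add_left _ _ _) (add_zero _).symm
  lie_add x y z := by
    refine Prod.ext (detForm_add_right _ _ _) (add_zero _).symm
  lie_self x := Prod.ext (detForm_self _) rfl
  leibniz_lie x y z := by
    refine Prod.ext ?_ (add_zero _).symm
    change detForm x.2 0 = detForm 0 z.2 + detForm y.2 0
    simp [detForm_zero_left, detForm_zero_right]

instance : LieAlgebra ℝ DLie where
  lie_smul t _ _ := Prod.ext (detForm_smul_right _ _ _) (smul_zero t).symm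

/-- The invariant pairing of signature `(4, 4)`: `(αⁱ, βⱼ) = (βⱼ, αⁱ) = δⁱⱼ`, all other
pairings of basis vectors being zero. -/
def pairing : LinearMap.BilinForm ℝ DLie :=
  LinearMap.mk₂ ℝ (fun x y => ∑ i, (x.1 i * y.2 i + x.2 i * y.1 i))
    (fun x x' y => by
      rw [← Finset.sum_add_distrib]
      refine Finset.sum_congr rfl fun i _ => ?_
      change (x.1 i + x'.1 i) * y.2 i + (x.2 i + x'.2 i) * y.1 i = _
      ring)
    (fun c x y => by
      rw [smul_eq_mul, Finset.mul_sum]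
      refine Finset.sum_congr rfl fun i _ => ?_
      change (c * x.1 i) * y.2 i + (c * x.2 i) * y.1 i = _
      ring)
    (fun x y y' => by
      rw [← Finset.sum_add_distrib]
      refine Finset.sum_congr rfl fun i _ => ?_
      change x.1 i * (y.2 i + y'.2 i) + x.2 i * (y.1 i + y'.1 i) = _
      ring)
    (fun c x y => by
      rw [smul_eq_mul, Finset.mul_sum]
      refine Finset.sum_congr rfl fun i _ => ?_
      change x.1 i * (c * y.2 i) + x.2 i * (c * y.1 i) = _
      ring)

/-- The complexification of `𝔤 ⊕ 𝔱²`. -/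
abbrev DLieC : Type := ℂ ⊗[ℝ] DLie

/-- The complex bilinear extension of the pairing. -/
def pairingC : LinearMap.BilinForm ℂ DLieC := LinearMap.BilinForm.baseChange ℂ pairing

/-! ### The group `G × ℝ²`, its lattice, and the nilmanifold `X × T²` -/

/-- The simply connected group `G × ℝ²`, presented in exponential coordinates. -/
@[ext]
structure DGroup : Type where
  /-- the exponential map, a global chart -/
  exp ::
  /-- the inverse of the exponential map -/
  log : DLie

/-- `(v*, v) (w*, w) = (v* + w* + ½ det(v, w, ·), v + w)`. -/
instance : Mul DGroup where
  mul g h := ⟨g.log + h.log + (1 / 2 : ℝ) • ⁅g.log, h.log⁆⟩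

instance : One DGroup where
  one := ⟨0⟩

instance : Inv DGroup where
  inv g := ⟨-g.log⟩

theorem mul_log (g h : DGroup) :
    (g * h).log = g.log + h.log + (1 / 2 : ℝ) • ⁅g.log, h.log⁆ := rfl

theorem lie_lie_eq_zero (x y z : DLie) : ⁅⁅x, y⁆, z⁆ = 0 :=
  Prod.ext (detForm_zero_left _) rfl

theorem lie_lie_eq_zero' (x y z : DLie) : ⁅x, ⁅y, z⁆⁆ = 0 :=
  Prod.ext (detForm_zero_right _) rfl

instance : Group DGroup :=
  Group.ofLeftAxioms
    (fun g h k => by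
      refine DGroup.ext ?_
      simp only [mul_log, add_lie, lie_add, smul_lie, lie_smul, lie_lie_eq_zero,
        lie_lie_eq_zero', smul_add, smul_zero, add_zero]
      abel)
    (fun g => by
      refine DGroup.ext ?_
      change (0 : DLie) + g.log + (1 / 2 : ℝ) • ⁅(0 : DLie), g.log⁆ = g.log
      simp)
    (fun g => by
      refine DGroup.ext ?_
      change -g.log + g.log + (1 / 2 : ℝ) • ⁅-g.log, g.log⁆ = 0
      simp)

/-- The discrete co-compact subgroup `Γ × ℤ²`, generated by the integral vectors of
`V ⊕ ℝ` and of its dual. -/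
def lattice : Subgroup DGroup :=
  Subgroup.closure
    {g | ∃ k : Fin 4 → ℤ,
      g.log.1 = (fun i => (k i : ℝ)) ∧ g.log.2 = 0 ∨
      g.log.1 = 0 ∧ g.log.2 = (fun i => (k i : ℝ))}

/-- The nilmanifold `X × T² = (Γ × ℤ²) \ (G × ℝ²)`. -/
abbrev Nilmanifold : Type := Quotient (QuotientGroup.rightRel lattice)

/-- The projection `G × ℝ² → X × T²`. -/
def proj (g : DGroup) : Nilmanifold := Quotient.mk _ g

/-- The right action of `G × ℝ²` on `X × T²`. -/
def rightTranslate (h : DGroup) : Nilmanifold → Nilmanifold :=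
  Quotient.map (fun g => g * h) (by
    intro a b hab
    change QuotientGroup.rightRel lattice _ _
    rw [QuotientGroup.rightRel_apply]
    have h' : QuotientGroup.rightRel lattice a b := hab
    rw [QuotientGroup.rightRel_apply] at h'
    simpa [mul_assoc] using h')

theorem rightTranslate_proj (h g : DGroup) : rightTranslate h (proj g) = proj (g * h) := rfl

/-- `C^∞(X × T²)`: complex functions on the nilmanifold that are smooth after pull back along
the covering `G × ℝ² → X × T²`. -/
def SmoothFunctions : Submodule ℂ (Nilmanifold → ℂ) where
  carrier := {f | ContDiff ℝ ∞ (fun x : DLie => f (proj ⟨x⟩))}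
  add_mem' {f g} hf hg := by
    have hf' : ContDiff ℝ ∞ (fun x : DLie => f (proj ⟨x⟩)) := hf
    have hg' : ContDiff ℝ ∞ (fun x : DLie => g (proj ⟨x⟩)) := hg
    exact hf'.add hg'
  zero_mem' := by
    change ContDiff ℝ ∞ (fun _ : DLie => (0 : ℂ))
    exact contDiff_const
  smul_mem' c f hf := by
    have hf' : ContDiff ℝ ∞ (fun x : DLie => f (proj ⟨x⟩)) := hf
    exact hf'.const_smul c

theorem hasDerivAt_rightTranslate (f : SmoothFunctions) (X x : DLie) :
    HasDerivAt (fun t : ℝ => f.1 (rightTranslate ⟨t • X⟩ (proj ⟨x⟩)))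
      (fderiv ℝ (fun y : DLie => f.1 (proj ⟨y⟩)) x (X + (1 / 2 : ℝ) • ⁅x, X⁆)) 0 := by
  have h1 : HasDerivAt (fun t : ℝ => x + t • (X + (1 / 2 : ℝ) • ⁅x, X⁆))
      (X + (1 / 2 : ℝ) • ⁅x, X⁆) 0 := by
    simpa using ((hasDerivAt_id (0 : ℝ)).smul_const (X + (1 / 2 : ℝ) • ⁅x, X⁆)).const_add x
  have hf : ContDiff ℝ ∞ (fun y : DLie => f.1 (proj ⟨y⟩)) := f.2
  have h2 : HasFDerivAt (fun y : DLie => f.1 (proj ⟨y⟩))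
      (fderiv ℝ (fun y : DLie => f.1 (proj ⟨y⟩)) x)
      (x + (0 : ℝ) • (X + (1 / 2 : ℝ) • ⁅x, X⁆)) := by
    simpa using (hf.differentiable (by simp) x).hasFDerivAt
  have h3 := h2.comp_hasDerivAt (0 : ℝ) h1
  refine h3.congr_of_eventuallyEq (Filter.Eventually.of_forall fun t => ?_)
  change f.1 (proj ⟨x + t • X + (1 / 2 : ℝ) • ⁅x, t • X⁆⟩) =
    f.1 (proj ⟨x + t • (X + (1 / 2 : ℝ) • ⁅x, X⁆)⟩)
  rw [lie_smul, smul_add, smul_comm t (1 / 2 : ℝ), add_assoc]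

/-- The action of `X ∈ 𝔤 ⊕ 𝔱²` on `C^∞(X × T²)`, the differential of the action of `G × ℝ²`
by right translations. -/
def act (X : DLie) : SmoothFunctions →ₗ[ℂ] SmoothFunctions where
  toFun f := ⟨fun p => deriv (fun t : ℝ => f.1 (rightTranslate ⟨t • X⟩ p)) 0, by
    change ContDiff ℝ ∞ (fun x : DLie =>
      deriv (fun t : ℝ => f.1 (rightTranslate ⟨t • X⟩ (proj ⟨x⟩))) 0)
    have hf : ContDiff ℝ ∞ (fun y : DLie => f.1 (proj ⟨y⟩)) := f.2
    have h1 : ContDiff ℝ ∞ (fun x : DLie => X + (1 / 2 : ℝ) • ⁅x, X⁆) := by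
      have h2 : ContDiff ℝ ∞ (fun x : DLie => -⁅X, x⁆) :=
        (LinearMap.toContinuousLinearMap
          ((LieAlgebra.ad ℝ DLie X : DLie →ₗ[ℝ] DLie))).contDiff.neg
      have h3 : (fun x : DLie => -⁅X, x⁆) = fun x : DLie => ⁅x, X⁆ := by
        funext x; exact lie_skew x X
      rw [h3] at h2
      exact contDiff_const.add (h2.const_smul (1 / 2 : ℝ))
    have h4 : (fun x : DLie =>
        deriv (fun t : ℝ => f.1 (rightTranslate ⟨t • X⟩ (proj ⟨x⟩))) 0) =
        fun x : DLie =>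
          fderiv ℝ (fun y : DLie => f.1 (proj ⟨y⟩)) x (X + (1 / 2 : ℝ) • ⁅x, X⁆) :=
      funext fun x => (hasDerivAt_rightTranslate f X x).deriv
    rw [h4]
    exact (hf.fderiv_right (m := ∞) (by simp)).clm_apply h1⟩
  map_add' f g := by
    ext p
    induction p using Quotient.inductionOn with
    | h g' =>
      exact ((hasDerivAt_rightTranslate f X g'.log).add
        (hasDerivAt_rightTranslate g X g'.log)).deriv.trans
        (congrArg₂ (· + ·) (hasDerivAt_rightTranslate f X g'.log).deriv.symm
          (hasDerivAt_rightTranslate g X g'.log).deriv.symm)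
  map_smul' c f := by
    ext p
    induction p using Quotient.inductionOn with
    | h g' =>
      exact ((hasDerivAt_rightTranslate f X g'.log).const_smul c).deriv.trans
        (congrArg (c • ·) (hasDerivAt_rightTranslate f X g'.log).deriv.symm)

/-! ### Complex structures on `X × T²` -/

/-- The differential at `x` of left translation by `h`, in exponential coordinates. -/
def dLeft (h : DGroup) (x : DLie) : DLie →L[ℝ] DLie :=
  fderiv ℝ (fun y : DLie => (h * ⟨y⟩).log) x

/-- The pseudo-Riemannian metric of signature `(4, 4)` on the tangent bundle obtained from the
pairing on `𝔤 ⊕ 𝔱²` through the trivialization by left translations. -/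
def metric (x u v : DLie) : ℝ :=
  pairing (dLeft (DGroup.exp x)⁻¹ x u) (dLeft (DGroup.exp x)⁻¹ x v)

/-- A complex structure on `X × T²`: a smooth endomorphism `𝒥` of the tangent bundle with
`𝒥² = -1` and vanishing Nijenhuis tensor. A tensor field on `X × T²` is the same as a tensor
field on the covering group `G × ℝ²` that is invariant under the lattice. -/
structure IsComplexStructure (𝒥 : DLie → DLie →L[ℝ] DLie) : Prop where
  smooth : ContDiff ℝ ∞ 𝒥
  descends : ∀ γ ∈ lattice, ∀ x,
    dLeft γ x ∘L 𝒥 x = 𝒥 (γ * DGroup.exp x).log ∘L dLeft γ x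
  sq : ∀ x, 𝒥 x ∘L 𝒥 x = -ContinuousLinearMap.id ℝ DLie
  integrable : ∀ U V : DLie → DLie, ContDiff ℝ ∞ U → ContDiff ℝ ∞ V → ∀ x,
    VectorField.lieBracket ℝ (fun y => 𝒥 y (U y)) (fun y => 𝒥 y (V y)) x
      - 𝒥 x (VectorField.lieBracket ℝ (fun y => 𝒥 y (U y)) V x)
      - 𝒥 x (VectorField.lieBracket ℝ U (fun y => 𝒥 y (V y)) x)
      - VectorField.lieBracket ℝ U V x = 0

/-- Equivariance: in the trivialization of `T(X × T²)` by left-invariant vector fields, the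
endomorphism `𝒥` is constant, i.e. `𝒥` is invariant under all left translations of `G × ℝ²`. -/
def IsEquivariant (𝒥 : DLie → DLie →L[ℝ] DLie) : Prop :=
  ∀ (h : DGroup) (x : DLie), dLeft h x ∘L 𝒥 x = 𝒥 (h * DGroup.exp x).log ∘L dLeft h x

/-- `𝒥` is orthogonal for the metric. -/
def IsOrthogonal (𝒥 : DLie → DLie →L[ℝ] DLie) : Prop :=
  ∀ x u v : DLie, metric x (𝒥 x u) (𝒥 x v) = metric x u v

/-- The `ε`-eigenspace, in the complexified Lie algebra, of the endomorphism of `𝔤 ⊕ 𝔱²`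
given by `𝒥` at the identity. For `ε = i, -i` these are `𝔩` and `𝔩̄`. -/
def eigen (𝒥 : DLie → DLie →L[ℝ] DLie) (ε : ℂ) : Submodule ℂ DLieC :=
  Module.End.eigenspace (LinearMap.baseChange ℂ (𝒥 0 : DLie →ₗ[ℝ] DLie)) ε

/-- A Manin triple: a Lie algebra with a nondegenerate invariant symmetric bilinear form that is
the direct sum of two isotropic Lie subalgebras. -/
structure IsManinTriple {K 𝔡 : Type*} [Field K] [LieRing 𝔡] [LieAlgebra K 𝔡]
    (B : LinearMap.BilinForm K 𝔡) (𝔞 𝔟 : Submodule K 𝔡) : Prop where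
  symm : ∀ x y, B x y = B y x
  nondegenerate : B.Nondegenerate
  invariant : ∀ x y z, B ⁅x, y⁆ z = B x ⁅y, z⁆
  lie_mem_left : ∀ x ∈ 𝔞, ∀ y ∈ 𝔞, ⁅x, y⁆ ∈ 𝔞
  lie_mem_right : ∀ x ∈ 𝔟, ∀ y ∈ 𝔟, ⁅x, y⁆ ∈ 𝔟
  isotropic_left : ∀ x ∈ 𝔞, ∀ y ∈ 𝔞, B x y = 0
  isotropic_right : ∀ x ∈ 𝔟, ∀ y ∈ 𝔟, B x y = 0
  isCompl : IsCompl 𝔞 𝔟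

/-! ### Fields and operator product expansions -/

section Fields

variable {M : Type*} [AddCommGroup M] [Module ℂ M]

/-- A formal distribution `A(z) = ∑ₙ A₍ₙ₎ z⁻ⁿ⁻¹` with coefficients operators on `M`. -/
abbrev FormalDist (M : Type*) [AddCommGroup M] [Module ℂ M] : Type _ := ℤ → Module.End ℂ M

/-- `A(z)` is a field: `A(z) v` is a Laurent series for every `v`. -/
def IsQuantumField (A : FormalDist M) : Prop :=
  ∀ v : M, ∃ N : ℤ, ∀ n : ℤ, N ≤ n → A n v = 0

/-- The identity field. -/
def idField : FormalDist M := fun n => if n = -1 then LinearMap.id else 0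

/-- The derivative `∂A(z)`. -/
def dField (A : FormalDist M) : FormalDist M := fun n => (-n : ℂ) • A (n - 1)

/-- The sign `(-1)^{pq}`. -/
def koszul (p q : ZMod 2) : ℂ := if p = 1 ∧ q = 1 then -1 else 1

/-- The operator product expansion
`A(z) B(w) ~ C₀(w)/(z-w) + C₁(w)/(z-w)² + C₂(w)/(z-w)³ + ⋯`, with `C = [C₀, C₁, C₂, …]`, for
`A` of parity `p` and `B` of parity `q`: the super-commutator of `A(z)` and `B(w)` is
`∑ⱼ Cⱼ(w) ∂_w^j δ(z-w) / j!`, written out in modes. -/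
def HasOPE (p q : ZMod 2) (A B : FormalDist M) (C : List (FormalDist M)) : Prop :=
  ∀ m n : ℤ, A m * B n - koszul p q • (B n * A m) =
    ∑ j : Fin C.length, ((Ring.choose m (j : ℕ) : ℤ) : ℂ) • C.get j (m + n - (j : ℕ))

/-- The `n`-th mode, applied to `v`, of the `k`-th product `A₍ₖ₎B` of two fields of parities
`p` and `q`: the residue at `z` of
`i_{z,w}(z-w)^k A(z) B(w) - (-1)^{pq} i_{w,z}(z-w)^k B(w) A(z)`.
The sum is finite when `A` and `B` are fields. -/
def nthProd (p q : ZMod 2) (k : ℤ) (A B : FormalDist M) (n : ℤ) (v : M) : M :=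
  ∑ᶠ j : ℕ, ((-1 : ℂ) ^ j * ((Ring.choose k j : ℤ) : ℂ)) •
    (A (k - j) (B (n + j) v) - (koszul p q * (-1 : ℂ) ^ k) • B (n + k - j) (A j v))

/-- The normally ordered product `:A(z)B(z):`. -/
def normalOrd (p q : ZMod 2) (A B : FormalDist M) (n : ℤ) (v : M) : M :=
  nthProd p q (-1) A B n v

/-- Given fields `even a` and `odd a` on `M`, the vertex super-algebra of fields on `M` that they
generate: the smallest space of fields that contains them and the identity field and is closed
under all `k`-th products. `MemGenerated even odd p A` says that `A` is in its part of
parity `p`. -/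
inductive MemGenerated {ι : Type*} (even odd : ι → FormalDist M) :
    ZMod 2 → FormalDist M → Prop
  | one : MemGenerated even odd 0 idField
  | even (a : ι) : MemGenerated even odd 0 (even a)
  | odd (a : ι) : MemGenerated even odd 1 (odd a)
  | add {p : ZMod 2} {A B : FormalDist M} : MemGenerated even odd p A →
      MemGenerated even odd p B → MemGenerated even odd p (A + B)
  | smul {p : ZMod 2} (c : ℂ) {A : FormalDist M} : MemGenerated even odd p A →
      MemGenerated even odd p (c • A)
  | prod {p q : ZMod 2} (k : ℤ) {A B C : FormalDist M} : MemGenerated even odd p A →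
      MemGenerated even odd q B → (∀ n v, C n v = nthProd p q k A B n v) →
      MemGenerated even odd (p + q) C

/-- All modes of `A` are operators of parity `p` for the `ℤ/2`-grading `S` of `M`. -/
def HasParity (S : ZMod 2 → Submodule ℂ M) (p : ZMod 2) (A : FormalDist M) : Prop :=
  ∀ n q, ∀ v ∈ S q, A n v ∈ S (p + q)

/-- Four formal distributions, candidates for the generators of the `N = 2` algebra. -/
structure N2Data (M : Type*) [AddCommGroup M] [Module ℂ M] where
  L : FormalDist M
  J : FormalDist M
  Gp : FormalDist M
  Gm : FormalDist M

/-- The fields `L`, `J` (even) and `G⁺`, `G⁻` (odd) make the super-space `M = S 0 ⊕ S 1` a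
representation of the `N = 2` super-conformal algebra of central charge `c`. -/
structure IsN2 (S : ZMod 2 → Submodule ℂ M) (c : ℂ) (D : N2Data M) : Prop where
  field_L : IsQuantumField D.L
  field_J : IsQuantumField D.J
  field_Gp : IsQuantumField D.Gp
  field_Gm : IsQuantumField D.Gm
  parity_L : HasParity S 0 D.L
  parity_J : HasParity S 0 D.J
  parity_Gp : HasParity S 1 D.Gp
  parity_Gm : HasParity S 1 D.Gm
  LL : HasOPE 0 0 D.L D.L [dField D.L, (2 : ℂ) • D.L, 0, (c / 2) • idField]
  LJ : HasOPE 0 0 D.L D.J [dField D.J, D.J]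
  LGp : HasOPE 0 1 D.L D.Gp [dField D.Gp, (3 / 2 : ℂ) • D.Gp]
  LGm : HasOPE 0 1 D.L D.Gm [dField D.Gm, (3 / 2 : ℂ) • D.Gm]
  JJ : HasOPE 0 0 D.J D.J [0, (c / 3) • idField]
  JGp : HasOPE 0 1 D.J D.Gp [D.Gp]
  JGm : HasOPE 0 1 D.J D.Gm [-D.Gm]
  GpGm : HasOPE 1 1 D.Gp D.Gm
    [D.L + (1 / 2 : ℂ) • dField D.J, D.J, (c / 3) • idField]
  GpGp : HasOPE 1 1 D.Gp D.Gp []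
  GmGm : HasOPE 1 1 D.Gm D.Gm []

end Fields

/-! ### The affine super-algebra and the space of states -/

/-- Generators of the affine Lie super-algebra: the modes `a₍ₙ₎` of the even currents
`a(z) = ∑ₙ a₍ₙ₎ z⁻ⁿ⁻¹` and `ā₍ₙ₎` (of degree `n + 1/2`) of the odd currents
`ā(z) = ∑ₙ ā₍ₙ₎ z⁻ⁿ⁻¹`. -/
inductive Gen : Type
  | cur (a : DLieC) (n : ℤ) : Gen
  | bar (a : DLieC) (n : ℤ) : Gen

/-- The parity of a generator. -/
def Gen.parity : Gen → ZMod 2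
  | .cur _ _ => 0
  | .bar _ _ => 1

/-- The defining relations: linearity in `a`, and the commutators at level one
`[a₍ₘ₎, b₍ₙ₎] = [a, b]₍ₘ₊ₙ₎ + m (a, b) δ_{m,-n}`, `[a₍ₘ₎, b̄₍ₙ₎]` the mode `m + n` of the odd
current of `[a, b]`, and `{ā₍ₘ₎, b̄₍ₙ₎} = (a, b) δ_{m + n, -1}`. -/
inductive AffineRel : FreeAlgebra ℂ Gen → FreeAlgebra ℂ Gen → Prop
  | cur_add (a b : DLieC) (n : ℤ) : AffineRel (FreeAlgebra.ι ℂ (.cur (a + b) n))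
      (FreeAlgebra.ι ℂ (.cur a n) + FreeAlgebra.ι ℂ (.cur b n))
  | cur_smul (c : ℂ) (a : DLieC) (n : ℤ) : AffineRel (FreeAlgebra.ι ℂ (.cur (c • a) n))
      (c • FreeAlgebra.ι ℂ (.cur a n))
  | bar_add (a b : DLieC) (n : ℤ) : AffineRel (FreeAlgebra.ι ℂ (.bar (a + b) n))
      (FreeAlgebra.ι ℂ (.bar a n) + FreeAlgebra.ι ℂ (.bar b n))
  | bar_smul (c : ℂ) (a : DLieC) (n : ℤ) : AffineRel (FreeAlgebra.ι ℂ (.bar (c • a) n))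
      (c • FreeAlgebra.ι ℂ (.bar a n))
  | cur_cur (a b : DLieC) (m n : ℤ) :
      AffineRel (FreeAlgebra.ι ℂ (.cur a m) * FreeAlgebra.ι ℂ (.cur b n)
          - FreeAlgebra.ι ℂ (.cur b n) * FreeAlgebra.ι ℂ (.cur a m))
        (FreeAlgebra.ι ℂ (.cur ⁅a, b⁆ (m + n))
          + algebraMap ℂ _ (if m + n = 0 then (m : ℂ) * pairingC a b else 0))
  | cur_bar (a b : DLieC) (m n : ℤ) :
      AffineRel (FreeAlgebra.ι ℂ (.cur a m) * FreeAlgebra.ι ℂ (.bar b n)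
          - FreeAlgebra.ι ℂ (.bar b n) * FreeAlgebra.ι ℂ (.cur a m))
        (FreeAlgebra.ι ℂ (.bar ⁅a, b⁆ (m + n)))
  | bar_bar (a b : DLieC) (m n : ℤ) :
      AffineRel (FreeAlgebra.ι ℂ (.bar a m) * FreeAlgebra.ι ℂ (.bar b n)
          + FreeAlgebra.ι ℂ (.bar b n) * FreeAlgebra.ι ℂ (.bar a m))
        (algebraMap ℂ _ (if m + n = -1 then pairingC a b else 0))

/-- The enveloping algebra of the affine Lie super-algebra, with the central element equal
to `1`. -/
def Envelope : Type := RingQuot AffineRel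

instance : Ring Envelope := inferInstanceAs (Ring (RingQuot AffineRel))

instance : Algebra ℂ Envelope := inferInstanceAs (Algebra ℂ (RingQuot AffineRel))

/-- A generator, as an element of the enveloping algebra. -/
def Gen.toEnvelope (x : Gen) : Envelope := RingQuot.mkAlgHom ℂ AffineRel (FreeAlgebra.ι ℂ x)

/-- The relations of the induced module: modes of positive degree annihilate `C^∞(X × T²)`, and
modes of degree zero act on it through `act`. -/
def inducedRelations : Submodule Envelope (Envelope ⊗[ℂ] SmoothFunctions) :=
  Submodule.span Envelope
    ({t | ∃ (a : DLieC) (n : ℤ) (f : SmoothFunctions), 0 < n ∧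
        t = (Gen.cur a n).toEnvelope ⊗ₜ[ℂ] f} ∪
     {t | ∃ (a : DLieC) (n : ℤ) (f : SmoothFunctions), 0 ≤ n ∧
        t = (Gen.bar a n).toEnvelope ⊗ₜ[ℂ] f} ∪
     {t | ∃ (X : DLie) (f : SmoothFunctions),
        t = (Gen.cur (1 ⊗ₜ[ℝ] X) 0).toEnvelope ⊗ₜ[ℂ] f - 1 ⊗ₜ[ℂ] act X f})

/-- The space of states `ℋ ⊗ ℋ_{T²}`: the module over the affine Lie super-algebra induced from
its subalgebra of non-negative degree acting on `C^∞(X × T²)`. -/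
def States : Type := (Envelope ⊗[ℂ] SmoothFunctions) ⧸ inducedRelations

instance : AddCommGroup States :=
  inferInstanceAs (AddCommGroup ((Envelope ⊗[ℂ] SmoothFunctions) ⧸ inducedRelations))

instance : Module Envelope States :=
  inferInstanceAs (Module Envelope ((Envelope ⊗[ℂ] SmoothFunctions) ⧸ inducedRelations))

instance : Module ℂ States :=
  inferInstanceAs (Module ℂ ((Envelope ⊗[ℂ] SmoothFunctions) ⧸ inducedRelations))

instance : IsScalarTower ℂ Envelope States :=
  inferInstanceAs
    (IsScalarTower ℂ Envelope ((Envelope ⊗[ℂ] SmoothFunctions) ⧸ inducedRelations))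

/-- The projection of `U ⊗ C^∞(X × T²)` onto the space of states. -/
def toStates : Envelope ⊗[ℂ] SmoothFunctions →ₗ[Envelope] States := inducedRelations.mkQ

/-- The `ℤ/2`-grading of the space of states: `C^∞(X × T²)` is even, and each odd mode changes
the parity. -/
def stateParity (p : ZMod 2) : Submodule ℂ States :=
  Submodule.span ℂ {v | ∃ (w : List Gen) (f : SmoothFunctions),
    (w.map Gen.parity).sum = p ∧
    v = (w.map Gen.toEnvelope).prod • toStates (1 ⊗ₜ[ℂ] f)}

/-- The even current `a(z)` acting on the space of states. -/
def current (a : DLieC) : FormalDist States := fun n =>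
  Algebra.lsmul ℂ ℂ States (Gen.cur a n).toEnvelope

/-- The odd current `ā(z)` acting on the space of states. -/
def oddCurrent (a : DLieC) : FormalDist States := fun n =>
  Algebra.lsmul ℂ ℂ States (Gen.bar a n).toEnvelope

/-- The `N = 2` data `D` on the space of states is generated by the super-field
`J(z,θ) = ∑ᵢ ēⁱ(z,θ) ēᵢ(z,θ)`, where `ā(z,θ) = ā(z) + θ a(z)`. Here `e` and `e'` are dual bases
of two subspaces of the Lie algebra (`e' i` is written `eⁱ`), and
`J(z,θ) = J(z) + θ (G⁻(z) - G⁺(z))`. -/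
def IsGeneratedBy (D : N2Data States) (e e' : Fin 4 → DLieC) : Prop :=
  (∀ n v, D.J n v = ∑ i, normalOrd 1 1 (oddCurrent (e' i)) (oddCurrent (e i)) n v) ∧
  (∀ n v, D.Gm n v - D.Gp n v =
    ∑ i, (normalOrd 0 1 (current (e' i)) (oddCurrent (e i)) n v
      - normalOrd 1 0 (oddCurrent (e' i)) (current (e i)) n v))

/-- The fields of `D` come from the vertex super-algebra `V((𝔤 ⊕ 𝔱²)_super)`, that is, they
belong to the vertex super-algebra of fields generated by the currents. -/
structure IsInAffineVertexAlgebra (D : N2Data States) : Prop where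
  mem_L : MemGenerated current oddCurrent 0 D.L
  mem_J : MemGenerated current oddCurrent 0 D.J
  mem_Gp : MemGenerated current oddCurrent 1 D.Gp
  mem_Gm : MemGenerated current oddCurrent 1 D.Gm

end DoubledTorus

end

noncomputable section

namespace DoubledTorus

/-! ### Calculus of quantum fields -/

section FieldCalculus

open Filter

variable {M : Type*} [AddCommGroup M] [Module ℂ M]

/-! At the identity, `𝒥` becomes an endomorphism `j` of the Lie algebra with `j² = -1`, orthogonal
for the pairing and with vanishing algebraic Nijenhuis tensor (`IsComplexStructure.atIdentity`).
Orthogonality makes its eigenspaces isotropic and the Nijenhuis identity makes them subalgebras;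
this is the Manin triple (`isManinTriple`).

The construction of the fields exploits nilpotency. For `i, k ∈ {1, 2, 3}` the `βₖ`-components of `j
αⁱ` form an antisymmetric matrix. Its rows are parallel, since the Nijenhuis identity on central
vectors reads `[j αⁱ, j αᵏ] = 0`; hence it vanishes and `j αⁱ` is central. So there is a `j`-stable
central Lagrangian subspace (`exists_isAdapted`). Its complexification has a basis of eigenvectors
`wₖ`, with charges `σₖ = ±1`, and a dual basis `dₖ` of a complementary Lagrangian subspace. Then
`[dᵢ, dⱼ] = ∑ Fᵢⱼₖ wₖ` with `F` totally antisymmetric, and zero when the three charges agree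
(`exists_adaptedBasis`).

In this basis `J = ∑ σₖ :d̄ₖ w̄ₖ:`. With `H = G⁻ - G⁺`, the relations force `K = G⁺ + G⁻ = -[J₀,
H]`. This `K` is an `N = 1` supercurrent: it sends `ā` to `a` and `a` to `∂ā`. The Virasoro field is
`S = ½ {K₀, K}`. The nonlinear corrections involve only the anticommuting `w̄ₖ`, so a small calculus
of normally ordered products is enough: brackets with a mode are superderivations (`ad_NO`), and
powers of `w` move out of a product up to explicit contractions (`NO_shift_one_left`).

Five families of mode relations between `J`, `K`, `H`, `S` (`CurrentSystem.seed`) imply the whole `N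
= 2` algebra through super-Jacobi identities (`N2Seed.isN2`). The level of `J` is `4`, one unit for
each conjugate pair, whence `c = 3 · 4 = 12`.

For uniqueness, `J` and `G⁻ - G⁺` determine `G⁺ + G⁻` through the bracket with `J₀`, and then `L`
through `{G⁺₀, G⁻}` (`IsN2.eq_of_superfield_eq`). The choice of dual bases does not matter, because
`∑ eⁱ ⊗ eᵢ` is canonical (`sum_dual_eq`). -/

theorem isQuantumField_iff {A : FormalDist M} :
    IsQuantumField A ↔ ∀ v, ∀ᶠ n : ℤ in atTop, A n v = 0 := by
  simp only [IsQuantumField, eventually_atTop]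

variable (M) in
/-- The space of quantum fields on `M`. -/
structure QField where
  /-- the modes -/
  val : FormalDist M
  isQuantumField : IsQuantumField val

namespace QField

theorem val_injective : Function.Injective (val : QField M → FormalDist M) := by
  rintro ⟨A, hA⟩ ⟨B, hB⟩ rfl
  rfl

instance : Zero (QField M) := ⟨⟨0, fun _ => ⟨0, fun _ _ => rfl⟩⟩⟩

instance : Add (QField M) := ⟨fun A B => ⟨A.1 + B.1, isQuantumField_iff.2 fun v => by
  filter_upwards [isQuantumField_iff.1 A.2 v, isQuantumField_iff.1 B.2 v] with n h1 h2
  simp [h1, h2]⟩⟩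

instance : Neg (QField M) := ⟨fun A => ⟨-A.1, isQuantumField_iff.2 fun v => by
  filter_upwards [isQuantumField_iff.1 A.2 v] with n h1
  simp [h1]⟩⟩

instance : Sub (QField M) := ⟨fun A B => ⟨A.1 - B.1, isQuantumField_iff.2 fun v => by
  filter_upwards [isQuantumField_iff.1 A.2 v, isQuantumField_iff.1 B.2 v] with n h1 h2
  simp [h1, h2]⟩⟩

instance : SMul ℂ (QField M) := ⟨fun c A => ⟨c • A.1, isQuantumField_iff.2 fun v => by
  filter_upwards [isQuantumField_iff.1 A.2 v] with n h1
  simp [h1]⟩⟩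

instance : SMul ℕ (QField M) := ⟨fun c A => ⟨c • A.1, isQuantumField_iff.2 fun v => by
  filter_upwards [isQuantumField_iff.1 A.2 v] with n h1
  simp [h1]⟩⟩

instance : SMul ℤ (QField M) := ⟨fun c A => ⟨c • A.1, isQuantumField_iff.2 fun v => by
  filter_upwards [isQuantumField_iff.1 A.2 v] with n h1
  simp [h1]⟩⟩

instance : AddCommGroup (QField M) :=
  val_injective.addCommGroup val rfl (fun _ _ => rfl) (fun _ => rfl) (fun _ _ => rfl)
    (fun _ _ => rfl) (fun _ _ => rfl)

/-- The modes of a field, as an additive map. -/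
def valHom : QField M →+ FormalDist M where
  toFun := val
  map_zero' := rfl
  map_add' _ _ := rfl

instance : Module ℂ (QField M) := val_injective.module ℂ valHom fun _ _ => rfl

theorem eventually_zero (A : QField M) (v : M) : ∀ᶠ n : ℤ in atTop, A.1 n v = 0 :=
  isQuantumField_iff.1 A.2 v

theorem ext {A B : QField M} (h : ∀ n v, A.1 n v = B.1 n v) : A = B :=
  val_injective (funext fun n => LinearMap.ext fun v => h n v)

@[simp] theorem val_add_apply (A B : QField M) (n : ℤ) : (A + B).1 n = A.1 n + B.1 n := rfl
@[simp] theorem val_sub_apply (A B : QField M) (n : ℤ) : (A - B).1 n = A.1 n - B.1 n := rfl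
@[simp] theorem val_neg_apply (A : QField M) (n : ℤ) : (-A).1 n = -A.1 n := rfl
@[simp] theorem val_smul_apply (c : ℂ) (A : QField M) (n : ℤ) : (c • A).1 n = c • A.1 n := rfl
@[simp] theorem val_zero_apply (n : ℤ) : (0 : QField M).1 n = 0 := rfl

@[simp] theorem val_sum_apply {ι : Type*} (s : Finset ι) (A : ι → QField M) (n : ℤ) :
    (∑ i ∈ s, A i).1 n = ∑ i ∈ s, (A i).1 n :=
  (congrFun (map_sum valHom A s) n).trans (Finset.sum_apply n s fun i => (A i).1)

theorem eventually_nat_zero (A : QField M) (v : M) (n : ℤ) :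
    ∀ᶠ N : ℕ in atTop, ∀ j : ℕ, N ≤ j → A.1 (n + j) v = 0 := by
  obtain ⟨N, hN⟩ := eventually_atTop.1 (eventually_zero A v)
  filter_upwards [eventually_ge_atTop (N - n).toNat] with k hk j hj
  exact hN _ (by omega)

/-- Multiplication of a field by `w ^ r`. -/
def shift (r : ℤ) : QField M →ₗ[ℂ] QField M where
  toFun A := ⟨fun n => A.1 (n + r), fun v => by
    obtain ⟨N, hN⟩ := A.2 v
    exact ⟨N - r, fun n hn => hN _ (by omega)⟩⟩
  map_add' _ _ := rfl
  map_smul' _ _ := rfl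

@[simp] theorem shift_apply (r : ℤ) (A : QField M) (n : ℤ) : (shift r A).1 n = A.1 (n + r) := rfl

theorem shift_shift (r s : ℤ) (A : QField M) : shift r (shift s A) = shift (r + s) A :=
  ext fun n v => by simp [add_assoc]

@[simp] theorem shift_zero (A : QField M) : shift 0 A = A := ext fun n v => by simp

/-- The derivative of a field. -/
def der : QField M →ₗ[ℂ] QField M where
  toFun A := ⟨dField A.1, fun v => by
    obtain ⟨N, hN⟩ := A.2 v
    refine ⟨N + 1, fun n hn => ?_⟩
    simp [dField, hN (n - 1) (by omega)]⟩
  map_add' A B := ext fun n v => by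
    change dField (A.1 + B.1) n v = dField A.1 n v + dField B.1 n v
    simp [dField]
  map_smul' c A := ext fun n v => by
    change dField (c • A.1) n v = c • dField A.1 n v
    simp [dField, smul_comm c]

@[simp] theorem der_apply (A : QField M) (n : ℤ) : (der A).1 n = (-n : ℂ) • A.1 (n - 1) := rfl

theorem der_shift (r : ℤ) (A : QField M) :
    der (shift r A) = shift r (der A) + (r : ℂ) • shift (r - 1) A := ext fun n v => by
  have h : n - 1 + r = n + (r - 1) := by ring
  have h' : n + r - 1 = n + (r - 1) := by ring
  simp only [der_apply, shift_apply, val_add_apply, val_smul_apply, h, h', Int.cast_add,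
    neg_add, add_smul]
  simp

/-- The identity field. -/
def one : QField M := ⟨idField, fun v => ⟨0, fun n hn => by
  have : n ≠ -1 := by omega
  simp [idField, this]⟩⟩

theorem one_apply (n : ℤ) : (one : QField M).1 n = if n = -1 then 1 else 0 := rfl

/-- The super-commutator with an operator `T`, where `η` is the sign of the exchange. -/
def ad (η : ℂ) (T : Module.End ℂ M) : QField M →ₗ[ℂ] QField M where
  toFun A := ⟨fun n => T * A.1 n - η • (A.1 n * T), by
    rw [isQuantumField_iff]
    intro v
    filter_upwards [eventually_zero A v, eventually_zero A (T v)] with n h1 h2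
    simp [h1, h2]⟩
  map_add' A B := ext fun n v => by
    change (T * (A.1 n + B.1 n) - η • ((A.1 n + B.1 n) * T)) v
      = (T * A.1 n - η • (A.1 n * T)) v + (T * B.1 n - η • (B.1 n * T)) v
    simp only [LinearMap.sub_apply, Module.End.mul_apply, LinearMap.add_apply,
      LinearMap.smul_apply, map_add, smul_add]
    abel
  map_smul' c A := ext fun n v => by
    change (T * (c • A.1 n) - η • ((c • A.1 n) * T)) v = c • (T * A.1 n - η • (A.1 n * T)) v
    simp [smul_sub, smul_comm c]

theorem ad_apply (η : ℂ) (T : Module.End ℂ M) (A : QField M) (n : ℤ) :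
    (ad η T A).1 n = T * A.1 n - η • (A.1 n * T) := rfl

/-! ### Normally ordered products: bilinearity, shifts, derivations, exchange of factors -/

/-- The modes of the normally ordered product of two fields, `ε` being the sign of
their exchange. -/
def noMode (ε : ℂ) (A B : QField M) (n : ℤ) (v : M) : M :=
  ∑ᶠ j : ℕ, (A.1 (-1 - j) (B.1 (n + j) v) + ε • B.1 (n - 1 - j) (A.1 j v))

theorem noMode_eventually (ε : ℂ) (A B : QField M) (n : ℤ) (v : M) :
    ∀ᶠ N : ℕ in atTop, noMode ε A B n v =
      ∑ j ∈ Finset.range N, (A.1 (-1 - j) (B.1 (n + j) v) + ε • B.1 (n - 1 - j) (A.1 j v)) := by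
  filter_upwards [eventually_nat_zero A v 0, eventually_nat_zero B v n] with N hA hB
  refine finsum_eq_sum_of_support_subset _ fun j hj => ?_
  rw [Finset.coe_range, Set.mem_Iio]
  by_contra h
  have h1 := hA j (not_lt.1 h)
  rw [zero_add] at h1
  exact hj (by simp [h1, hB j (not_lt.1 h)])

/-- The normally ordered product of two fields, `ε` being the sign of their exchange. -/
def NO (ε : ℂ) : QField M →ₗ[ℂ] QField M →ₗ[ℂ] QField M :=
  LinearMap.mk₂ ℂ
    (fun A B => ⟨fun n =>
      { toFun := noMode ε A B n
        map_add' := fun v w => by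
          obtain ⟨N, h⟩ := ((noMode_eventually ε A B n v).and ((noMode_eventually ε A B n w).and
            (noMode_eventually ε A B n (v + w)))).exists
          rw [h.1, h.2.1, h.2.2, ← Finset.sum_add_distrib]
          refine Finset.sum_congr rfl fun j _ => ?_
          simp only [map_add, smul_add]
          abel
        map_smul' := fun c v => by
          obtain ⟨N, h⟩ := ((noMode_eventually ε A B n v).and
            (noMode_eventually ε A B n (c • v))).exists
          rw [h.1, h.2, Finset.smul_sum]
          refine Finset.sum_congr rfl fun j _ => ?_
          simp only [map_smul, smul_add, RingHom.id_apply, smul_comm ε c] }, by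
      rw [isQuantumField_iff]
      intro v
      -- Only the finitely many `j < NA` have `A j v ≠ 0`, so one bound on `n` serves for all `j`.
      obtain ⟨NA, hA⟩ := (eventually_nat_zero A v 0).exists
      have hB : ∀ᶠ n : ℤ in atTop, ∀ j : ℕ, B.1 (n + j) v = 0 := by
        obtain ⟨N, hN⟩ := B.2 v
        filter_upwards [eventually_ge_atTop N] with n hn j
        exact hN _ (by omega)
      have hAB : ∀ᶠ n : ℤ in atTop, ∀ j ∈ Finset.range NA, B.1 (n - 1 - j) (A.1 j v) = 0 := by
        refine (eventually_all_finset _).2 fun j _ => ?_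
        obtain ⟨N, hN⟩ := B.2 (A.1 j v)
        filter_upwards [eventually_ge_atTop (N + 1 + j)] with n hn
        exact hN _ (by omega)
      filter_upwards [hB, hAB] with n h1 h2
      change noMode ε A B n v = 0
      refine (finsum_congr fun j => ?_).trans finsum_zero
      rw [h1, map_zero, zero_add]
      by_cases hj : j < NA
      · rw [h2 j (Finset.mem_range.2 hj), smul_zero]
      · have := hA j (not_lt.1 hj)
        rw [zero_add] at this
        rw [this, map_zero, smul_zero]⟩)
    (fun A A' B => ext fun n v => by
      change noMode ε (A + A') B n v = noMode ε A B n v + noMode ε A' B n v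
      obtain ⟨N, h⟩ := ((noMode_eventually ε A B n v).and ((noMode_eventually ε A' B n v).and
        (noMode_eventually ε (A + A') B n v))).exists
      rw [h.1, h.2.1, h.2.2, ← Finset.sum_add_distrib]
      refine Finset.sum_congr rfl fun j _ => ?_
      simp only [val_add_apply, LinearMap.add_apply, map_add, smul_add]
      abel)
    (fun c A B => ext fun n v => by
      change noMode ε (c • A) B n v = c • noMode ε A B n v
      obtain ⟨N, h⟩ := ((noMode_eventually ε A B n v).and
        (noMode_eventually ε (c • A) B n v)).exists
      rw [h.1, h.2, Finset.smul_sum]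
      refine Finset.sum_congr rfl fun j _ => ?_
      simp only [val_smul_apply, LinearMap.smul_apply, map_smul, smul_add, smul_comm ε c])
    (fun A B B' => ext fun n v => by
      change noMode ε A (B + B') n v = noMode ε A B n v + noMode ε A B' n v
      obtain ⟨N, h⟩ := ((noMode_eventually ε A B n v).and ((noMode_eventually ε A B' n v).and
        (noMode_eventually ε A (B + B') n v))).exists
      rw [h.1, h.2.1, h.2.2, ← Finset.sum_add_distrib]
      refine Finset.sum_congr rfl fun j _ => ?_
      simp only [val_add_apply, LinearMap.add_apply, map_add, smul_add]
      abel)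
    (fun c A B => ext fun n v => by
      change noMode ε A (c • B) n v = c • noMode ε A B n v
      obtain ⟨N, h⟩ := ((noMode_eventually ε A B n v).and
        (noMode_eventually ε A (c • B) n v)).exists
      rw [h.1, h.2, Finset.smul_sum]
      refine Finset.sum_congr rfl fun j _ => ?_
      simp only [val_smul_apply, LinearMap.smul_apply, map_smul, smul_add, smul_comm ε c])

theorem NO_eventually (ε : ℂ) (A B : QField M) (n : ℤ) (v : M) :
    ∀ᶠ N : ℕ in atTop, (NO ε A B).1 n v =
      ∑ j ∈ Finset.range N, (A.1 (-1 - j) (B.1 (n + j) v) + ε • B.1 (n - 1 - j) (A.1 j v)) :=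
  noMode_eventually ε A B n v

theorem choose_neg_one (j : ℕ) : (Ring.choose (-1 : ℤ) j : ℤ) = (-1) ^ j := by
  rw [Ring.choose_neg', Int.negOnePow_def]
  simp [Units.smul_def]

theorem normalOrd_eq_NO (p q : ZMod 2) (A B : QField M) (n : ℤ) (v : M) :
    normalOrd p q A.1 B.1 n v = (NO (koszul p q) A B).1 n v := by
  refine finsum_congr fun j => ?_
  rw [choose_neg_one]
  -- The alternating sign cancels against the binomial coefficient of `-1` over `j`.
  have h : ((-1 : ℂ) ^ j * (((-1 : ℤ) ^ j : ℤ) : ℂ)) = 1 := by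
    push_cast
    rw [← mul_pow]
    simp
  have h2 : n + -1 - (j : ℤ) = n - 1 - j := by ring
  rw [h, one_smul, h2]
  simp [sub_eq_add_neg]

theorem NO_shift_right (ε : ℂ) (r : ℤ) (A B : QField M) :
    NO ε A (shift r B) = shift r (NO ε A B) := ext fun n v => by
  refine finsum_congr fun j => ?_
  simp only [shift_apply]
  rw [add_right_comm, show n - 1 - (j : ℤ) + r = n + r - 1 - j by ring]

/-- Multiplying `A` by `w` moves the mode `A₀` from the annihilation half, to the right of `B`, into
the creation half, to the left of `B`. The correction is the supercommutator of `A₀` with `B`. -/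
theorem NO_shift_one_left (ε : ℂ) (A B : QField M) :
    NO ε (shift 1 A) B = shift 1 (NO ε A B) + ad ε (A.1 0) B := ext fun n v => by
  obtain ⟨N, h1, h2, hA, hB⟩ := ((NO_eventually ε (shift 1 A) B n v).and
    ((NO_eventually ε A B (n + 1) v).and ((eventually_nat_zero A v 0).and
      (eventually_nat_zero B v n)))).exists
  rw [val_add_apply, shift_apply, LinearMap.add_apply, h1, h2, ad_apply]
  simp only [Finset.sum_add_distrib, shift_apply]
  have e1 := Finset.sum_range_succ' (fun j : ℕ => A.1 (-j) (B.1 (n + j) v)) N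
  rw [Finset.sum_range_succ, hB N le_rfl] at e1
  have e2 := Finset.sum_range_succ' (fun j : ℕ => ε • B.1 (n - j) (A.1 j v)) N
  have hAN := hA N le_rfl
  rw [zero_add] at hAN
  rw [Finset.sum_range_succ, hAN] at e2
  simp only [map_zero, smul_zero, add_zero, Nat.cast_zero, neg_zero, sub_zero] at e1 e2
  have s1 : ∀ j : ℕ, A.1 (-1 - (j : ℤ) + 1) (B.1 (n + j) v) = A.1 (-j) (B.1 (n + j) v) := by
    intro j; rw [show -1 - (j : ℤ) + 1 = -j by ring]
  have s2 : ∀ j : ℕ, A.1 (-1 - (j : ℤ)) (B.1 (n + 1 + j) v)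
      = A.1 (-((j + 1 : ℕ) : ℤ)) (B.1 (n + ((j + 1 : ℕ) : ℤ)) v) := by
    intro j
    rw [show -1 - (j : ℤ) = -((j + 1 : ℕ) : ℤ) by push_cast; ring,
      show n + 1 + (j : ℤ) = n + ((j + 1 : ℕ) : ℤ) by push_cast; ring]
  have s3 : ∀ j : ℕ, ε • B.1 (n - 1 - (j : ℤ)) (A.1 ((j : ℤ) + 1) v)
      = ε • B.1 (n - ((j + 1 : ℕ) : ℤ)) (A.1 ((j + 1 : ℕ) : ℤ) v) := by
    intro j
    rw [show n - 1 - (j : ℤ) = n - ((j + 1 : ℕ) : ℤ) by push_cast; ring,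
      show (j : ℤ) + 1 = ((j + 1 : ℕ) : ℤ) by push_cast; ring]
  have s4 : ∀ j : ℕ, ε • B.1 (n + 1 - 1 - (j : ℤ)) (A.1 j v)
      = ε • B.1 (n - j) (A.1 j v) := by
    intro j; rw [add_sub_cancel_right]
  simp only [s1, s2, s3, s4, e1, e2, LinearMap.sub_apply, Module.End.mul_apply,
    LinearMap.smul_apply]
  abel

/-- Two fields whose modes commute up to the sign `ε`. -/
def SComm (ε : ℂ) (A B : QField M) : Prop :=
  ∀ m n, A.1 m * B.1 n = ε • (B.1 n * A.1 m)

theorem NO_shift_left_of_comm {ε : ℂ} {A B : QField M} (h : SComm ε A B) (r : ℤ) :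
    NO ε (shift r A) B = shift r (NO ε A B) := by
  have key : ∀ r : ℤ, NO ε (shift (r + 1) A) B = shift 1 (NO ε (shift r A) B) := fun r => by
    have h1 : ad ε ((shift r A).1 0) B = 0 := ext fun n v => by
      rw [ad_apply, shift_apply, h, sub_self]; rfl
    rw [add_comm r 1, ← shift_shift, NO_shift_one_left, h1, add_zero]
  induction r using Int.induction_on with
  | zero => simp
  | succ r ih => rw [key, ih, shift_shift, add_comm (1 : ℤ)]
  | pred r ih =>
    have h1 := key (-(r : ℤ) - 1)
    rw [sub_add_cancel, ih] at h1
    have h2 := congrArg (shift (-1)) h1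
    rw [shift_shift, shift_shift] at h2
    simpa [sub_eq_add_neg, add_comm] using h2.symm

theorem der_NO (ε : ℂ) (A B : QField M) :
    der (NO ε A B) = NO ε (der A) B + NO ε A (der B) := ext fun n v => by
  obtain ⟨N, h1, h2, h3, hA, hB⟩ := ((NO_eventually ε A B (n - 1) v).and
    ((NO_eventually ε (der A) B n v).and ((NO_eventually ε A (der B) n v).and
      ((eventually_nat_zero A v (-1)).and
      (eventually_nat_zero B v (n - 1)))))).exists
  rw [val_add_apply, LinearMap.add_apply, der_apply, LinearMap.smul_apply, h1, h2, h3]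
  -- The two halves are compared after the reindexing `j ↦ j + 1`. The weight `j` kills the boundary
  -- term at `0`, and the field property kills the one at `N`.
  have e1 := Finset.sum_range_succ'
    (fun j : ℕ => (j : ℂ) • A.1 (-1 - j) (B.1 (n - 1 + j) v)) N
  rw [Finset.sum_range_succ, hB N le_rfl] at e1
  have e2 := Finset.sum_range_succ'
    (fun j : ℕ => ((j : ℂ) * ε) • B.1 (n - 1 - j) (A.1 (-1 + j) v)) N
  rw [Finset.sum_range_succ, hA N le_rfl] at e2
  simp only [map_zero, smul_zero, add_zero, Nat.cast_zero, zero_smul, zero_mul] at e1 e2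
  have s1 : ∀ j : ℕ, (der A).1 (-1 - j) (B.1 (n + j) v)
      = ((j + 1 : ℕ) : ℂ) • A.1 (-1 - ((j + 1 : ℕ) : ℤ)) (B.1 (n - 1 + ((j + 1 : ℕ) : ℤ)) v) := by
    intro j
    rw [der_apply, show -1 - (j : ℤ) - 1 = -1 - ((j + 1 : ℕ) : ℤ) by push_cast; ring,
      show n + (j : ℤ) = n - 1 + ((j + 1 : ℕ) : ℤ) by push_cast; ring, LinearMap.smul_apply]
    congr 1
    push_cast; ring
  have s2 : ∀ j : ℕ, A.1 (-1 - j) ((der B).1 (n + j) v)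
      = (-(n + j) : ℂ) • A.1 (-1 - j) (B.1 (n - 1 + j) v) := by
    intro j
    rw [der_apply, show n + (j : ℤ) - 1 = n - 1 + j by ring, LinearMap.smul_apply, map_smul]
    push_cast; rfl
  have s3 : ∀ j : ℕ, ε • B.1 (n - 1 - j) ((der A).1 j v)
      = -(((j : ℂ) * ε) • B.1 (n - 1 - j) (A.1 (-1 + j) v)) := by
    intro j
    rw [der_apply, show (j : ℤ) - 1 = -1 + j by ring, LinearMap.smul_apply, map_smul, smul_smul,
      ← neg_smul]
    push_cast
    congr 1; ring
  have s4 : ∀ j : ℕ, ε • (der B).1 (n - 1 - j) (A.1 j v)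
      = -(((n : ℂ) - (j + 1 : ℕ)) * ε) •
        B.1 (n - 1 - ((j + 1 : ℕ) : ℤ)) (A.1 (-1 + ((j + 1 : ℕ) : ℤ)) v) := by
    intro j
    rw [der_apply, show n - 1 - (j : ℤ) - 1 = n - 1 - ((j + 1 : ℕ) : ℤ) by push_cast; ring,
      show -1 + ((j + 1 : ℕ) : ℤ) = j by push_cast; ring, LinearMap.smul_apply, smul_smul]
    congr 1
    push_cast; ring
  have s5 : ∀ j : ℕ, ε • B.1 (n - 1 - 1 - (j : ℤ)) (A.1 j v) = ε •
        B.1 (n - 1 - ((j + 1 : ℕ) : ℤ)) (A.1 (-1 + ((j + 1 : ℕ) : ℤ)) v) := by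
    intro j
    rw [show -1 + ((j + 1 : ℕ) : ℤ) = j by push_cast; ring,
      show n - 1 - 1 - (j : ℤ) = n - 1 - ((j + 1 : ℕ) : ℤ) by push_cast; ring]
  simp only [s1, s2, s3, s4, s5, Finset.sum_add_distrib, smul_add, Finset.smul_sum]
  rw [← e1, Finset.sum_neg_distrib, e2, ← sub_eq_zero, ← Finset.sum_neg_distrib]
  have t1 : ∀ j : ℕ, (-n : ℂ) • A.1 (-1 - (j : ℤ)) (B.1 (n - 1 + j) v)
      = (j : ℂ) • A.1 (-1 - (j : ℤ)) (B.1 (n - 1 + j) v)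
        + (-(n + j) : ℂ) • A.1 (-1 - j) (B.1 (n - 1 + j) v) := by
    intro j; rw [← add_smul]; congr 1; ring
  have t2 : ∀ (j : ℕ) (x : M), (-n : ℂ) • ε • x
      = -((((j + 1 : ℕ) : ℂ) * ε) • x) + (-(((n : ℂ) - (j + 1 : ℕ)) * ε)) • x := by
    intro j x; rw [← neg_smul, ← add_smul, smul_smul]; congr 1; ring
  rw [Finset.sum_congr rfl fun j _ => t1 j, Finset.sum_congr rfl fun j _ => t2 j _]
  simp only [Finset.sum_add_distrib]
  abel

/-- Here `ηA`, `ηB`, `ε` stand for the Koszul signs of the exchanges `T`–`A`, `T`–`B` and `A`–`B`,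
while `εA` and `εB` are the signs once `A`, respectively `B`, has absorbed `T`. With these signs the
derivation rule holds term by term in the defining sum. -/
theorem ad_NO {ηA ηB ε εA εB : ℂ} (hA : ηA * ηA = 1) (h1 : εA = ε * ηB) (h2 : εB = ε * ηA)
    (T : Module.End ℂ M) (A B : QField M) :
    ad (ηA * ηB) T (NO ε A B) = NO εA (ad ηA T A) B + ηA • NO εB A (ad ηB T B) :=
  ext fun n v => by
  obtain ⟨N, e1, e2, e3, e4⟩ := ((NO_eventually ε A B n v).and
    ((NO_eventually ε A B n (T v)).and ((NO_eventually εA (ad ηA T A) B n v).and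
      (NO_eventually εB A (ad ηB T B) n v)))).exists
  simp only [val_add_apply, LinearMap.add_apply, val_smul_apply, LinearMap.smul_apply]
  rw [ad_apply, e3, e4, LinearMap.sub_apply, LinearMap.smul_apply, Module.End.mul_apply,
    Module.End.mul_apply, e1, e2]
  simp only [map_sum, Finset.smul_sum, ← Finset.sum_add_distrib, ← Finset.sum_sub_distrib]
  refine Finset.sum_congr rfl fun j _ => ?_
  subst h1 h2
  simp only [ad_apply, LinearMap.sub_apply, Module.End.mul_apply, LinearMap.smul_apply, map_add,
    map_sub, map_smul, smul_sub, smul_add, smul_smul]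
  have c1 : ηA * (ε * ηA) = ε := by linear_combination ε * hA
  have c2 : ηA * (ε * ηA * ηB) = ε * ηB := by linear_combination ε * ηB * hA
  have c3 : ηA * ηB * ε = ε * ηB * ηA := by ring
  rw [c1, c2, c3]
  abel

theorem NO_one_right (A : QField M) : NO 1 A one = A := ext fun n v => by
  obtain ⟨N, h, hN⟩ := ((NO_eventually 1 A one n v).and
    (eventually_gt_atTop n.natAbs)).exists
  rw [h]
  -- The only surviving term `A n v` sits in the creation half for `n < 0` and in the annihilation
  -- half for `n ≥ 0`.
  rcases lt_or_ge n 0 with hn | hn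
  · rw [Finset.sum_eq_single (-1 - n).toNat]
    · rw [one_apply, one_apply, if_pos (by omega), if_neg (by omega)]
      simp only [LinearMap.zero_apply, smul_zero, add_zero, Module.End.one_apply]
      rw [show -1 - ((-1 - n).toNat : ℤ) = n by omega]
    · intro j _ hj
      rw [one_apply, one_apply, if_neg (by omega), if_neg (by omega)]
      simp
    · intro hj
      rw [Finset.mem_range] at hj
      omega
  · rw [Finset.sum_eq_single n.toNat]
    · rw [one_apply, one_apply, if_neg (by omega), if_pos (by omega)]
      simp only [LinearMap.zero_apply, map_zero, zero_add, one_smul, Module.End.one_apply]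
      rw [show (n.toNat : ℤ) = n by omega]
    · intro j _ hj
      rw [one_apply, one_apply, if_neg (by omega), if_neg (by omega)]
      simp
    · intro hj
      rw [Finset.mem_range] at hj
      omega

theorem NO_one_left (B : QField M) : NO 1 one B = B := ext fun n v => by
  obtain ⟨N, h, hN⟩ := ((NO_eventually 1 one B n v).and
    (eventually_gt_atTop 0)).exists
  rw [h, Finset.sum_eq_single 0]
  · simp [one_apply]
  · intro j _ hj
    rw [one_apply, one_apply, if_neg (by omega), if_neg (by omega)]
    simp
  · intro hj
    rw [Finset.mem_range] at hj
    omega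

theorem SComm.one_left (B : QField M) : SComm 1 one B := fun m n => by
  rw [one_apply]; split_ifs <;> simp

theorem NO_shift_one_right (r : ℤ) (A : QField M) : NO 1 A (shift r one) = shift r A := by
  rw [NO_shift_right, NO_one_right]

theorem NO_shift_id_left (r : ℤ) (B : QField M) : NO 1 (shift r one) B = shift r B := by
  rw [NO_shift_left_of_comm (SComm.one_left B), NO_one_left]

/-- The modes of the normally ordered product as a sum over all pairs of modes, if these commute. -/
theorem NO_eq_finsum_of_comm {ε : ℂ} {A B : QField M} {n : ℤ}
    (h : ∀ i, A.1 i * B.1 (n - 1 - i) = ε • (B.1 (n - 1 - i) * A.1 i)) (v : M) :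
    (NO ε A B).1 n v = ∑ᶠ i : ℤ, A.1 i (B.1 (n - 1 - i) v) := by
  obtain ⟨N, e1, hA, hB⟩ := ((NO_eventually ε A B n v).and
    ((eventually_nat_zero A v 0).and (eventually_nat_zero B v n))).exists
  have hc : ∀ i, ε • B.1 (n - 1 - i) (A.1 i v) = A.1 i (B.1 (n - 1 - i) v) := fun i =>
    (LinearMap.congr_fun (h i) v).symm
  have hz : ∀ i : ℤ, (N : ℤ) ≤ i → A.1 i v = 0 := fun i hi => by
    obtain ⟨k, rfl⟩ := Int.eq_ofNat_of_zero_le (by omega : (0 : ℤ) ≤ i)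
    simpa using hA k (by omega)
  have hz' : ∀ i : ℤ, n + (N : ℤ) ≤ i → B.1 i v = 0 := fun i hi => by
    obtain ⟨k, hk⟩ := Int.eq_ofNat_of_zero_le (by omega : (0 : ℤ) ≤ i - n)
    have := hB k (by omega)
    rwa [show n + (k : ℤ) = i by omega] at this
  -- The creation half is the sum over `i = -1 - j < 0`, the annihilation half, with its factors
  -- exchanged, the sum over `i = j ≥ 0`.
  rw [e1, Finset.sum_add_distrib, finsum_eq_sum_of_support_subset (s := Finset.Ico (-N : ℤ) N)]
  · rw [← Finset.Ico_union_Ico_eq_Ico (show (-N : ℤ) ≤ 0 by omega) (by omega : (0 : ℤ) ≤ N),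
      Finset.sum_union (Finset.Ico_disjoint_Ico_consecutive _ _ _)]
    congr 1
    · refine Finset.sum_bij' (fun j _ => -1 - (j : ℤ)) (fun i _ => (-1 - i).toNat) ?_ ?_ ?_ ?_ ?_
      · intro j hj; rw [Finset.mem_range] at hj; rw [Finset.mem_Ico]; omega
      · intro j hj; rw [Finset.mem_Ico] at hj; rw [Finset.mem_range]; omega
      · intro j hj; omega
      · intro j hj; rw [Finset.mem_Ico] at hj; omega
      · intro j hj
        rw [show n - 1 - (-1 - (j : ℤ)) = n + j by ring]
    · refine Finset.sum_bij' (fun j _ => (j : ℤ)) (fun i _ => i.toNat) ?_ ?_ ?_ ?_ ?_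
      · intro j hj; rw [Finset.mem_range] at hj; rw [Finset.mem_Ico]; omega
      · intro j hj; rw [Finset.mem_Ico] at hj; rw [Finset.mem_range]; omega
      · intro j hj; omega
      · intro j hj; rw [Finset.mem_Ico] at hj; omega
      · intro j hj
        exact hc _
  · intro i hi
    rw [Finset.coe_Ico, Set.mem_Ico]
    by_contra hcon
    apply hi
    change A.1 i (B.1 (n - 1 - i) v) = 0
    rcases lt_or_ge i (N : ℤ) with h1 | h1
    · rw [hz' _ (by omega), map_zero]
    · rw [← hc, hz _ h1, map_zero, smul_zero]

theorem SComm.symm {ε : ℂ} (hε : ε * ε = 1) {A B : QField M} (h : SComm ε A B) :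
    SComm ε B A := fun m n => by
  rw [h n m, smul_smul, hε, one_smul]

theorem NO_swap_apply {ε : ℂ} (hε : ε * ε = 1) {A B : QField M} {n : ℤ}
    (h : ∀ i, A.1 i * B.1 (n - 1 - i) = ε • (B.1 (n - 1 - i) * A.1 i)) (v : M) :
    (NO ε A B).1 n v = ε • (NO ε B A).1 n v := by
  have h' : ∀ i, B.1 i * A.1 (n - 1 - i) = ε • (A.1 (n - 1 - i) * B.1 i) := fun i => by
    have := h (n - 1 - i)
    rw [sub_sub_cancel] at this
    rw [this, smul_smul, hε, one_smul]
  rw [NO_eq_finsum_of_comm h, NO_eq_finsum_of_comm h']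
  rw [smul_finsum, ← finsum_comp_equiv (Equiv.subLeft (n - 1))]
  refine finsum_congr fun i => ?_
  rw [Equiv.subLeft_apply, sub_sub_cancel]
  have := h (n - 1 - i)
  rw [sub_sub_cancel] at this
  exact LinearMap.congr_fun this v

theorem NO_swap_of_comm {ε : ℂ} (hε : ε * ε = 1) {A B : QField M} (h : SComm ε A B) :
    NO ε A B = ε • NO ε B A := ext fun _ v => NO_swap_apply hε (fun _ => h _ _) v

/-- The modes multiplied in the `n`-th mode of the product have indices of sum `n - 1`, and
conjugate fermions anticommute unless the indices sum to `-1`. Only `n = 0` escapes `NO_swap_apply`,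
and there the defining sum is antisymmetric term by term. -/
theorem NO_swap_of_conj {A B : QField M} (h : ∀ m, ad (-1) (A.1 m) B = shift m one) :
    NO (-1) A B = -NO (-1) B A := ext fun n v => by
  by_cases hn : n = 0
  · subst hn
    obtain ⟨N, h1, h2⟩ := ((NO_eventually (-1) A B 0 v).and (NO_eventually (-1) B A 0 v)).exists
    rw [val_neg_apply, LinearMap.neg_apply, h1, h2, ← Finset.sum_neg_distrib]
    refine Finset.sum_congr rfl fun j _ => ?_
    rw [zero_add, zero_sub, neg_one_smul, neg_one_smul]
    abel
  · rw [val_neg_apply, LinearMap.neg_apply, NO_swap_apply (by norm_num) (fun i => ?_),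
      neg_one_smul]
    have h1 := congrFun (congrArg val (h i)) (n - 1 - i)
    rw [ad_apply, shift_apply, one_apply, if_neg (by omega)] at h1
    exact sub_eq_zero.1 h1

theorem ad_swap (η : ℂ) (hη : η * η = 1) (S T : Module.End ℂ M) :
    S * T - η • (T * S) = -η • (T * S - η • (S * T)) := by
  rw [smul_sub, smul_smul, neg_mul, hη, neg_smul, neg_smul, one_smul]; abel

end QField

end FieldCalculus

end DoubledTorus

end

noncomputable section

namespace DoubledTorus

/-! ### The `N = 2` algebra from a current and a supercurrent -/

/-! ### Super-Jacobi identities in an associative ring -/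

section SuperJacobi

variable {E : Type*} [Ring E]

theorem lie_anticomm_eq (x y z : E) :
    x * (y * z + z * y) - (y * z + z * y) * x
      = ((x * y - y * x) * z + z * (x * y - y * x))
        + (y * (x * z - z * x) + (x * z - z * x) * y) := by
  noncomm_ring

theorem anticomm_lie_eq (x y z : E) :
    (y * (z * x - x * z) + (z * x - x * z) * y) + (z * (y * x - x * y) + (y * x - x * y) * z)
      = (y * z + z * y) * x - x * (y * z + z * y) := by
  noncomm_ring

theorem anticomm_comm_eq (x y z : E) :
    (x * y + y * x) * z - z * (x * y + y * x)
      = (x * (y * z + z * y) - (y * z + z * y) * x)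
        + (y * (x * z + z * x) - (x * z + z * x) * y) := by
  noncomm_ring

theorem lie_anticomm_of_sq_zero (x y : E) (h : x * x = 0) :
    (x * y + y * x) * x - x * (x * y + y * x) = 0 := by
  have : (x * y + y * x) * x - x * (x * y + y * x) = y * (x * x) - (x * x) * y := by noncomm_ring
  rw [this, h]; simp

end SuperJacobi

/-! ### From the seed relations to the `N = 2` algebra -/

section N2

variable {M : Type*} [AddCommGroup M] [Module ℂ M]

theorem idField_mul (n : ℤ) (T : Module.End ℂ M) :
    idField (M := M) n * T = T * idField (M := M) n := by
  unfold idField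
  split_ifs
  · rfl
  · simp

theorem two_mul_choose_two (m : ℤ) : 2 * (Ring.choose m 2 : ℤ) = m * (m - 1) := by
  have h := Ring.descPochhammer_eq_factorial_smul_choose m 2
  simp [descPochhammer_succ_right, Polynomial.smeval_mul, Polynomial.smeval_sub,
    Polynomial.smeval_X] at h
  linarith

theorem six_mul_choose_three (m : ℤ) : 6 * (Ring.choose m 3 : ℤ) = m * (m - 1) * (m - 2) := by
  have h := Ring.descPochhammer_eq_factorial_smul_choose m 3
  have h2 : (2 : Polynomial ℤ).smeval m = 2 := by
    simpa using Polynomial.smeval_natCast ℤ m 2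
  simp [descPochhammer_succ_right, Polynomial.smeval_mul, Polynomial.smeval_sub,
    Polynomial.smeval_X, Nat.factorial, h2] at h
  linarith

theorem choose_two_cast (m : ℤ) :
    ((Ring.choose m 2 : ℤ) : ℂ) = (m : ℂ) * ((m : ℂ) - 1) / 2 := by
  have h : ((2 * (Ring.choose m 2 : ℤ) : ℤ) : ℂ) = ((m * (m - 1) : ℤ) : ℂ) := by
    rw [two_mul_choose_two]
  push_cast at h
  linear_combination h / 2

theorem choose_three_cast (m : ℤ) :
    ((Ring.choose m 3 : ℤ) : ℂ) = (m : ℂ) * ((m : ℂ) - 1) * ((m : ℂ) - 2) / 6 := by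
  have h : ((6 * (Ring.choose m 3 : ℤ) : ℤ) : ℂ) = ((m * (m - 1) * (m - 2) : ℤ) : ℂ) := by
    rw [six_mul_choose_three]
  push_cast at h
  linear_combination h / 6

/-- Mode relations between a `U(1)` current `J`, a supercurrent `K`, its companion `H` and the
Virasoro modes `S` which generate the `N = 2` algebra of central charge `3 k`. -/
structure N2Seed (k : ℂ) (J K H S : FormalDist M) : Prop where
  JJ : ∀ m n, J m * J n - J n * J m = (k * m) • idField (m + n - 1)
  JK : ∀ m n, J m * K n - K n * J m = -H (m + n)
  JH : ∀ m n, J m * H n - H n * J m = -K (m + n)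
  KK : ∀ m n, K m * K n + K n * K m
    = (2 : ℂ) • S (m + n) + (k * m * (m - 1)) • idField (m + n - 2)
  SJ : ∀ m n, S m * J n - J n * S m = (-n : ℂ) • J (m + n - 1)

namespace N2Seed

variable {k : ℂ} {J K H S : FormalDist M}

theorem idField_mul_cond (f g : ℂ) (n : ℤ) (h : n = -1 → f = g) :
    f • idField (M := M) n = g • idField n := by
  by_cases hn : n = -1
  · rw [h hn]
  · simp [idField, hn]

/-- Since `H b = [K a, J (b - a)]`, the Jacobi identity for `J (b - a)` and `{K a, K a}` expresses
`{K a, H b}` through the known bracket of `S (2 a)` with `J (b - a)`. -/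
theorem KH (h : N2Seed k J K H S) (a b : ℤ) :
    K a * H b + H b * K a = ((a : ℂ) - b) • J (a + b - 1) := by
  have h1 := anticomm_lie_eq (J (b - a)) (K a) (K a)
  have h2 : K a * J (b - a) - J (b - a) * K a = H b := by
    have := h.JK (b - a) a
    rw [sub_add_cancel] at this
    rw [← neg_sub, this, neg_neg]
  rw [h2, h.KK] at h1
  have h3 := h.SJ (a + a) (b - a)
  rw [show a + a + (b - a) - 1 = a + b - 1 by ring] at h3
  have h4 := idField_mul (a + a - 2) (J (b - a))
  simp only [add_mul, mul_add, smul_mul_assoc, mul_smul_comm, h4] at h1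
  push_cast at h3
  linear_combination (norm := module) (1 / 2 : ℂ) • h1 + h3

/-- `{K m, H n}` is a multiple of a mode of `J`, which commutes with `J 0`. Expanding its bracket
with `J 0` by Jacobi gives `{H m, H n} + {K m, K n} = 0`. -/
theorem HH (h : N2Seed k J K H S) (m n : ℤ) :
    H m * H n + H n * H m
      = (-2 : ℂ) • S (m + n) - (k * m * (m - 1)) • idField (m + n - 2) := by
  have h1 := lie_anticomm_eq (J 0) (K m) (H n)
  rw [h.JK, h.JH, h.KH, zero_add, zero_add, mul_smul_comm, smul_mul_assoc, ← smul_sub, h.JJ] at h1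
  have h2 := h.KK m n
  simp only [neg_mul, mul_neg] at h1
  push_cast at h1
  linear_combination (norm := module) h1 - h2

/-- The generators of the `N = 2` algebra attached to a seed. -/
def data (J K H S : FormalDist M) : N2Data M where
  L := S
  J := J
  Gp := (1 / 2 : ℂ) • (K - H)
  Gm := (1 / 2 : ℂ) • (K + H)

theorem GpGp_anticomm (h : N2Seed k J K H S) (m n : ℤ) :
    (data J K H S).Gp m * (data J K H S).Gp n + (data J K H S).Gp n * (data J K H S).Gp m
      = 0 := by
  have h1 := h.KK m n
  have h2 := h.HH m n
  have h3 := h.KH m n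
  have h4 := h.KH n m
  rw [add_comm n m] at h4
  simp only [data, Pi.smul_apply, Pi.sub_apply, smul_mul_assoc, mul_smul_comm, mul_sub, sub_mul]
  linear_combination (norm := module) (1 / 4 : ℂ) • (h1 + h2 - h3 - h4)

theorem GmGm_anticomm (h : N2Seed k J K H S) (m n : ℤ) :
    (data J K H S).Gm m * (data J K H S).Gm n + (data J K H S).Gm n * (data J K H S).Gm m
      = 0 := by
  have h1 := h.KK m n
  have h2 := h.HH m n
  have h3 := h.KH m n
  have h4 := h.KH n m
  rw [add_comm n m] at h4
  simp only [data, Pi.smul_apply, Pi.add_apply, smul_mul_assoc, mul_smul_comm, mul_add, add_mul]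
  linear_combination (norm := module) (1 / 4 : ℂ) • (h1 + h2 + h3 + h4)

theorem GpGm_anticomm (h : N2Seed k J K H S) (m n : ℤ) :
    (data J K H S).Gp m * (data J K H S).Gm n + (data J K H S).Gm n * (data J K H S).Gp m
      = S (m + n) + (((m : ℂ) - n) / 2) • J (m + n - 1)
        + (k * m * (m - 1) / 2) • idField (m + n - 2) := by
  have h1 := h.KK m n
  have h2 := h.HH m n
  have h3 := h.KH m n
  have h4 := h.KH n m
  rw [add_comm n m] at h4
  simp only [data, Pi.smul_apply, Pi.add_apply, Pi.sub_apply, smul_mul_assoc, mul_smul_comm,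
    mul_add, add_mul, mul_sub, sub_mul]
  linear_combination (norm := module) (1 / 4 : ℂ) • (h1 - h2 + h3 - h4)

theorem JGp_comm (h : N2Seed k J K H S) (m n : ℤ) :
    J m * (data J K H S).Gp n - (data J K H S).Gp n * J m = (data J K H S).Gp (m + n) := by
  have h1 := h.JK m n
  have h2 := h.JH m n
  simp only [data, Pi.smul_apply, Pi.sub_apply, smul_mul_assoc, mul_smul_comm, mul_sub, sub_mul]
  linear_combination (norm := module) (1 / 2 : ℂ) • (h1 - h2)

theorem JGm_comm (h : N2Seed k J K H S) (m n : ℤ) :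
    J m * (data J K H S).Gm n - (data J K H S).Gm n * J m = -(data J K H S).Gm (m + n) := by
  have h1 := h.JK m n
  have h2 := h.JH m n
  simp only [data, Pi.smul_apply, Pi.add_apply, smul_mul_assoc, mul_smul_comm, mul_add, add_mul]
  linear_combination (norm := module) (1 / 2 : ℂ) • (h1 + h2)

/-- `Gp n` squares to zero, hence commutes with its anticommutator with `Gm (m - n)`. That
anticommutator is `S m` plus a multiple of `J (m - 1)` plus a central term, so the bracket with `S
m` can be read off from the one with `J (m - 1)`. -/
theorem SGp_comm (h : N2Seed k J K H S) (m n : ℤ) :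
    S m * (data J K H S).Gp n - (data J K H S).Gp n * S m
      = ((m : ℂ) / 2 - n) • (data J K H S).Gp (m + n - 1) := by
  have sq : (data J K H S).Gp n * (data J K H S).Gp n = 0 := by
    have := h.GpGp_anticomm n n
    rw [← two_smul ℂ] at this
    exact (smul_eq_zero.1 this).resolve_left two_ne_zero
  have h1 := lie_anticomm_of_sq_zero _ ((data J K H S).Gm (m - n)) sq
  rw [h.GpGm_anticomm] at h1
  rw [show n + (m - n) = m by ring] at h1
  have h2 := h.JGp_comm (m - 1) n
  rw [show m - 1 + n = m + n - 1 by ring] at h2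
  have h3 := idField_mul (m - 2) ((data J K H S).Gp n)
  simp only [add_mul, mul_add, smul_mul_assoc, mul_smul_comm, h3] at h1
  push_cast at h1
  linear_combination (norm := module) h1 - ((2 * (n : ℂ) - m) / 2) • h2

theorem SGm_comm (h : N2Seed k J K H S) (m n : ℤ) :
    S m * (data J K H S).Gm n - (data J K H S).Gm n * S m
      = ((m : ℂ) / 2 - n) • (data J K H S).Gm (m + n - 1) := by
  have sq : (data J K H S).Gm n * (data J K H S).Gm n = 0 := by
    have := h.GmGm_anticomm n n
    rw [← two_smul ℂ] at this
    exact (smul_eq_zero.1 this).resolve_left two_ne_zero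
  have h1 := lie_anticomm_of_sq_zero _ ((data J K H S).Gp (m - n)) sq
  have h0 := h.GpGm_anticomm (m - n) n
  rw [add_comm] at h0
  rw [h0] at h1
  rw [show m - n + n = m by ring] at h1
  have h2 := h.JGm_comm (m - 1) n
  rw [show m - 1 + n = m + n - 1 by ring] at h2
  have h3 := idField_mul (m - 2) ((data J K H S).Gm n)
  simp only [add_mul, mul_add, smul_mul_assoc, mul_smul_comm, h3] at h1
  push_cast at h1
  linear_combination (norm := module) h1 - (((m : ℂ) - 2 * n) / 2) • h2

/-- `S n` is a summand of `{Gp n, Gm 0}`, so its bracket with `S m` follows from the action of `S m`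
on `Gp`, `Gm` and `J`. -/
theorem SS_comm (h : N2Seed k J K H S) (m n : ℤ) :
    S m * S n - S n * S m = ((m : ℂ) - n) • S (m + n - 1)
      + (k * m * (m - 1) * (m - 2) / 4) • idField (m + n - 3) := by
  have h1 := lie_anticomm_eq (S m) ((data J K H S).Gp n) ((data J K H S).Gm 0)
  rw [h.SGp_comm, h.SGm_comm] at h1
  simp only [smul_mul_assoc, mul_smul_comm, ← smul_add] at h1
  rw [h.GpGm_anticomm, h.GpGm_anticomm, h.GpGm_anticomm] at h1
  have h2 := h.SJ m (n - 1)
  have h3 := idField_mul (n - 2) (S m)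
  simp only [add_mul, mul_add, smul_mul_assoc, mul_smul_comm, h3, add_zero] at h1
  simp only [show m + n - 1 - 1 = m + n - 2 by ring, show m + n - 1 - 2 = m + n - 3 by ring,
    show m + (n - 1) - 1 = m + n - 2 by ring, show n + (m - 1) = m + n - 1 by ring] at h1 h2
  -- The central coefficients differ as polynomials in `m` and `n`; they agree where `idField` is
  -- nonzero, which is at `m + n = 2`.
  have h4 : (((m : ℂ) / 2 - n) * (k * (m + n - 1) * (m + n - 2) / 2)
      + ((m : ℂ) / 2) * (k * n * (n - 1) / 2)) • idField (M := M) (m + n - 3)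
      = (k * m * (m - 1) * (m - 2) / 4) • idField (m + n - 3) := by
    refine idField_mul_cond _ _ _ fun hn => ?_
    have hn' : (n : ℂ) = 2 - m := by
      have : n = 2 - m := by omega
      rw [this]; push_cast; ring
    rw [hn']; ring
  push_cast at h1 h2
  linear_combination (norm := module) h1 - ((n : ℂ) / 2) • h2 + h4

theorem koszul_zero_left (q : ZMod 2) : koszul 0 q = 1 := by simp [koszul]

theorem koszul_one_one : koszul 1 1 = -1 := by simp [koszul]

theorem isN2 (h : N2Seed k J K H S) (Sp : ZMod 2 → Submodule ℂ M)
    (fS : IsQuantumField S) (fJ : IsQuantumField J)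
    (fGp : IsQuantumField (data J K H S).Gp) (fGm : IsQuantumField (data J K H S).Gm)
    (pS : HasParity Sp 0 S) (pJ : HasParity Sp 0 J)
    (pGp : HasParity Sp 1 (data J K H S).Gp) (pGm : HasParity Sp 1 (data J K H S).Gm) :
    IsN2 Sp (3 * k) (data J K H S) where
  field_L := fS
  field_J := fJ
  field_Gp := fGp
  field_Gm := fGm
  parity_L := pS
  parity_J := pJ
  parity_Gp := pGp
  parity_Gm := pGm
  LL m n := by
    rw [koszul_zero_left, one_smul]
    refine (h.SS_comm m n).trans ?_
    simp only [List.length_cons, List.length_nil, Fin.sum_univ_succ, List.get_eq_getElem,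
      Finset.univ_unique, Finset.sum_singleton, Fin.val_zero, Fin.val_succ, Fin.default_eq_zero,
      List.getElem_cons_zero, List.getElem_cons_succ, zero_add, Nat.reduceAdd,
      Ring.choose_zero_right, Ring.choose_one_right, choose_two_cast, choose_three_cast,
      Pi.smul_apply, Pi.zero_apply, dField, data, Nat.cast_zero, Nat.cast_one, sub_zero,
      Nat.cast_ofNat]
    push_cast
    module
  LJ m n := by
    rw [koszul_zero_left, one_smul]
    refine (h.SJ m n).trans ?_
    simp only [List.length_cons, List.length_nil, Fin.sum_univ_succ, List.get_eq_getElem,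
      Finset.univ_unique, Finset.sum_singleton, Fin.val_zero, Fin.val_succ, Fin.default_eq_zero,
      List.getElem_cons_zero, List.getElem_cons_succ, zero_add,
      Ring.choose_zero_right, Ring.choose_one_right,
      dField, data, Nat.cast_zero, Nat.cast_one, sub_zero]
    push_cast
    module
  LGp m n := by
    rw [koszul_zero_left, one_smul]
    refine (h.SGp_comm m n).trans ?_
    simp only [List.length_cons, List.length_nil, Fin.sum_univ_succ, List.get_eq_getElem,
      Finset.univ_unique, Finset.sum_singleton, Fin.val_zero, Fin.val_succ, Fin.default_eq_zero,
      List.getElem_cons_zero, List.getElem_cons_succ, zero_add,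
      Ring.choose_zero_right, Ring.choose_one_right, Pi.smul_apply (3 / 2 : ℂ),
      dField, Nat.cast_zero, Nat.cast_one, sub_zero]
    push_cast
    module
  LGm m n := by
    rw [koszul_zero_left, one_smul]
    refine (h.SGm_comm m n).trans ?_
    simp only [List.length_cons, List.length_nil, Fin.sum_univ_succ, List.get_eq_getElem,
      Finset.univ_unique, Finset.sum_singleton, Fin.val_zero, Fin.val_succ, Fin.default_eq_zero,
      List.getElem_cons_zero, List.getElem_cons_succ, zero_add,
      Ring.choose_zero_right, Ring.choose_one_right, Pi.smul_apply (3 / 2 : ℂ),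
      dField, Nat.cast_zero, Nat.cast_one, sub_zero]
    push_cast
    module
  JJ m n := by
    rw [koszul_zero_left, one_smul]
    refine (h.JJ m n).trans ?_
    simp only [List.length_cons, List.length_nil, Fin.sum_univ_succ, List.get_eq_getElem,
      Finset.univ_unique, Finset.sum_singleton, Fin.val_zero, Fin.val_succ, Fin.default_eq_zero,
      List.getElem_cons_zero, List.getElem_cons_succ, zero_add,
      Ring.choose_zero_right, Ring.choose_one_right, Pi.smul_apply, Pi.zero_apply,
      Nat.cast_zero, Nat.cast_one, sub_zero]
    module
  JGp m n := by
    rw [koszul_zero_left, one_smul]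
    refine (h.JGp_comm m n).trans ?_
    simp
  JGm m n := by
    rw [koszul_zero_left, one_smul]
    refine (h.JGm_comm m n).trans ?_
    simp
  GpGm m n := by
    rw [koszul_one_one, neg_one_smul, sub_neg_eq_add]
    refine (h.GpGm_anticomm m n).trans ?_
    simp only [List.length_cons, List.length_nil, Fin.sum_univ_succ, List.get_eq_getElem,
      Finset.univ_unique, Finset.sum_singleton, Fin.val_zero, Fin.val_succ, Fin.default_eq_zero,
      List.getElem_cons_zero, List.getElem_cons_succ, zero_add, Nat.reduceAdd,
      Ring.choose_zero_right, Ring.choose_one_right, choose_two_cast,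
      Pi.smul_apply, Pi.add_apply, dField, data, Nat.cast_zero, Nat.cast_one, sub_zero,
      Nat.cast_ofNat]
    push_cast
    module
  GpGp m n := by
    rw [koszul_one_one, neg_one_smul, sub_neg_eq_add]
    refine (h.GpGp_anticomm m n).trans ?_
    simp
  GmGm m n := by
    rw [koszul_one_one, neg_one_smul, sub_neg_eq_add]
    refine (h.GmGm_anticomm m n).trans ?_
    simp

end N2Seed

end N2

end DoubledTorus

end

noncomputable section

namespace DoubledTorus

/-! ### The `N = 2` seed of a Lie algebra with a central Lagrangian subspace -/

section Construction

open QField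

variable {M : Type*} [AddCommGroup M] [Module ℂ M]

/-! ### Derivation rules with their signs, skew-symmetry, and contractions of conjugate fermions -/

namespace QField

theorem scomm_of_ad_zero {ε : ℂ} {A B : QField M} (h : ∀ m, ad ε (A.1 m) B = 0) :
    SComm ε A B := fun m n => by
  have := congrFun (congrArg QField.val (h m)) n
  exact sub_eq_zero.1 this

theorem ad_even_NO (ε : ℂ) (T : Module.End ℂ M) (A B : QField M) :
    ad 1 T (NO ε A B) = NO ε (ad 1 T A) B + NO ε A (ad 1 T B) := by
  have := ad_NO (ηA := 1) (ηB := 1) (ε := ε) (by norm_num) rfl rfl T A B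
  simpa using this

theorem ad_odd_NO_odd_odd (T : Module.End ℂ M) (A B : QField M) :
    ad 1 T (NO (-1) A B) = NO 1 (ad (-1) T A) B - NO 1 A (ad (-1) T B) := by
  have := ad_NO (ηA := -1) (ηB := -1) (ε := -1) (by norm_num) rfl rfl T A B
  simpa [sub_eq_add_neg] using this

theorem ad_odd_NO_even_odd (T : Module.End ℂ M) (A B : QField M) :
    ad (-1) T (NO 1 A B) = NO (-1) (ad 1 T A) B + NO 1 A (ad (-1) T B) := by
  have := ad_NO (ηA := 1) (ηB := -1) (ε := 1) (by norm_num) rfl rfl T A B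
  simpa using this

theorem ad_odd_NO_odd_even (T : Module.End ℂ M) (A B : QField M) :
    ad (-1) T (NO 1 A B) = NO 1 (ad (-1) T A) B - NO (-1) A (ad 1 T B) := by
  have := ad_NO (ηA := -1) (ηB := 1) (ε := 1) (by norm_num) rfl rfl T A B
  simpa [sub_eq_add_neg] using this

/-- Skew-symmetry for an operator product with a simple pole only: the mode relation depends on `m +
n` alone, so the roles can be exchanged at the cost of a sign. -/
theorem ad_flip {η : ℂ} (hη : η * η = 1) {X A Y : QField M}
    (h : ∀ n, ad η (X.1 n) A = shift n Y) (m : ℤ) : ad η (A.1 m) X = -η • shift m Y :=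
  ext fun n v => by
    have h1 := congrFun (congrArg QField.val (h n)) m
    rw [ad_apply] at h1
    rw [ad_apply, ad_swap η hη, h1, val_smul_apply, shift_apply, shift_apply, add_comm]

/-- Skew-symmetry for a pure double pole: the factor `n`, read as a coefficient of the mode of the
other field, becomes a derivative. -/
theorem ad_flip_der {X A Y : QField M}
    (h : ∀ n : ℤ, ad 1 (X.1 n) A = (n : ℂ) • shift (n - 1) Y) (m : ℤ) :
    ad 1 (A.1 m) X = der (shift m Y) :=
  ext fun n v => by
    have h1 := congrFun (congrArg QField.val (h n)) m
    rw [ad_apply] at h1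
    rw [ad_apply, ad_swap 1 (by norm_num), h1, val_smul_apply, der_apply, shift_apply, shift_apply,
      smul_smul, show m + (n - 1) = n - 1 + m by ring]
    simp

/-- The effect of a shift on the normally ordered product of two conjugate fermions. -/
theorem NO_shift_left_of_conj {A B : QField M} (h : ∀ m, ad (-1) (A.1 m) B = shift m one)
    (r : ℤ) : NO (-1) (shift r A) B = shift r (NO (-1) A B) + (r : ℂ) • shift (r - 1) one := by
  have key : ∀ r : ℤ, NO (-1) (shift (r + 1) A) B
      = shift 1 (NO (-1) (shift r A) B) + shift r one := fun r => by
    rw [add_comm r 1, ← shift_shift, NO_shift_one_left, shift_apply, zero_add, h]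
  induction r using Int.induction_on with
  | zero => simp
  | succ r ih =>
    rw [key, ih, map_add, map_smul, shift_shift, shift_shift, add_assoc]
    rw [show (1 : ℤ) + r = r + 1 by ring, show (1 : ℤ) + (r - 1) = r by ring,
      show (r + 1 - 1 : ℤ) = r by ring]
    push_cast
    module
  | pred r ih =>
    have h1 := key (-(r : ℤ) - 1)
    rw [sub_add_cancel, ih] at h1
    have h2 := congrArg (shift (-1)) h1
    simp only [map_add, map_smul, shift_shift] at h2
    rw [show (-1 : ℤ) + 1 = 0 by ring, shift_zero,
      show -1 + -(r : ℤ) = -r - 1 by ring, show -1 + (-(r : ℤ) - 1) = -r - 1 - 1 by ring] at h2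
    push_cast at h2 ⊢
    linear_combination (norm := module) -h2

/-- Each unit step in `r` adds an undifferentiated product with its contraction `r w^(r-1)`, and
these add up to `r (r - 1) / 2 · w^(r-2)`. The derivative creates no contraction of its own, because
its zero mode vanishes. -/
theorem NO_der_shift_left_of_conj {A B : QField M} (h : ∀ m, ad (-1) (A.1 m) B = shift m one)
    (r : ℤ) : NO (-1) (der (shift r A)) B = shift r (NO (-1) (der A) B)
      + (r : ℂ) • shift (r - 1) (NO (-1) A B)
      + ((r : ℂ) * (r - 1) / 2) • shift (r - 2) one := by
  have key : ∀ r : ℤ, NO (-1) (der (shift (r + 1) A)) B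
      = shift 1 (NO (-1) (der (shift r A)) B) + NO (-1) (shift r A) B := fun r => by
    have h1 : der (shift (r + 1) A) = shift 1 (der (shift r A)) + shift r A := by
      rw [add_comm r 1, ← shift_shift, der_shift]
      simp
    have h2 : ad (-1) ((der (shift r A)).1 0) B = 0 := ext fun n v => by
      simp [ad_apply]
    rw [h1, map_add, LinearMap.add_apply, NO_shift_one_left, h2, add_zero]
  induction r using Int.induction_on with
  | zero => simp
  | succ r ih =>
    rw [key, ih, NO_shift_left_of_conj h]
    simp only [map_add, map_smul, shift_shift]
    rw [show (1 : ℤ) + r = r + 1 by ring, show (1 : ℤ) + (r - 1) = r by ring,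
      show (1 : ℤ) + (r - 2) = r - 1 by ring,
      show (r + 1 - 1 : ℤ) = r by ring, show (r + 1 - 2 : ℤ) = r - 1 by ring]
    push_cast
    module
  | pred r ih =>
    have h1 := key (-(r : ℤ) - 1)
    rw [sub_add_cancel, ih, NO_shift_left_of_conj h] at h1
    have h2 := congrArg (shift (-1)) h1
    simp only [map_add, map_smul, shift_shift] at h2
    rw [show (-1 : ℤ) + 1 = 0 by ring, shift_zero,
      show -1 + -(r : ℤ) = -r - 1 by ring, show -1 + (-(r : ℤ) - 1) = -r - 1 - 1 by ring,
      show -1 + (-(r : ℤ) - 2) = -r - 1 - 2 by ring,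
      show -1 + (-(r : ℤ) - 1 - 1) = -r - 1 - 2 by ring] at h2
    push_cast at h2 ⊢
    linear_combination (norm := module) -h2

end QField

variable {𝔡 : Type*} [LieRing 𝔡] [LieAlgebra ℂ 𝔡]

/-- Even and odd currents of the level-one super-affinization of a Lie algebra with a bilinear
form `B`. -/
structure CurrentSystem (B : LinearMap.BilinForm ℂ 𝔡) (cur bar : 𝔡 →ₗ[ℂ] QField M) : Prop where
  cur_cur : ∀ (a b : 𝔡) (n : ℤ), ad 1 ((cur a).1 n) (cur b)
    = shift n (cur ⁅a, b⁆) + ((n : ℂ) * B a b) • shift (n - 1) one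
  cur_bar : ∀ (a b : 𝔡) (n : ℤ), ad 1 ((cur a).1 n) (bar b) = shift n (bar ⁅a, b⁆)
  bar_cur : ∀ (a b : 𝔡) (n : ℤ), ad 1 ((bar a).1 n) (cur b) = shift n (bar ⁅a, b⁆)
  bar_bar : ∀ (a b : 𝔡) (n : ℤ), ad (-1) ((bar a).1 n) (bar b) = B a b • shift n one

/-- Dual bases `w` and `d` of two transversal Lagrangian subspaces, the first of which is central.
The sign `σ k` is the charge of `d k`. -/
structure AdaptedBasis (B : LinearMap.BilinForm ℂ 𝔡) (σ : Fin 4 → ℂ)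
    (F : Fin 4 → Fin 4 → Fin 4 → ℂ) (w d : Fin 4 → 𝔡) : Prop where
  lie_w_left : ∀ (i : Fin 4) (x : 𝔡), ⁅w i, x⁆ = 0
  lie_w_right : ∀ (x : 𝔡) (i : Fin 4), ⁅x, w i⁆ = 0
  lie_dd : ∀ i j, ⁅d i, d j⁆ = ∑ k, F i j k • w k
  ww : ∀ i j, B (w i) (w j) = 0
  dd : ∀ i j, B (d i) (d j) = 0
  wd : ∀ i j, B (w i) (d j) = if i = j then 1 else 0
  dw : ∀ i j, B (d i) (w j) = if i = j then 1 else 0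
  swap : ∀ i j k, F i j k = -F j i k
  cyc : ∀ i j k, F i j k = F j k i
  sq : ∀ i, σ i * σ i = 1
  charge : ∀ i j k, F i j k * (1 + σ i * σ j + σ j * σ k + σ k * σ i) = 0

namespace CurrentSystem

variable {B : LinearMap.BilinForm ℂ 𝔡} {cur bar : 𝔡 →ₗ[ℂ] QField M}
  {σ : Fin 4 → ℂ} {F : Fin 4 → Fin 4 → Fin 4 → ℂ} {w d : Fin 4 → 𝔡}

/-- The `U(1)` current. -/
def jField (bar : 𝔡 →ₗ[ℂ] QField M) (σ : Fin 4 → ℂ) (w d : Fin 4 → 𝔡) : QField M :=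
  ∑ k, σ k • NO (-1) (bar (d k)) (bar (w k))

/-- The difference of the two supercurrents. -/
def hField (cur bar : 𝔡 →ₗ[ℂ] QField M) (σ : Fin 4 → ℂ) (w d : Fin 4 → 𝔡) : QField M :=
  ∑ k, σ k • (NO 1 (cur (d k)) (bar (w k)) - NO 1 (cur (w k)) (bar (d k)))

/-- The super-commutator of the `U(1)` current with the even current `d l`. -/
def qField (bar : 𝔡 →ₗ[ℂ] QField M) (σ : Fin 4 → ℂ) (F : Fin 4 → Fin 4 → Fin 4 → ℂ)
    (w : Fin 4 → 𝔡) (l : Fin 4) : QField M :=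
  -∑ k, ∑ j, (σ k * F l k j) • NO (-1) (bar (w j)) (bar (w k))

/-- The sum of the two supercurrents. -/
def kField (cur bar : 𝔡 →ₗ[ℂ] QField M) (σ : Fin 4 → ℂ) (F : Fin 4 → Fin 4 → Fin 4 → ℂ)
    (w d : Fin 4 → 𝔡) : QField M :=
  ∑ k, (NO 1 (cur (d k)) (bar (w k)) + NO 1 (cur (w k)) (bar (d k))
    - σ k • NO 1 (qField bar σ F w k) (bar (w k)))

/-- The Virasoro field. -/
def sField (cur bar : 𝔡 →ₗ[ℂ] QField M) (σ : Fin 4 → ℂ) (F : Fin 4 → Fin 4 → Fin 4 → ℂ)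
    (w d : Fin 4 → 𝔡) : QField M :=
  (1 / 2 : ℂ) • ad (-1) ((kField cur bar σ F w d).1 0) (kField cur bar σ F w d)

/-- By definition `S p` is half of `{K 0, K p}`, so the Jacobi identity gives its action from that
of `K`. The result says that the odd currents are primary of weight `1/2`. -/
theorem sField_bar {x : 𝔡}
    (h1 : ∀ m, ad (-1) ((kField cur bar σ F w d).1 m) (bar x) = shift m (cur x))
    (h2 : ∀ m, ad 1 ((kField cur bar σ F w d).1 m) (cur x) = der (shift m (bar x))) (p : ℤ) :
    ad 1 ((sField cur bar σ F w d).1 p) (bar x)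
      = der (shift p (bar x)) - ((p : ℂ) / 2) • shift (p - 1) (bar x) := by
  refine val_injective (funext fun n => ?_)
  have e1 := congrFun (congrArg QField.val (h1 p)) n
  have e2 := congrFun (congrArg QField.val (h1 0)) n
  have e3 := congrFun (congrArg QField.val (h2 0)) (n + p)
  have e4 := congrFun (congrArg QField.val (h2 p)) n
  rw [ad_apply, shift_apply, neg_one_smul, sub_neg_eq_add] at e1 e2
  rw [ad_apply, der_apply, shift_apply, one_smul] at e3 e4
  have e5 := anticomm_comm_eq ((kField cur bar σ F w d).1 0) ((kField cur bar σ F w d).1 p)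
    ((bar x).1 n)
  rw [add_zero] at e2 e3
  rw [e1, e2, e3, e4] at e5
  simp only [ad_apply, sField, val_smul_apply, val_sub_apply, der_apply, shift_apply, one_smul,
    neg_one_smul, sub_neg_eq_add, smul_mul_assoc, mul_smul_comm]
  rw [show n - 1 + p = n + p - 1 by ring] at e5 ⊢
  rw [show n + (p - 1) = n + p - 1 by ring]
  push_cast at e5
  linear_combination (norm := module) (1 / 2 : ℂ) • e5

theorem bar_jField (hc : CurrentSystem B cur bar) (x : 𝔡) (n : ℤ) :
    ad 1 ((bar x).1 n) (jField bar σ w d)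
    = shift n (∑ k, σ k • (B x (d k) • bar (w k) - B x (w k) • bar (d k))) := by
  rw [jField, map_sum, map_sum]
  refine Finset.sum_congr rfl fun k _ => ?_
  rw [map_smul, ad_odd_NO_odd_odd, hc.bar_bar, hc.bar_bar]
  simp only [map_smul, LinearMap.smul_apply, NO_shift_id_left, NO_shift_one_right, map_sub]

/-! ### Brackets of the currents in an adapted basis -/

theorem barw_barw (hc : CurrentSystem B cur bar) (hb : AdaptedBasis B σ F w d)
    (i j : Fin 4) (n : ℤ) : ad (-1) ((bar (w i)).1 n) (bar (w j)) = 0 := by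
  rw [hc.bar_bar, hb.ww, zero_smul]

theorem barw_bard (hc : CurrentSystem B cur bar) (hb : AdaptedBasis B σ F w d)
    (i j : Fin 4) (n : ℤ) : ad (-1) ((bar (w i)).1 n) (bar (d j))
    = if i = j then shift n one else 0 := by
  rw [hc.bar_bar, hb.wd, ite_smul, one_smul, zero_smul]

theorem bard_barw (hc : CurrentSystem B cur bar) (hb : AdaptedBasis B σ F w d)
    (i j : Fin 4) (n : ℤ) : ad (-1) ((bar (d i)).1 n) (bar (w j))
    = if i = j then shift n one else 0 := by
  rw [hc.bar_bar, hb.dw, ite_smul, one_smul, zero_smul]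

theorem bard_bard (hc : CurrentSystem B cur bar) (hb : AdaptedBasis B σ F w d)
    (i j : Fin 4) (n : ℤ) : ad (-1) ((bar (d i)).1 n) (bar (d j)) = 0 := by
  rw [hc.bar_bar, hb.dd, zero_smul]

theorem barw_cur (hc : CurrentSystem B cur bar) (hb : AdaptedBasis B σ F w d)
    (i : Fin 4) (x : 𝔡) (n : ℤ) : ad 1 ((bar (w i)).1 n) (cur x) = 0 := by
  rw [hc.bar_cur, hb.lie_w_left, map_zero, map_zero]

theorem bar_curw (hc : CurrentSystem B cur bar) (hb : AdaptedBasis B σ F w d)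
    (i : Fin 4) (x : 𝔡) (n : ℤ) : ad 1 ((bar x).1 n) (cur (w i)) = 0 := by
  rw [hc.bar_cur, hb.lie_w_right, map_zero, map_zero]

theorem curw_bar (hc : CurrentSystem B cur bar) (hb : AdaptedBasis B σ F w d)
    (i : Fin 4) (x : 𝔡) (n : ℤ) : ad 1 ((cur (w i)).1 n) (bar x) = 0 := by
  rw [hc.cur_bar, hb.lie_w_left, map_zero, map_zero]

theorem cur_barw (hc : CurrentSystem B cur bar) (hb : AdaptedBasis B σ F w d)
    (i : Fin 4) (x : 𝔡) (n : ℤ) : ad 1 ((cur x).1 n) (bar (w i)) = 0 := by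
  rw [hc.cur_bar, hb.lie_w_right, map_zero, map_zero]

theorem curw_curw (hc : CurrentSystem B cur bar) (hb : AdaptedBasis B σ F w d)
    (i j : Fin 4) (n : ℤ) : ad 1 ((cur (w i)).1 n) (cur (w j)) = 0 := by
  rw [hc.cur_cur, hb.lie_w_left, map_zero, map_zero, hb.ww]; simp

theorem curw_curd (hc : CurrentSystem B cur bar) (hb : AdaptedBasis B σ F w d)
    (i j : Fin 4) (n : ℤ) : ad 1 ((cur (w i)).1 n) (cur (d j))
    = if i = j then (n : ℂ) • shift (n - 1) one else 0 := by
  rw [hc.cur_cur, hb.lie_w_left, map_zero, map_zero, hb.wd]; split_ifs <;> simp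

theorem curd_curw (hc : CurrentSystem B cur bar) (hb : AdaptedBasis B σ F w d)
    (i j : Fin 4) (n : ℤ) : ad 1 ((cur (d i)).1 n) (cur (w j))
    = if i = j then (n : ℂ) • shift (n - 1) one else 0 := by
  rw [hc.cur_cur, hb.lie_w_right, map_zero, map_zero, hb.dw]; split_ifs <;> simp

theorem curd_curd (hc : CurrentSystem B cur bar) (hb : AdaptedBasis B σ F w d)
    (i j : Fin 4) (n : ℤ) : ad 1 ((cur (d i)).1 n) (cur (d j))
    = ∑ k, F i j k • shift n (cur (w k)) := by
  rw [hc.cur_cur, hb.lie_dd, hb.dd]; simp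

theorem curd_bard (hc : CurrentSystem B cur bar) (hb : AdaptedBasis B σ F w d)
    (i j : Fin 4) (n : ℤ) : ad 1 ((cur (d i)).1 n) (bar (d j))
    = ∑ k, F i j k • shift n (bar (w k)) := by
  rw [hc.cur_bar, hb.lie_dd]; simp

theorem bard_curd (hc : CurrentSystem B cur bar) (hb : AdaptedBasis B σ F w d)
    (i j : Fin 4) (n : ℤ) : ad 1 ((bar (d i)).1 n) (cur (d j))
    = ∑ k, F i j k • shift n (bar (w k)) := by
  rw [hc.bar_cur, hb.lie_dd]; simp

theorem scomm_barw_barw (hc : CurrentSystem B cur bar) (hb : AdaptedBasis B σ F w d)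
    (i j : Fin 4) : SComm (-1) (bar (w i)) (bar (w j)) :=
  scomm_of_ad_zero (hc.barw_barw hb i j)

theorem NO_barw_swap (hc : CurrentSystem B cur bar) (hb : AdaptedBasis B σ F w d)
    (i j : Fin 4) :
    NO (-1) (bar (w i)) (bar (w j)) = -NO (-1) (bar (w j)) (bar (w i)) := by
  rw [NO_swap_of_comm (by norm_num) (hc.scomm_barw_barw hb i j), neg_one_smul]

/-- Contracting the antisymmetric structure constants with `σ j - σ k` gives zero. -/
theorem sum_charge_sub (hc : CurrentSystem B cur bar) (hb : AdaptedBasis B σ F w d)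
    (l : Fin 4) :
    ∑ k, ∑ j, (F l k j * (σ j - σ k)) • NO (-1) (bar (w j)) (bar (w k)) = 0 := by
  -- Exchanging the names of `k` and `j` reverses the sign of all three factors: the structure
  -- constant, the difference of charges and the product of fermions.
  have h : ∑ k, ∑ j, (F l k j * (σ j - σ k)) • NO (-1) (bar (w j)) (bar (w k))
      = -∑ k, ∑ j, (F l k j * (σ j - σ k)) • NO (-1) (bar (w j)) (bar (w k)) := by
    conv_lhs => rw [Finset.sum_comm]
    rw [← Finset.sum_neg_distrib]
    refine Finset.sum_congr rfl fun k _ => ?_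
    rw [← Finset.sum_neg_distrib]
    refine Finset.sum_congr rfl fun j _ => ?_
    rw [hc.NO_barw_swap hb k j, hb.cyc l j k, hb.swap j k l, ← hb.cyc l k j]
    module
  have h2 : (2 : ℂ) • ∑ k, ∑ j, (F l k j * (σ j - σ k)) • NO (-1) (bar (w j)) (bar (w k)) = 0 := by
    rw [two_smul]; nth_rewrite 1 [h]; exact neg_add_cancel _
  exact (smul_eq_zero.1 h2).resolve_left two_ne_zero

/-! ### The action of the `U(1)` current -/

theorem jField_barw (hc : CurrentSystem B cur bar) (hb : AdaptedBasis B σ F w d)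
    (l : Fin 4) (m : ℤ) :
    ad 1 ((jField bar σ w d).1 m) (bar (w l)) = -σ l • shift m (bar (w l)) := by
  rw [ad_flip (by norm_num) (hc.bar_jField (w l))]
  simp [hb.ww, hb.wd]

theorem jField_bard (hc : CurrentSystem B cur bar) (hb : AdaptedBasis B σ F w d)
    (l : Fin 4) (m : ℤ) :
    ad 1 ((jField bar σ w d).1 m) (bar (d l)) = σ l • shift m (bar (d l)) := by
  rw [ad_flip (by norm_num) (hc.bar_jField (d l))]
  simp [hb.dw, hb.dd]

theorem jField_curw (hc : CurrentSystem B cur bar) (hb : AdaptedBasis B σ F w d)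
    (l : Fin 4) (m : ℤ) :
    ad 1 ((jField bar σ w d).1 m) (cur (w l)) = 0 := by
  rw [ad_flip (Y := 0) (by norm_num)]
  · simp
  · intro n
    simp only [jField, map_sum, map_smul, ad_even_NO, hc.curw_bar hb]
    simp

theorem jField_curd (hc : CurrentSystem B cur bar) (hb : AdaptedBasis B σ F w d)
    (l : Fin 4) (m : ℤ) :
    ad 1 ((jField bar σ w d).1 m) (cur (d l)) = shift m (qField bar σ F w l) := by
  rw [ad_flip (Y := ∑ k, ∑ j, (σ k * F l k j) • NO (-1) (bar (w j)) (bar (w k))) (by norm_num)]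
  · rw [qField, map_neg, neg_smul, one_smul]
  · intro n
    simp only [jField, map_sum, map_smul, ad_even_NO, hc.curd_bard hb, hc.cur_barw hb,
      LinearMap.sum_apply, LinearMap.smul_apply, map_zero, add_zero,
      NO_shift_left_of_comm (hc.scomm_barw_barw hb _ _), Finset.smul_sum, smul_smul]

theorem jField_jField (hc : CurrentSystem B cur bar) (hb : AdaptedBasis B σ F w d)
    (m : ℤ) : ad 1 ((jField bar σ w d).1 m) (jField bar σ w d)
    = (4 * (m : ℂ)) • shift (m - 1) one := by
  -- The two factors have opposite charges, so only the contraction of the conjugate pair is left.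
  -- Each of the four pairs contributes `σ k ^ 2 = 1` to the level.
  have h : ∀ k, ad 1 ((jField bar σ w d).1 m) (σ k • NO (-1) (bar (d k)) (bar (w k)))
      = (m : ℂ) • shift (m - 1) one := fun k => by
    rw [map_smul, ad_even_NO, hc.jField_bard hb, hc.jField_barw hb]
    simp only [map_smul, LinearMap.smul_apply, NO_shift_right]
    rw [NO_shift_left_of_conj (fun m => by rw [hc.bard_barw hb, if_pos rfl])]
    have := hb.sq k
    linear_combination (norm := skip) this • (m : ℂ) • (shift (m - 1) (one : QField M))
    module
  nth_rewrite 2 [jField]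
  rw [map_sum, Finset.sum_congr rfl fun k _ => h k]
  rw [Finset.sum_const, Finset.card_univ, Fintype.card_fin]
  module

theorem barw_NO_barw (hc : CurrentSystem B cur bar) (hb : AdaptedBasis B σ F w d)
    (i j k : Fin 4) (n : ℤ) :
    ad 1 ((bar (w i)).1 n) (NO (-1) (bar (w j)) (bar (w k))) = 0 := by
  rw [ad_odd_NO_odd_odd, hc.barw_barw hb, hc.barw_barw hb]; simp

theorem barw_qField (hc : CurrentSystem B cur bar) (hb : AdaptedBasis B σ F w d)
    (i l : Fin 4) (n : ℤ) : ad 1 ((bar (w i)).1 n) (qField bar σ F w l) = 0 := by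
  simp [qField, hc.barw_NO_barw hb]

theorem cur_qField (hc : CurrentSystem B cur bar) (hb : AdaptedBasis B σ F w d)
    (x : 𝔡) (l : Fin 4) (n : ℤ) : ad 1 ((cur x).1 n) (qField bar σ F w l) = 0 := by
  simp [qField, ad_even_NO, hc.cur_barw hb]

theorem scomm_qField_barw (hc : CurrentSystem B cur bar) (hb : AdaptedBasis B σ F w d)
    (l i : Fin 4) : SComm 1 (qField bar σ F w l) (bar (w i)) :=
  (scomm_of_ad_zero (hc.barw_qField hb i l)).symm (by norm_num)

/-- This relation dictates the formula for `kField`: the sum of the supercurrents has to be `-[J₀,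
H]`, and its correction term is the effect of `J` on the even currents of the `d k`. -/
theorem jField_hField (hc : CurrentSystem B cur bar) (hb : AdaptedBasis B σ F w d)
    (m : ℤ) : ad 1 ((jField bar σ w d).1 m) (hField cur bar σ w d)
    = -shift m (kField cur bar σ F w d) := by
  rw [hField, kField, map_sum, map_sum, ← Finset.sum_neg_distrib]
  refine Finset.sum_congr rfl fun k _ => ?_
  rw [map_smul, map_sub, ad_even_NO, ad_even_NO, hc.jField_curd hb, hc.jField_curw hb,
    hc.jField_barw hb, hc.jField_bard hb, NO_shift_left_of_comm (hc.scomm_qField_barw hb k k)]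
  simp only [map_smul, NO_shift_right, map_zero, LinearMap.zero_apply, map_sub, map_add, zero_add]
  have := hb.sq k
  linear_combination (norm := skip) (-this) • (shift m (NO 1 (cur (d k)) (bar (w k)))
    + shift m (NO 1 (cur (w k)) (bar (d k))))
  module

theorem jField_NO_barw (hc : CurrentSystem B cur bar) (hb : AdaptedBasis B σ F w d)
    (j k : Fin 4) (m : ℤ) :
    ad 1 ((jField bar σ w d).1 m) (NO (-1) (bar (w j)) (bar (w k)))
      = (-(σ j + σ k)) • shift m (NO (-1) (bar (w j)) (bar (w k))) := by
  rw [ad_even_NO, hc.jField_barw hb, hc.jField_barw hb]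
  simp only [map_smul, LinearMap.smul_apply, NO_shift_right,
    NO_shift_left_of_comm (hc.scomm_barw_barw hb _ _)]
  module

/-- Only terms with `σ j = σ k = -σ l` survive in `qField`: terms with `σ j = -σ k` cancel in pairs,
and `F` vanishes when all three charges agree. The survivors have charge `-(σ j + σ k) = 2 σ l`. In
the computation the two sides differ by the vanishing sum of `sum_charge_sub`. -/
theorem jField_qField (hc : CurrentSystem B cur bar) (hb : AdaptedBasis B σ F w d)
    (l : Fin 4) (m : ℤ) :
    σ l • ad 1 ((jField bar σ w d).1 m) (qField bar σ F w l)
      = (2 : ℂ) • shift m (qField bar σ F w l) := by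
  rw [← sub_eq_zero]
  have h0 := congrArg (shift m) (hc.sum_charge_sub hb l)
  rw [map_zero] at h0
  rw [← neg_zero, ← h0]
  simp only [qField, map_neg, map_sum, map_smul, hc.jField_NO_barw hb, Finset.smul_sum,
    smul_neg, ← Finset.sum_neg_distrib, ← Finset.sum_sub_distrib]
  refine Finset.sum_congr rfl fun k _ => Finset.sum_congr rfl fun j _ => ?_
  have h1 := hb.charge l k j
  have h2 := hb.sq l
  have h3 := hb.sq k
  have h4 : σ l * (σ k * F l k j * (σ j + σ k)) + 2 * (σ k * F l k j) = F l k j * (σ k - σ j) := by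
    linear_combination σ l * h1 - F l k j * (σ k + σ j) * h2 + σ l * F l k j * h3
  linear_combination (norm := skip) h4 • shift m (NO (-1) (bar (w j)) (bar (w k)))
  module

theorem jField_kField (hc : CurrentSystem B cur bar) (hb : AdaptedBasis B σ F w d)
    (m : ℤ) : ad 1 ((jField bar σ w d).1 m) (kField cur bar σ F w d)
    = -shift m (hField cur bar σ w d) := by
  rw [hField, kField, map_sum, map_sum, ← Finset.sum_neg_distrib]
  refine Finset.sum_congr rfl fun k _ => ?_
  have h0 := congrArg (fun X => NO 1 X (bar (w k))) (hc.jField_qField hb k m)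
  rw [map_sub, map_add, map_smul, ad_even_NO, ad_even_NO, ad_even_NO, hc.jField_curd hb,
    hc.jField_curw hb,
    hc.jField_barw hb, hc.jField_bard hb, NO_shift_left_of_comm (hc.scomm_qField_barw hb k k)]
  simp only [map_smul, LinearMap.smul_apply,
    NO_shift_left_of_comm (hc.scomm_qField_barw hb k k)] at h0
  simp only [map_smul, NO_shift_right, map_zero, LinearMap.zero_apply, map_sub, zero_add]
  have := hb.sq k
  linear_combination (norm := skip) (this) • (shift m (NO 1 (qField bar σ F w k) (bar (w k)))) - h0
  module

/-! ### The supercurrent exchanges odd and even currents -/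

theorem barw_kField (hc : CurrentSystem B cur bar) (hb : AdaptedBasis B σ F w d)
    (l : Fin 4) (n : ℤ) :
    ad (-1) ((bar (w l)).1 n) (kField cur bar σ F w d) = shift n (cur (w l)) := by
  rw [kField, map_sum]
  simp only [map_sub, map_add, map_smul, ad_odd_NO_even_odd, hc.barw_cur hb, hc.barw_barw hb,
    hc.barw_bard hb, hc.barw_qField hb]
  simp only [map_zero, LinearMap.zero_apply, add_zero, zero_add, smul_zero, sub_zero]
  rw [Finset.sum_eq_single l]
  · rw [if_pos rfl, NO_shift_one_right]
  · intro k _ hk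
    rw [if_neg hk.symm, map_zero]
  · simp

theorem bard_NO_barw (hc : CurrentSystem B cur bar) (hb : AdaptedBasis B σ F w d)
    (l j k : Fin 4) (n : ℤ) :
    ad 1 ((bar (d l)).1 n) (NO (-1) (bar (w j)) (bar (w k)))
      = (if l = j then shift n (bar (w k)) else 0) - if l = k then shift n (bar (w j)) else 0 := by
  rw [ad_odd_NO_odd_odd, hc.bard_barw hb, hc.bard_barw hb]
  split_ifs <;> simp [NO_shift_id_left, NO_shift_one_right]

theorem bard_qField (hc : CurrentSystem B cur bar) (hb : AdaptedBasis B σ F w d)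
    (l i : Fin 4) (n : ℤ) : ad 1 ((bar (d l)).1 n) (qField bar σ F w i)
    = ∑ j, ((σ j + σ l) * F i l j) • shift n (bar (w j)) := by
  have h : ∀ j, F i j l = -F i l j := fun j => by rw [hb.cyc i j l, hb.swap j l i, ← hb.cyc i l j]
  simp only [qField, map_neg, map_sum, map_smul, hc.bard_NO_barw hb, smul_sub, smul_ite, smul_zero,
    Finset.sum_sub_distrib, Finset.sum_ite_eq, Finset.mem_univ, if_true]
  have e : ∑ x, ∑ y, (if l = x then (σ x * F i x y) • shift n (bar (w y)) else 0)
      = ∑ y, (σ l * F i l y) • shift n (bar (w y)) := by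
    rw [Finset.sum_comm]
    refine Finset.sum_congr rfl fun y _ => ?_
    rw [Finset.sum_ite_eq, if_pos (Finset.mem_univ _)]
  rw [e, neg_sub, ← Finset.sum_sub_distrib]
  refine Finset.sum_congr rfl fun j _ => ?_
  rw [h]
  module

/-- Here the cubic part of `K` is needed. The brackets of `d l` with the `d k` leave terms quadratic
in the fermions `w̄`, and the contractions of `d̄ l` with the cubic part cancel them. -/
theorem bard_kField (hc : CurrentSystem B cur bar) (hb : AdaptedBasis B σ F w d)
    (l : Fin 4) (n : ℤ) :
    ad (-1) ((bar (d l)).1 n) (kField cur bar σ F w d) = shift n (cur (d l)) := by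
  have h0 := congrArg (shift n) (hc.sum_charge_sub hb l)
  simp only [map_zero, map_sum, map_smul] at h0
  rw [kField, map_sum]
  simp only [map_sub, map_add, map_sum, map_smul, ad_odd_NO_even_odd, hc.bar_curw hb,
    hc.bard_bard hb, hc.bard_barw hb, hc.bard_qField hb, hc.bard_curd hb, LinearMap.sum_apply,
    LinearMap.smul_apply, NO_shift_left_of_comm (hc.scomm_barw_barw hb _ _)]
  simp only [map_zero, LinearMap.zero_apply, add_zero]
  rw [Finset.sum_sub_distrib, Finset.sum_add_distrib]
  have e1 : ∑ k, NO 1 (cur (d k)) (if l = k then shift n one else 0) = shift n (cur (d l)) := by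
    rw [Finset.sum_eq_single l]
    · rw [if_pos rfl, NO_shift_one_right]
    · intro k _ hk
      rw [if_neg hk.symm, map_zero]
    · simp
  have e2 : ∑ k, σ k • NO 1 (qField bar σ F w k) (if l = k then shift n one else 0)
      = σ l • shift n (qField bar σ F w l) := by
    rw [Finset.sum_eq_single l]
    · rw [if_pos rfl, NO_shift_one_right]
    · intro k _ hk
      rw [if_neg hk.symm, map_zero, smul_zero]
    · simp
  simp only [smul_add, Finset.sum_add_distrib]
  rw [e1, e2, add_comm, add_sub_assoc, add_eq_left, ← smul_zero (-σ l), ← h0, qField]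
  simp only [map_neg, map_sum, map_smul, Finset.smul_sum, smul_neg, ← Finset.sum_neg_distrib,
    ← Finset.sum_add_distrib, ← Finset.sum_sub_distrib]
  refine Finset.sum_congr rfl fun k _ => Finset.sum_congr rfl fun j _ => ?_
  -- The charge condition turns the total coefficient into a multiple of the one in
  -- `sum_charge_sub`.
  have h1 : F l k j - σ k * ((σ j + σ l) * F k l j) + σ l * (σ k * F l k j)
      = -σ l * (F l k j * (σ j - σ k)) := by
    rw [hb.swap k l j]
    linear_combination hb.charge l k j
  linear_combination (norm := skip) h1 • shift n (NO (-1) (bar (w j)) (bar (w k)))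
  module

theorem curw_kField (hc : CurrentSystem B cur bar) (hb : AdaptedBasis B σ F w d)
    (l : Fin 4) (n : ℤ) :
    ad 1 ((cur (w l)).1 n) (kField cur bar σ F w d) = (n : ℂ) • shift (n - 1) (bar (w l)) := by
  rw [kField, map_sum]
  simp only [map_sub, map_add, map_smul, ad_even_NO, hc.curw_curd hb, hc.curw_bar hb,
    hc.curw_curw hb, hc.cur_qField hb]
  simp only [map_zero, LinearMap.zero_apply, add_zero, smul_zero, sub_zero]
  rw [Finset.sum_eq_single l]
  · rw [if_pos rfl, map_smul, LinearMap.smul_apply, NO_shift_id_left]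
  · intro k _ hk
    rw [if_neg hk.symm, map_zero, LinearMap.zero_apply]
  · simp

theorem scomm_curw_barw (hc : CurrentSystem B cur bar) (hb : AdaptedBasis B σ F w d)
    (i j : Fin 4) : SComm 1 (cur (w i)) (bar (w j)) :=
  scomm_of_ad_zero (hc.curw_bar hb i (w j))

/-- The terms from `[d l, d k]` in the two quadratic parts of `K` cancel by antisymmetry of `F`. The
cubic part is built from the `w̄`, which commute with every even current. -/
theorem curd_kField (hc : CurrentSystem B cur bar) (hb : AdaptedBasis B σ F w d)
    (l : Fin 4) (n : ℤ) :
    ad 1 ((cur (d l)).1 n) (kField cur bar σ F w d) = (n : ℂ) • shift (n - 1) (bar (d l)) := by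
  rw [kField, map_sum]
  simp only [map_sub, map_add, map_sum, map_smul, ad_even_NO, hc.curd_curd hb, hc.cur_barw hb,
    hc.curd_curw hb, hc.curd_bard hb, hc.cur_qField hb, LinearMap.sum_apply,
    LinearMap.smul_apply, NO_shift_left_of_comm (hc.scomm_curw_barw hb _ _), NO_shift_right]
  simp only [map_zero, LinearMap.zero_apply, add_zero, smul_zero, sub_zero]
  rw [Finset.sum_add_distrib, Finset.sum_add_distrib]
  have e1 : ∑ k, NO 1 (if l = k then (n : ℂ) • shift (n - 1) one else 0) (bar (d k))
      = (n : ℂ) • shift (n - 1) (bar (d l)) := by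
    rw [Finset.sum_eq_single l]
    · rw [if_pos rfl, map_smul, LinearMap.smul_apply, NO_shift_id_left]
    · intro k _ hk
      rw [if_neg hk.symm, map_zero, LinearMap.zero_apply]
    · simp
  have e2 : ∑ k, ∑ j, F l k j • shift n (NO 1 (cur (w k)) (bar (w j)))
      = -∑ k, ∑ j, F l k j • shift n (NO 1 (cur (w j)) (bar (w k))) := by
    rw [Finset.sum_comm, ← Finset.sum_neg_distrib]
    refine Finset.sum_congr rfl fun k _ => ?_
    rw [← Finset.sum_neg_distrib]
    refine Finset.sum_congr rfl fun j _ => ?_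
    rw [hb.cyc l j k, hb.swap j k l, ← hb.cyc l k j, neg_smul]
  rw [e1, e2]
  abel

theorem kField_barw (hc : CurrentSystem B cur bar) (hb : AdaptedBasis B σ F w d)
    (l : Fin 4) (m : ℤ) :
    ad (-1) ((kField cur bar σ F w d).1 m) (bar (w l)) = shift m (cur (w l)) := by
  rw [ad_flip (by norm_num) (hc.barw_kField hb l)]; simp

theorem kField_bard (hc : CurrentSystem B cur bar) (hb : AdaptedBasis B σ F w d)
    (l : Fin 4) (m : ℤ) :
    ad (-1) ((kField cur bar σ F w d).1 m) (bar (d l)) = shift m (cur (d l)) := by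
  rw [ad_flip (by norm_num) (hc.bard_kField hb l)]; simp

theorem kField_curw (hc : CurrentSystem B cur bar) (hb : AdaptedBasis B σ F w d)
    (l : Fin 4) (m : ℤ) :
    ad 1 ((kField cur bar σ F w d).1 m) (cur (w l)) = der (shift m (bar (w l))) :=
  ad_flip_der (hc.curw_kField hb l) m

theorem kField_curd (hc : CurrentSystem B cur bar) (hb : AdaptedBasis B σ F w d)
    (l : Fin 4) (m : ℤ) :
    ad 1 ((kField cur bar σ F w d).1 m) (cur (d l)) = der (shift m (bar (d l))) :=
  ad_flip_der (hc.curd_kField hb l) m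

theorem kField_NO_barw (hc : CurrentSystem B cur bar) (hb : AdaptedBasis B σ F w d)
    (j k : Fin 4) (m : ℤ) :
    ad 1 ((kField cur bar σ F w d).1 m) (NO (-1) (bar (w j)) (bar (w k)))
      = shift m (NO 1 (cur (w j)) (bar (w k)) - NO 1 (bar (w j)) (cur (w k))) := by
  rw [ad_odd_NO_odd_odd, hc.kField_barw hb, hc.kField_barw hb,
    NO_shift_left_of_comm (hc.scomm_curw_barw hb _ _), NO_shift_right, map_sub]

/-- The bracket of `K` with `qField` only involves currents of the central vectors `w`, even and
odd. It anticommutes with `w̄ i`, so the power of the variable moves out without contraction. -/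
theorem NO_kField_qField_barw (hc : CurrentSystem B cur bar) (hb : AdaptedBasis B σ F w d)
    (l i : Fin 4) (m : ℤ) :
    NO (-1) (ad 1 ((kField cur bar σ F w d).1 m) (qField bar σ F w l)) (bar (w i))
      = shift m (NO (-1) (ad 1 ((kField cur bar σ F w d).1 0) (qField bar σ F w l))
        (bar (w i))) := by
  have h : ∀ m, ad 1 ((kField cur bar σ F w d).1 m) (qField bar σ F w l)
      = shift m (-∑ k, ∑ j, (σ k * F l k j) •
        (NO 1 (cur (w j)) (bar (w k)) - NO 1 (bar (w j)) (cur (w k)))) := fun m => by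
    simp only [qField, map_neg, map_sum, map_smul, hc.kField_NO_barw hb]
  rw [h, h 0, shift_zero]
  refine NO_shift_left_of_comm (SComm.symm (by norm_num) (scomm_of_ad_zero fun n => ?_)) m
  have h1 : ∀ j k, ad (-1) ((bar (w i)).1 n) (NO 1 (cur (w j)) (bar (w k))) = 0 := fun j k => by
    rw [ad_odd_NO_even_odd, hc.barw_cur hb, hc.barw_barw hb]; simp
  have h2 : ∀ j k, ad (-1) ((bar (w i)).1 n) (NO 1 (bar (w j)) (cur (w k))) = 0 := fun j k => by
    rw [ad_odd_NO_odd_even, hc.barw_cur hb, hc.barw_barw hb]; simp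
  simp [h1, h2]

/-- The modes of the supercurrent anticommute to modes of a single field, up to a current
which turns out to vanish and a central term. -/
theorem kField_kField_aux (hc : CurrentSystem B cur bar) (hb : AdaptedBasis B σ F w d)
    (m : ℤ) :
    ad (-1) ((kField cur bar σ F w d).1 m) (kField cur bar σ F w d)
      = shift m (ad (-1) ((kField cur bar σ F w d).1 0) (kField cur bar σ F w d))
        + (m : ℂ) • shift (m - 1) (∑ k, (NO (-1) (bar (d k)) (bar (w k))
          + NO (-1) (bar (w k)) (bar (d k))))
        + (4 * (m : ℂ) * (m - 1)) • shift (m - 2) one := by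
  have h : ∀ m, ad (-1) ((kField cur bar σ F w d).1 m) (kField cur bar σ F w d)
      = ∑ k, (NO (-1) (der (shift m (bar (d k)))) (bar (w k))
        + shift m (NO 1 (cur (d k)) (cur (w k)))
        + (NO (-1) (der (shift m (bar (w k)))) (bar (d k))
        + shift m (NO 1 (cur (w k)) (cur (d k))))
        - σ k • (shift m (NO (-1) (ad 1 ((kField cur bar σ F w d).1 0) (qField bar σ F w k))
          (bar (w k))) + shift m (NO 1 (qField bar σ F w k) (cur (w k))))) := fun m => by
    nth_rewrite 2 [kField]
    rw [map_sum]
    refine Finset.sum_congr rfl fun k _ => ?_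
    rw [map_sub, map_add, map_smul, ad_odd_NO_even_odd, ad_odd_NO_even_odd, ad_odd_NO_even_odd,
      hc.kField_curd hb, hc.kField_curw hb, hc.kField_barw hb, hc.kField_bard hb,
      NO_shift_right, NO_shift_right, NO_shift_right, hc.NO_kField_qField_barw hb k k m]
  -- Each of the four conjugate pairs gives two contractions `m (m - 1) / 2`, one for either order
  -- of its members.
  have hone : (4 * (m : ℂ) * (m - 1)) • shift (m - 2) (one : QField M)
      = ∑ _k : Fin 4, ((m : ℂ) * (m - 1)) • shift (m - 2) one := by
    rw [Finset.sum_const, Finset.card_univ, Fintype.card_fin]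
    module
  rw [h, h 0, hone, map_sum, map_sum, Finset.smul_sum, ← Finset.sum_add_distrib,
    ← Finset.sum_add_distrib]
  refine Finset.sum_congr rfl fun k _ => ?_
  rw [NO_der_shift_left_of_conj (fun m => by rw [hc.bard_barw hb, if_pos rfl]),
    NO_der_shift_left_of_conj (fun m => by rw [hc.barw_bard hb, if_pos rfl])]
  simp only [shift_zero, map_add, map_sub, map_smul]
  module

theorem kField_kField (hc : CurrentSystem B cur bar) (hb : AdaptedBasis B σ F w d)
    (m n : ℤ) :
    (kField cur bar σ F w d).1 m * (kField cur bar σ F w d).1 n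
      + (kField cur bar σ F w d).1 n * (kField cur bar σ F w d).1 m
      = (2 : ℂ) • (sField cur bar σ F w d).1 (m + n)
        + (4 * (m : ℂ) * (m - 1)) • idField (m + n - 2) := by
  set Z : QField M := ∑ k, (NO (-1) (bar (d k)) (bar (w k)) + NO (-1) (bar (w k)) (bar (d k)))
    with hZ
  have h : ∀ m n : ℤ, (kField cur bar σ F w d).1 m * (kField cur bar σ F w d).1 n
      + (kField cur bar σ F w d).1 n * (kField cur bar σ F w d).1 m
      = (2 : ℂ) • (sField cur bar σ F w d).1 (m + n) + (m : ℂ) • Z.1 (m + n - 1)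
        + (4 * (m : ℂ) * (m - 1)) • idField (m + n - 2) := fun m n => by
    have h1 := congrFun (congrArg QField.val (hc.kField_kField_aux hb m)) n
    rw [ad_apply, neg_one_smul, sub_neg_eq_add] at h1
    rw [h1, sField, ← hZ]
    simp only [val_add_apply, val_smul_apply, shift_apply, smul_smul]
    rw [show n + m = m + n by ring, show n + (m - 1) = m + n - 1 by ring,
      show n + (m - 2) = m + n - 2 by ring]
    norm_num
    rfl
  -- The anticommutator is symmetric in `m` and `n`, so the terms linear in `m` must cancel. The
  -- choice `m = 2 s + 3`, `n = -s - 2` has `m + n - 1 = s`, and `m - n = 3 s + 5` is never zero.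
  -- The central terms are nonzero only for `s = 0`, and agree there since `3 · 2 = (-2) · (-3)`.
  have hz : ∀ s, Z.1 s = 0 := fun s => by
    have h1 := h (2 * s + 3) (-s - 2)
    have h2 := h (-s - 2) (2 * s + 3)
    have h3 : (4 * ((2 * s + 3 : ℤ) : ℂ) * (((2 * s + 3 : ℤ) : ℂ) - 1)) • idField (M := M) (s - 1)
        = (4 * ((-s - 2 : ℤ) : ℂ) * (((-s - 2 : ℤ) : ℂ) - 1)) • idField (s - 1) := by
      refine N2Seed.idField_mul_cond _ _ _ fun hs => ?_
      have : s = 0 := by omega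
      subst this
      norm_num
    rw [show 2 * s + 3 + (-s - 2) - 2 = s - 1 by ring, show 2 * s + 3 + (-s - 2) - 1 = s by ring,
      show 2 * s + 3 + (-s - 2) = s + 1 by ring, h3] at h1
    rw [show -s - 2 + (2 * s + 3) - 2 = s - 1 by ring, show -s - 2 + (2 * s + 3) - 1 = s by ring,
      show -s - 2 + (2 * s + 3) = s + 1 by ring] at h2
    have h4 : (3 * (s : ℂ) + 5) • Z.1 s = 0 := by
      push_cast at h1 h2
      linear_combination (norm := module) h2 - h1
    refine (smul_eq_zero.1 h4).resolve_left fun h5 => ?_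
    have h6 : 3 * s + 5 = 0 := by exact_mod_cast h5
    omega
  rw [h m n, hz, smul_zero, add_zero]

/-! ### The Virasoro field and the complete seed -/

theorem sField_jField (hc : CurrentSystem B cur bar) (hb : AdaptedBasis B σ F w d)
    (p : ℤ) : ad 1 ((sField cur bar σ F w d).1 p) (jField bar σ w d)
    = der (shift p (jField bar σ w d)) := by
  have hw := fun k => sField_bar (hc.kField_barw hb k) (hc.kField_curw hb k) p
  have hd := fun k => sField_bar (hc.kField_bard hb k) (hc.kField_curd hb k) p
  simp only [jField, map_sum, map_smul]
  refine Finset.sum_congr rfl fun k _ => ?_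
  rw [ad_even_NO, hw, hd]
  simp only [map_sub, map_smul, LinearMap.sub_apply, LinearMap.smul_apply]
  -- The contraction `p (p - 1) / 2` of the derivative cancels against `-(p / 2) (p - 1)` from the
  -- weight term, so `J` has no anomaly.
  rw [NO_der_shift_left_of_conj (fun m => by rw [hc.bard_barw hb, if_pos rfl]),
    NO_shift_left_of_conj (fun m => by rw [hc.bard_barw hb, if_pos rfl]), NO_shift_right,
    der_shift, map_add, map_smul, NO_shift_right, NO_shift_right, der_shift, der_NO, map_add]
  rw [show p - 1 - 1 = p - 2 by ring]
  push_cast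
  module

theorem seed (hc : CurrentSystem B cur bar) (hb : AdaptedBasis B σ F w d) :
    N2Seed 4 (jField bar σ w d).1 (kField cur bar σ F w d).1
    (hField cur bar σ w d).1 (sField cur bar σ F w d).1 where
  JJ m n := by
    have h1 := congrFun (congrArg QField.val (hc.jField_jField hb m)) n
    rw [ad_apply, one_smul] at h1
    rw [h1, val_smul_apply, shift_apply, show n + (m - 1) = m + n - 1 by ring]
    rfl
  JK m n := by
    have h1 := congrFun (congrArg QField.val (hc.jField_kField hb m)) n
    rw [ad_apply, one_smul] at h1
    rw [h1, val_neg_apply, shift_apply, add_comm]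
  JH m n := by
    have h1 := congrFun (congrArg QField.val (hc.jField_hField hb m)) n
    rw [ad_apply, one_smul] at h1
    rw [h1, val_neg_apply, shift_apply, add_comm]
  KK m n := hc.kField_kField hb m n
  SJ m n := by
    have h1 := congrFun (congrArg QField.val (hc.sField_jField hb m)) n
    rw [ad_apply, one_smul] at h1
    rw [h1, der_apply, shift_apply, show n - 1 + m = m + n - 1 by ring]

end CurrentSystem

end Construction

end DoubledTorus

end

noncomputable section

namespace DoubledTorus

/-! ### Vertex algebras and parity -/

section Membership

open QField

variable {M : Type*} [AddCommGroup M] [Module ℂ M]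

theorem MemGenerated.normalOrder {ι : Type*} {even odd : ι → FormalDist M} {p q : ZMod 2}
    {A B : QField M} (hA : MemGenerated even odd p A.1) (hB : MemGenerated even odd q B.1) :
    MemGenerated even odd (p + q) (NO (koszul p q) A B).1 :=
  .prod (-1) hA hB fun n v => (normalOrd_eq_NO p q A B n v).symm

/-- The bracket with the zero mode is the `0`-th product, as the binomial coefficients of `0` over
`j > 0` vanish. -/
theorem MemGenerated.zeroMode {ι : Type*} {even odd : ι → FormalDist M} {p q : ZMod 2}
    {A B : QField M} (hA : MemGenerated even odd p A.1) (hB : MemGenerated even odd q B.1) :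
    MemGenerated even odd (p + q) (ad (koszul p q) (A.1 0) B).1 :=
  .prod 0 hA hB fun n v => by
    rw [nthProd, finsum_eq_single _ 0 fun j hj => ?_]
    · simp [ad_apply]
    · rw [Ring.choose_zero_pos _ (Nat.pos_of_ne_zero hj)]
      simp

theorem MemGenerated.sum {ι κ : Type*} {even odd : ι → FormalDist M} {p : ZMod 2}
    (s : Finset κ) (hs : s.Nonempty) {A : κ → QField M}
    (hA : ∀ i ∈ s, MemGenerated even odd p (A i).1) :
    MemGenerated even odd p (∑ i ∈ s, A i).1 := by
  induction hs using Finset.Nonempty.cons_induction with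
  | singleton a => simpa using hA a (by simp)
  | cons a s ha hs ih =>
    rw [Finset.sum_cons]
    exact (hA a (by simp)).add (ih fun i hi => hA i (by simp [hi]))

theorem MemGenerated.sub {ι : Type*} {even odd : ι → FormalDist M} {p : ZMod 2}
    {A B : FormalDist M} (hA : MemGenerated even odd p A) (hB : MemGenerated even odd p B) :
    MemGenerated even odd p (A - B) := by
  have := hA.add (hB.smul (-1))
  rwa [neg_one_smul, ← sub_eq_add_neg] at this

variable {S : ZMod 2 → Submodule ℂ M}

theorem HasParity.normalOrder {p q : ZMod 2} {A B : QField M} (ε : ℂ)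
    (hA : HasParity S p A.1) (hB : HasParity S q B.1) : HasParity S (p + q) (NO ε A B).1 := by
  intro n r v hv
  obtain ⟨N, hN⟩ := (NO_eventually ε A B n v).exists
  rw [hN]
  refine Submodule.sum_mem _ fun j _ => Submodule.add_mem _ ?_ (Submodule.smul_mem _ _ ?_)
  · rw [add_assoc]; exact hA _ _ _ (hB _ _ _ hv)
  · rw [add_comm p, add_assoc]; exact hB _ _ _ (hA _ _ _ hv)

theorem HasParity.supercomm {p q : ZMod 2} {A B : QField M} (η : ℂ) (m : ℤ)
    (hA : HasParity S p A.1) (hB : HasParity S q B.1) :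
    HasParity S (p + q) (ad η (A.1 m) B).1 := by
  intro n r v hv
  rw [ad_apply]
  refine Submodule.sub_mem _ ?_ (Submodule.smul_mem _ _ ?_)
  · rw [add_assoc]; exact hA _ _ _ (hB _ _ _ hv)
  · rw [add_comm p, add_assoc]; exact hB _ _ _ (hA _ _ _ hv)

theorem HasParity.add {p : ZMod 2} {A B : FormalDist M}
    (hA : HasParity S p A) (hB : HasParity S p B) : HasParity S p (A + B) :=
  fun n r v hv => Submodule.add_mem _ (hA n r v hv) (hB n r v hv)

theorem HasParity.sub {p : ZMod 2} {A B : FormalDist M}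
    (hA : HasParity S p A) (hB : HasParity S p B) : HasParity S p (A - B) :=
  fun n r v hv => Submodule.sub_mem _ (hA n r v hv) (hB n r v hv)

theorem HasParity.smul {p : ZMod 2} {A : FormalDist M} (c : ℂ)
    (hA : HasParity S p A) : HasParity S p (c • A) :=
  fun n r v hv => Submodule.smul_mem _ _ (hA n r v hv)

theorem HasParity.sum {κ : Type*} {p : ZMod 2} (s : Finset κ) {A : κ → QField M}
    (hA : ∀ i ∈ s, HasParity S p (A i).1) : HasParity S p (∑ i ∈ s, A i).1 := by
  intro n r v hv
  rw [val_sum_apply, LinearMap.sum_apply]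
  exact Submodule.sum_mem _ fun i hi => hA i hi n r v hv

end Membership

/-! ### The currents on the space of states -/

section States

open Filter QField

theorem cur_add_toEnvelope (a b : DLieC) (n : ℤ) :
    (Gen.cur (a + b) n).toEnvelope = (Gen.cur a n).toEnvelope + (Gen.cur b n).toEnvelope :=
  (RingQuot.mkAlgHom_rel ℂ (AffineRel.cur_add a b n)).trans (map_add _ _ _)

theorem cur_smul_toEnvelope (c : ℂ) (a : DLieC) (n : ℤ) :
    (Gen.cur (c • a) n).toEnvelope = c • (Gen.cur a n).toEnvelope :=
  (RingQuot.mkAlgHom_rel ℂ (AffineRel.cur_smul c a n)).trans (map_smul _ _ _)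

theorem bar_add_toEnvelope (a b : DLieC) (n : ℤ) :
    (Gen.bar (a + b) n).toEnvelope = (Gen.bar a n).toEnvelope + (Gen.bar b n).toEnvelope :=
  (RingQuot.mkAlgHom_rel ℂ (AffineRel.bar_add a b n)).trans (map_add _ _ _)

theorem bar_smul_toEnvelope (c : ℂ) (a : DLieC) (n : ℤ) :
    (Gen.bar (c • a) n).toEnvelope = c • (Gen.bar a n).toEnvelope :=
  (RingQuot.mkAlgHom_rel ℂ (AffineRel.bar_smul c a n)).trans (map_smul _ _ _)

theorem cur_cur_toEnvelope (a b : DLieC) (m n : ℤ) :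
    (Gen.cur a m).toEnvelope * (Gen.cur b n).toEnvelope
      - (Gen.cur b n).toEnvelope * (Gen.cur a m).toEnvelope
      = (Gen.cur ⁅a, b⁆ (m + n)).toEnvelope
        + algebraMap ℂ Envelope (if m + n = 0 then (m : ℂ) * pairingC a b else 0) := by
  have h := RingQuot.mkAlgHom_rel ℂ (AffineRel.cur_cur a b m n)
  rw [map_sub, map_mul, map_mul, map_add, AlgHom.commutes] at h
  exact h

theorem cur_bar_toEnvelope (a b : DLieC) (m n : ℤ) :
    (Gen.cur a m).toEnvelope * (Gen.bar b n).toEnvelope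
      - (Gen.bar b n).toEnvelope * (Gen.cur a m).toEnvelope
      = (Gen.bar ⁅a, b⁆ (m + n)).toEnvelope := by
  have h := RingQuot.mkAlgHom_rel ℂ (AffineRel.cur_bar a b m n)
  rw [map_sub, map_mul, map_mul] at h
  exact h

theorem bar_bar_toEnvelope (a b : DLieC) (m n : ℤ) :
    (Gen.bar a m).toEnvelope * (Gen.bar b n).toEnvelope
      + (Gen.bar b n).toEnvelope * (Gen.bar a m).toEnvelope
      = algebraMap ℂ Envelope (if m + n = -1 then pairingC a b else 0) := by
  have h := RingQuot.mkAlgHom_rel ℂ (AffineRel.bar_bar a b m n)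
  rw [map_add, map_mul, map_mul, AlgHom.commutes] at h
  exact h

theorem current_cur_cur (a b : DLieC) (m n : ℤ) :
    current a m * current b n - current b n * current a m
      = current ⁅a, b⁆ (m + n)
        + algebraMap ℂ (Module.End ℂ States) (if m + n = 0 then (m : ℂ) * pairingC a b else 0) := by
  have h := congrArg (Algebra.lsmul ℂ ℂ States) (cur_cur_toEnvelope a b m n)
  rw [map_sub, map_mul, map_mul, map_add, AlgHom.commutes] at h
  exact h

theorem current_cur_bar (a b : DLieC) (m n : ℤ) :
    current a m * oddCurrent b n - oddCurrent b n * current a m = oddCurrent ⁅a, b⁆ (m + n) := by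
  have h := congrArg (Algebra.lsmul ℂ ℂ States) (cur_bar_toEnvelope a b m n)
  rw [map_sub, map_mul, map_mul] at h
  exact h

theorem current_bar_bar (a b : DLieC) (m n : ℤ) :
    oddCurrent a m * oddCurrent b n + oddCurrent b n * oddCurrent a m
      = algebraMap ℂ (Module.End ℂ States) (if m + n = -1 then pairingC a b else 0) := by
  have h := congrArg (Algebra.lsmul ℂ ℂ States) (bar_bar_toEnvelope a b m n)
  rw [map_add, map_mul, map_mul, AlgHom.commutes] at h
  exact h

theorem current_apply (a : DLieC) (n : ℤ) (v : States) :
    current a n v = (Gen.cur a n).toEnvelope • v := rfl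

theorem oddCurrent_apply (a : DLieC) (n : ℤ) (v : States) :
    oddCurrent a n v = (Gen.bar a n).toEnvelope • v := rfl

/-- The projection of the free algebra onto the enveloping algebra. -/
def freeToEnvelope : FreeAlgebra ℂ Gen →ₐ[ℂ] Envelope := RingQuot.mkAlgHom ℂ AffineRel

/-- A subspace of the states which contains the functions and is stable under the currents is
everything. -/
theorem states_submodule_eq_top (N : Submodule ℂ States)
    (h0 : ∀ f : SmoothFunctions, toStates (1 ⊗ₜ[ℂ] f) ∈ N)
    (h1 : ∀ (g : Gen) (v : States), v ∈ N → g.toEnvelope • v ∈ N) : N = ⊤ := by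
  have h2 : ∀ (u : FreeAlgebra ℂ Gen) (v : States), v ∈ N →
      freeToEnvelope u • v ∈ N := by
    intro u
    induction u using FreeAlgebra.induction with
    | grade0 c =>
      intro v hv
      have : freeToEnvelope (algebraMap ℂ _ c)
          = algebraMap ℂ Envelope c := AlgHom.commutes _ c
      rw [this, algebraMap_smul]
      exact N.smul_mem c hv
    | grade1 g => exact fun v hv => h1 g v hv
    | mul a b ha hb =>
      intro v hv
      have : freeToEnvelope (a * b) • v
          = freeToEnvelope a •
            freeToEnvelope b • v := by
        rw [map_mul, mul_smul]
      rw [this]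
      exact ha _ (hb _ hv)
    | add a b ha hb =>
      intro v hv
      have : freeToEnvelope (a + b) • v
          = freeToEnvelope a • v +
            freeToEnvelope b • v := by
        rw [map_add, add_smul]
      rw [this]
      exact N.add_mem (ha _ hv) (hb _ hv)
  refine eq_top_iff.2 fun v _ => ?_
  obtain ⟨t, rfl⟩ := Submodule.mkQ_surjective inducedRelations v
  change toStates t ∈ N
  induction t using TensorProduct.induction_on with
  | zero => rw [map_zero]; exact N.zero_mem
  | add x y hx hy => rw [map_add]; exact N.add_mem (hx trivial) (hy trivial)
  | tmul e f =>
    obtain ⟨u, rfl⟩ : ∃ u, freeToEnvelope u = e := RingQuot.mkAlgHom_surjective ℂ AffineRel e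
    have : toStates (freeToEnvelope u ⊗ₜ[ℂ] f)
        = freeToEnvelope u • toStates (1 ⊗ₜ[ℂ] f) := by
      rw [← map_smul, TensorProduct.smul_tmul', smul_eq_mul, mul_one]
    rw [this]
    exact h2 u _ (h0 f)

/-- The states annihilated by the modes of large degree of every current. -/
def smoothStates : Submodule ℂ States where
  carrier := {v | ∀ a, (∀ᶠ n : ℤ in atTop, current a n v = 0) ∧
    ∀ᶠ n : ℤ in atTop, oddCurrent a n v = 0}
  add_mem' {v w} hv hw a := by
    refine ⟨?_, ?_⟩
    · filter_upwards [(hv a).1, (hw a).1] with n h1 h2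
      rw [map_add, h1, h2, add_zero]
    · filter_upwards [(hv a).2, (hw a).2] with n h1 h2
      rw [map_add, h1, h2, add_zero]
  zero_mem' a := by simp
  smul_mem' c v hv a := by
    refine ⟨?_, ?_⟩
    · filter_upwards [(hv a).1] with n h1
      rw [map_smul, h1, smul_zero]
    · filter_upwards [(hv a).2] with n h1
      rw [map_smul, h1, smul_zero]

theorem eventually_add_const {P : ℤ → Prop} (h : ∀ᶠ n : ℤ in atTop, P n) (m : ℤ) :
    ∀ᶠ n : ℤ in atTop, P (n + m) :=
  (tendsto_atTop_add_const_right atTop m tendsto_id).eventually h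

/-- Functions are annihilated by modes of large degree by the relations of the induced module. The
property passes from `v` to a mode applied to `v`, because the supercommutator of two modes is a
mode of a single current, up to a central term that is absent for large indices. -/
theorem smoothStates_eq_top : smoothStates = ⊤ := by
  refine states_submodule_eq_top _ (fun f a => ⟨?_, ?_⟩) ?_
  · filter_upwards [eventually_gt_atTop 0] with n hn
    rw [current_apply, ← map_smul, TensorProduct.smul_tmul', smul_eq_mul, mul_one]
    exact (Submodule.Quotient.mk_eq_zero _).2
      (Submodule.subset_span (Or.inl (Or.inl ⟨a, n, f, hn, rfl⟩)))
  · filter_upwards [eventually_ge_atTop 0] with n hn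
    rw [oddCurrent_apply, ← map_smul, TensorProduct.smul_tmul', smul_eq_mul, mul_one]
    exact (Submodule.Quotient.mk_eq_zero _).2
      (Submodule.subset_span (Or.inl (Or.inr ⟨a, n, f, hn, rfl⟩)))
  · rintro (⟨b, m⟩ | ⟨b, m⟩) v hv a
    · refine ⟨?_, ?_⟩
      · filter_upwards [(hv a).1, eventually_add_const (hv ⁅a, b⁆).1 m,
          eventually_gt_atTop (-m)] with n h1 h2 h3
        have h := LinearMap.congr_fun (current_cur_cur a b n m) v
        rw [if_neg (by omega), map_zero, add_zero, LinearMap.sub_apply, h2, Module.End.mul_apply,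
          Module.End.mul_apply, h1, map_zero, sub_zero] at h
        exact h
      · filter_upwards [(hv a).2, eventually_add_const (hv ⁅b, a⁆).2 m] with n h1 h2
        have h := LinearMap.congr_fun (current_cur_bar b a m n) v
        rw [add_comm m n, LinearMap.sub_apply, h2, Module.End.mul_apply,
          Module.End.mul_apply, h1, map_zero, zero_sub, neg_eq_zero] at h
        exact h
    · refine ⟨?_, ?_⟩
      · filter_upwards [(hv a).1, eventually_add_const (hv ⁅a, b⁆).2 m] with n h1 h2
        have h := LinearMap.congr_fun (current_cur_bar a b n m) v
        rw [LinearMap.sub_apply, h2, Module.End.mul_apply,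
          Module.End.mul_apply, h1, map_zero, sub_zero] at h
        exact h
      · filter_upwards [(hv a).2, eventually_gt_atTop (-m)] with n h1 h3
        have h := LinearMap.congr_fun (current_bar_bar a b n m) v
        rw [if_neg (by omega), map_zero, LinearMap.add_apply, Module.End.mul_apply,
          Module.End.mul_apply, h1, map_zero, add_zero] at h
        exact h

/-- The even currents as quantum fields. -/
def curField : DLieC →ₗ[ℂ] QField States where
  toFun a := ⟨current a, isQuantumField_iff.2 fun v =>
    ((smoothStates_eq_top ▸ Submodule.mem_top : v ∈ smoothStates) a).1⟩
  map_add' a b := QField.ext fun n v => by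
    change current (a + b) n v = current a n v + current b n v
    simp only [current_apply, cur_add_toEnvelope, add_smul]
  map_smul' c a := QField.ext fun n v => by
    change current (c • a) n v = c • current a n v
    simp only [current_apply, cur_smul_toEnvelope, smul_assoc]

/-- The odd currents as quantum fields. -/
def barField : DLieC →ₗ[ℂ] QField States where
  toFun a := ⟨oddCurrent a, isQuantumField_iff.2 fun v =>
    ((smoothStates_eq_top ▸ Submodule.mem_top : v ∈ smoothStates) a).2⟩
  map_add' a b := QField.ext fun n v => by
    change oddCurrent (a + b) n v = oddCurrent a n v + oddCurrent b n v
    simp only [oddCurrent_apply, bar_add_toEnvelope, add_smul]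
  map_smul' c a := QField.ext fun n v => by
    change oddCurrent (c • a) n v = c • oddCurrent a n v
    simp only [oddCurrent_apply, bar_smul_toEnvelope, smul_assoc]

theorem curField_val (a : DLieC) : (curField a).1 = current a := rfl

theorem barField_val (a : DLieC) : (barField a).1 = oddCurrent a := rfl

theorem currentSystem_states : CurrentSystem pairingC curField barField where
  cur_cur a b n := val_injective <| funext fun k => by
    rw [ad_apply, one_smul, curField_val, curField_val, current_cur_cur, val_add_apply,
      val_smul_apply, shift_apply, shift_apply, one_apply, add_comm n k, curField_val]
    congr 1
    split_ifs with h1 h2 h2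
    · rw [Algebra.algebraMap_eq_smul_one]
    · omega
    · omega
    · simp
  cur_bar a b n := val_injective <| funext fun k => by
    rw [ad_apply, one_smul, curField_val, barField_val, current_cur_bar, shift_apply, add_comm n k,
      barField_val]
  bar_cur a b n := val_injective <| funext fun k => by
    rw [ad_apply, one_smul, curField_val, barField_val, ← neg_sub, current_cur_bar, shift_apply,
      ← lie_skew a b, map_neg, val_neg_apply, barField_val]
  bar_bar a b n := val_injective <| funext fun k => by
    rw [ad_apply, neg_one_smul, sub_neg_eq_add, barField_val, barField_val, current_bar_bar,
      val_smul_apply, shift_apply, one_apply, add_comm n k]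
    split_ifs with h1
    · rw [Algebra.algebraMap_eq_smul_one]
    · simp

theorem toEnvelope_smul_mem (g : Gen) (q : ZMod 2) (v : States) (hv : v ∈ stateParity q) :
    g.toEnvelope • v ∈ stateParity (g.parity + q) := by
  induction hv using Submodule.span_induction with
  | mem x hx =>
    obtain ⟨l, f, hl, rfl⟩ := hx
    refine Submodule.subset_span ⟨g :: l, f, ?_, ?_⟩
    · rw [List.map_cons, List.sum_cons, hl]
    · rw [List.map_cons, List.prod_cons, mul_smul]
  | zero => rw [smul_zero]; exact Submodule.zero_mem _
  | add x y _ _ hx hy => rw [smul_add]; exact Submodule.add_mem _ hx hy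
  | smul c x _ hx =>
    have : g.toEnvelope • c • x = c • g.toEnvelope • x :=
      map_smul (Algebra.lsmul ℂ ℂ States g.toEnvelope) c x
    rw [this]; exact Submodule.smul_mem _ _ hx

theorem hasParity_curField (a : DLieC) : HasParity stateParity 0 (curField a).1 :=
  fun n q v hv => toEnvelope_smul_mem (.cur a n) q v hv

theorem hasParity_barField (a : DLieC) : HasParity stateParity 1 (barField a).1 :=
  fun n q v hv => toEnvelope_smul_mem (.bar a n) q v hv

end States

end DoubledTorus

end

noncomputable section

namespace DoubledTorus

/-! ### Left-invariant complex structures -/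

theorem pairing_apply (x y : DLie) :
    pairing x y = ∑ i, (x.1 i * y.2 i + x.2 i * y.1 i) := rfl

theorem pairing_comm (x y : DLie) : pairing x y = pairing y x := by
  simp only [pairing_apply]
  exact Finset.sum_congr rfl fun i _ => by ring

theorem pairing_lie (x y z : DLie) : pairing ⁅x, y⁆ z = pairing x ⁅y, z⁆ := by
  rw [pairing_apply, pairing_apply]
  change ∑ i, (detForm x.2 y.2 i * z.2 i + 0 * z.1 i) = ∑ i, (x.1 i * 0 + x.2 i * detForm y.2 z.2 i)
  simp [Fin.sum_univ_four, detForm]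
  ring

theorem pairing_nondegenerate : pairing.Nondegenerate := by
  have h : pairing.SeparatingLeft := fun x hx => by
    refine Prod.ext (funext fun i => ?_) (funext fun i => ?_)
    · have h1 : ∑ k, (x.1 k * Pi.single (M := fun _ => ℝ) i 1 k + x.2 k * 0) = 0 :=
        hx ((0, Pi.single i 1) : (Fin 4 → ℝ) × (Fin 4 → ℝ))
      simp only [mul_zero, add_zero, Pi.single_apply, mul_ite, mul_one,
        Finset.sum_ite_eq', Finset.mem_univ, if_true] at h1
      exact h1
    · have h1 : ∑ k, (x.1 k * 0 + x.2 k * Pi.single (M := fun _ => ℝ) i 1 k) = 0 :=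
        hx ((Pi.single i 1, 0) : (Fin 4 → ℝ) × (Fin 4 → ℝ))
      simp only [mul_zero, zero_add, Pi.single_apply, mul_ite, mul_one,
        Finset.sum_ite_eq', Finset.mem_univ, if_true] at h1
      exact h1
  exact ⟨h, fun y hy => h y fun x => by rw [pairing_comm]; exact hy x⟩

/-- The linear map `u ↦ u + ½ [x, u]`, the differential at the identity of the left translation
by `exp x`. -/
def leftMap (x : DLie) : DLie →L[ℝ] DLie :=
  LinearMap.toContinuousLinearMap
    (LinearMap.id + (1 / 2 : ℝ) • (LieAlgebra.ad ℝ DLie x : DLie →ₗ[ℝ] DLie))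

theorem leftMap_apply (x u : DLie) : leftMap x u = u + (1 / 2 : ℝ) • ⁅x, u⁆ := rfl

/-- In exponential coordinates of a two-step nilpotent group left translations are affine, so the
differential is the same at every point. -/
theorem dLeft_eq (h : DGroup) (x : DLie) : dLeft h x = leftMap h.log := by
  have h1 : (fun y : DLie => (h * ⟨y⟩).log) = fun y => h.log + leftMap h.log y := by
    funext y
    rw [mul_log, leftMap_apply, add_assoc]
  rw [dLeft, h1, fderiv_const_add]
  exact (leftMap h.log).fderiv

/-- The left-invariant vector field with value `u` at the identity. -/
def invField (u : DLie) : DLie → DLie := fun y => u + (1 / 2 : ℝ) • ⁅y, u⁆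

theorem invField_eq (u : DLie) :
    invField u = fun y => u + (-(1 / 2 : ℝ) • LinearMap.toContinuousLinearMap
      (LieAlgebra.ad ℝ DLie u : DLie →ₗ[ℝ] DLie)) y := by
  funext y
  change u + (1 / 2 : ℝ) • ⁅y, u⁆ = u + -(1 / 2 : ℝ) • ⁅u, y⁆
  rw [← lie_skew y u, smul_neg, neg_smul]

theorem contDiff_invField (u : DLie) : ContDiff ℝ ∞ (invField u) := by
  rw [invField_eq]
  exact contDiff_const.add (ContinuousLinearMap.contDiff _)

theorem fderiv_invField (u x v : DLie) : fderiv ℝ (invField u) x v = (1 / 2 : ℝ) • ⁅v, u⁆ := by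
  rw [invField_eq, fderiv_const_add, ContinuousLinearMap.fderiv]
  change -(1 / 2 : ℝ) • ⁅u, v⁆ = _
  rw [← lie_skew v u, smul_neg, neg_smul]

theorem invField_zero (u : DLie) : invField u 0 = u := by
  simp [invField]

theorem lieBracket_invField (u v : DLie) :
    VectorField.lieBracket ℝ (invField u) (invField v) 0 = ⁅u, v⁆ := by
  rw [VectorField.lieBracket_eq]
  simp only [invField_zero, fderiv_invField]
  rw [← lie_skew u v]
  module

/-- The data at the identity of an orthogonal left-invariant complex structure. -/
structure IsInvariantComplexStructure (j : DLie →ₗ[ℝ] DLie) : Prop where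
  sq : ∀ x, j (j x) = -x
  orth : ∀ x y, pairing (j x) (j y) = pairing x y
  nijenhuis : ∀ x y, ⁅j x, j y⁆ - j ⁅j x, y⁆ - j ⁅x, j y⁆ - ⁅x, y⁆ = 0

theorem IsComplexStructure.atIdentity {𝒥 : DLie → DLie →L[ℝ] DLie}
    (h𝒥 : IsComplexStructure 𝒥) (heq : IsEquivariant 𝒥) (horth : IsOrthogonal 𝒥) :
    IsInvariantComplexStructure (𝒥 0 : DLie →ₗ[ℝ] DLie) where
  sq x := congrArg (fun T : DLie →L[ℝ] DLie => T x) (h𝒥.sq 0)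
  orth x y := by
    have h0 : ∀ u : DLie, dLeft (DGroup.exp 0)⁻¹ 0 u = u := fun u => by
      rw [dLeft_eq]
      change u + (1 / 2 : ℝ) • ⁅-(0 : DLie), u⁆ = u
      simp
    have := horth 0 x y
    simp only [metric, h0] at this
    exact this
  nijenhuis u v := by
    -- Equivariance under the translation from `0` to `y`: `𝒥` maps left-invariant fields to
    -- left-invariant fields, which makes the integrability condition algebraic.
    have key : ∀ u, (fun y => 𝒥 y (invField u y)) = invField (𝒥 0 u) := fun u => by
      funext y
      have h1 := congrArg (fun T : DLie →L[ℝ] DLie => T u) (heq ⟨y⟩ 0)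
      simp only [dLeft_eq, ContinuousLinearMap.comp_apply, leftMap_apply] at h1
      rw [mul_log] at h1
      simpa [invField] using h1.symm
    have h1 := h𝒥.integrable (invField u) (invField v) (contDiff_invField u)
      (contDiff_invField v) 0
    simp only [key, lieBracket_invField] at h1
    exact h1

namespace IsInvariantComplexStructure

variable {j : DLie →ₗ[ℝ] DLie}

theorem skew (h : IsInvariantComplexStructure j) (x y : DLie) :
    pairing (j x) y = -pairing x (j y) := by
  rw [← h.orth x (j y), h.sq, map_neg, neg_neg]

theorem pairing_self (h : IsInvariantComplexStructure j) (x : DLie) : pairing (j x) x = 0 := by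
  have := h.skew x x
  rw [pairing_comm x] at this
  linarith

end IsInvariantComplexStructure

/-! ### Extension of scalars -/

theorem DLieC.induction₂ {P : DLieC → DLieC → Prop} (x y : DLieC)
    (tmul : ∀ a u b v, P (a ⊗ₜ u) (b ⊗ₜ v)) (zero_left : ∀ y, P 0 y) (zero_right : ∀ x, P x 0)
    (add_left : ∀ x x' y, P x y → P x' y → P (x + x') y)
    (add_right : ∀ x y y', P x y → P x y' → P x (y + y')) : P x y := by
  induction x using TensorProduct.induction_on with
  | zero => exact zero_left y
  | add x x' h h' => exact add_left _ _ _ h h'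
  | tmul a u =>
    induction y using TensorProduct.induction_on with
    | zero => exact zero_right _
    | add x x' h h' => exact add_right _ _ _ h h'
    | tmul b v => exact tmul a u b v

theorem pairingC_tmul (a b : ℂ) (x y : DLie) :
    pairingC (a ⊗ₜ x) (b ⊗ₜ y) = pairing x y • (a * b) :=
  LinearMap.BilinForm.baseChange_tmul ..

theorem pairingC_comm (x y : DLieC) : pairingC x y = pairingC y x := by
  refine DLieC.induction₂ (P := fun x y => pairingC x y = pairingC y x) x y
    (fun a u b v => ?_) (fun y => by simp) (fun y => by simp) (fun x x' y h h' => by simp [h, h'])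
    (fun x x' y h h' => by simp [h, h'])
  rw [pairingC_tmul, pairingC_tmul, pairing_comm, mul_comm]

theorem lieC_add (x y z : DLieC) : ⁅x, y + z⁆ = ⁅x, y⁆ + ⁅x, z⁆ := lie_add x y z

theorem lieC_zero (x : DLieC) : ⁅x, (0 : DLieC)⁆ = 0 := lie_zero x

theorem pairingC_lie (x y z : DLieC) : pairingC ⁅x, y⁆ z = pairingC x ⁅y, z⁆ := by
  refine DLieC.induction₂ (P := fun x y => pairingC ⁅x, y⁆ z = pairingC x ⁅y, z⁆) x y
    (fun a u b v => ?_) (fun y => by simp) (fun y => by simp [lieC_zero])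
    (fun x x' y h h' => by simp [h, h'])
    (fun x x' y h h' => by simp [lieC_add, h, h'])
  induction z using TensorProduct.induction_on with
  | zero => simp [lieC_zero]
  | add x x' h h' => rw [map_add, h, h', lieC_add, map_add]
  | tmul c w =>
    simp only [LieAlgebra.ExtendScalars.bracket_tmul, pairingC_tmul, pairing_lie, mul_assoc]

theorem pairingC_nondegenerate : pairingC.Nondegenerate := by
  have h : pairingC.SeparatingLeft := fun x hx => by
    let c := Module.finBasis ℝ DLie
    let b := pairing.dualBasis pairing_nondegenerate c
    apply (b.baseChange ℂ).repr.injective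
    ext i
    -- Coordinates in the dual basis are pairings with the original basis, and this persists after
    -- extension of scalars.
    have h1 : ∀ x : DLieC, (b.baseChange ℂ).repr x i = pairingC x (1 ⊗ₜ c i) := fun x => by
      induction x using TensorProduct.induction_on with
      | zero => simp
      | add x y hx hy => simp [hx, hy]
      | tmul a u =>
        rw [pairingC_tmul, Module.Basis.baseChange_repr_tmul,
          LinearMap.BilinForm.dualBasis_repr_apply, mul_one]
    rw [h1, hx]; simp
  exact ⟨h, fun y hy => h y fun x => by rw [pairingC_comm]; exact hy x⟩

namespace IsInvariantComplexStructure

variable {j : DLie →ₗ[ℝ] DLie}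

theorem sqC (h : IsInvariantComplexStructure j) (x : DLieC) :
    j.baseChange ℂ (j.baseChange ℂ x) = -x := by
  induction x using TensorProduct.induction_on with
  | zero => simp
  | add x y hx hy => rw [map_add, map_add, hx, hy, neg_add]
  | tmul a u =>
    rw [LinearMap.baseChange_tmul, LinearMap.baseChange_tmul, h.sq, TensorProduct.tmul_neg]

theorem orthC (h : IsInvariantComplexStructure j) (x y : DLieC) :
    pairingC (j.baseChange ℂ x) (j.baseChange ℂ y) = pairingC x y := by
  refine DLieC.induction₂
    (P := fun x y => pairingC (j.baseChange ℂ x) (j.baseChange ℂ y) = pairingC x y) x y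
    (fun a u b v => ?_) (fun y => by simp) (fun y => by simp) (fun x x' y h h' => by simp [h, h'])
    (fun x x' y h h' => by simp [h, h'])
  rw [LinearMap.baseChange_tmul, LinearMap.baseChange_tmul, pairingC_tmul, pairingC_tmul, h.orth]

theorem nijenhuisC (h : IsInvariantComplexStructure j) (x y : DLieC) :
    ⁅j.baseChange ℂ x, j.baseChange ℂ y⁆ - j.baseChange ℂ ⁅j.baseChange ℂ x, y⁆
      - j.baseChange ℂ ⁅x, j.baseChange ℂ y⁆ - ⁅x, y⁆ = 0 := by
  refine DLieC.induction₂
    (P := fun x y => ⁅j.baseChange ℂ x, j.baseChange ℂ y⁆ - j.baseChange ℂ ⁅j.baseChange ℂ x, y⁆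
      - j.baseChange ℂ ⁅x, j.baseChange ℂ y⁆ - ⁅x, y⁆ = 0) x y
    (fun a u b v => ?_) (fun y => by simp) (fun y => by simp [lieC_zero])
    (fun x x' y h h' => ?_) (fun x y y' h h' => ?_)
  · simp only [LinearMap.baseChange_tmul, LieAlgebra.ExtendScalars.bracket_tmul,
      ← TensorProduct.tmul_sub, h.nijenhuis, TensorProduct.tmul_zero]
  · simp only [map_add, add_lie]
    linear_combination (norm := abel) h + h'
  · simp only [map_add, lieC_add]
    linear_combination (norm := abel) h + h'

/-- On eigenvectors the Nijenhuis identity reads `-2 [x, y] - 2 ε j [x, y] = 0`; multiplying by `ε`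
gives the claim. -/
theorem eigenspace_lie_mem (h : IsInvariantComplexStructure j) {ε : ℂ} (hε : ε * ε = -1)
    {x y : DLieC} (hx : x ∈ Module.End.eigenspace (j.baseChange ℂ) ε)
    (hy : y ∈ Module.End.eigenspace (j.baseChange ℂ) ε) :
    ⁅x, y⁆ ∈ Module.End.eigenspace (j.baseChange ℂ) ε := by
  rw [Module.End.mem_eigenspace_iff] at hx hy ⊢
  have h1 := h.nijenhuisC x y
  have h2 : ⁅x, ε • y⁆ = ε • ⁅x, y⁆ := lie_smul ε x y
  have h3 : ∀ z : DLieC, ⁅ε • x, z⁆ = ε • ⁅x, z⁆ := fun z => smul_lie ε x z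
  rw [hx, hy, h3, h3, h2, map_smul, smul_smul, hε] at h1
  have h4 := congrArg (ε • ·) h1
  simp only [smul_sub, smul_smul, hε, smul_zero] at h4
  linear_combination (norm := module) (1 / 2 : ℂ) • h4

/-- Orthogonality multiplies the pairing of two eigenvectors by `ε² = -1` without changing it. -/
theorem eigenspace_isotropic (h : IsInvariantComplexStructure j) {ε : ℂ} (hε : ε * ε = -1)
    {x y : DLieC} (hx : x ∈ Module.End.eigenspace (j.baseChange ℂ) ε)
    (hy : y ∈ Module.End.eigenspace (j.baseChange ℂ) ε) : pairingC x y = 0 := by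
  rw [Module.End.mem_eigenspace_iff] at hx hy
  have h1 := h.orthC x y
  rw [hx, hy, map_smul, map_smul, LinearMap.smul_apply, smul_smul, hε, neg_one_smul] at h1
  exact self_eq_neg.1 h1.symm

theorem eigenspace_isCompl (h : IsInvariantComplexStructure j) :
    IsCompl (Module.End.eigenspace (j.baseChange ℂ) Complex.I)
      (Module.End.eigenspace (j.baseChange ℂ) (-Complex.I)) := by
  constructor
  · rw [Submodule.disjoint_def]
    intro x hx hy
    rw [Module.End.mem_eigenspace_iff] at hx hy
    have h1 : (2 * Complex.I) • x = 0 := by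
      linear_combination (norm := module) hy - hx
    exact (smul_eq_zero.1 h1).resolve_left (by simp)
  · rw [codisjoint_iff, eq_top_iff]
    intro x _
    have hI := Complex.I_mul_I
    refine Submodule.mem_sup.2 ⟨(1 / 2 : ℂ) • (x - Complex.I • j.baseChange ℂ x), ?_,
      (1 / 2 : ℂ) • (x + Complex.I • j.baseChange ℂ x), ?_, by module⟩
    all_goals
      rw [Module.End.mem_eigenspace_iff]
      simp only [map_smul, map_sub, map_add, h.sqC, smul_add, smul_sub, smul_smul, smul_neg]
      simp only [neg_mul,
        show Complex.I * (1 / 2 * Complex.I) = -1 / 2 by linear_combination (1 / 2) * hI]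
      module

theorem isManinTriple (h : IsInvariantComplexStructure j) :
    IsManinTriple pairingC (Module.End.eigenspace (j.baseChange ℂ) Complex.I)
      (Module.End.eigenspace (j.baseChange ℂ) (-Complex.I)) where
  symm := pairingC_comm
  nondegenerate := pairingC_nondegenerate
  invariant := pairingC_lie
  lie_mem_left _ hx _ hy := h.eigenspace_lie_mem Complex.I_mul_I hx hy
  lie_mem_right _ hx _ hy := h.eigenspace_lie_mem (by simp) hx hy
  isotropic_left _ hx _ hy := h.eigenspace_isotropic Complex.I_mul_I hx hy
  isotropic_right _ hx _ hy := h.eigenspace_isotropic (by simp) hx hy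
  isCompl := h.eigenspace_isCompl

end IsInvariantComplexStructure

end DoubledTorus

end

noncomputable section

namespace DoubledTorus

/-! ### A central Lagrangian subspace stable under the complex structure -/

/-- The basis vector `αⁱ`. -/
def alpha (i : Fin 4) : DLie := ((Pi.single i 1, 0) : (Fin 4 → ℝ) × (Fin 4 → ℝ))

theorem pairing_alpha (x : DLie) (i : Fin 4) : pairing x (alpha i) = x.2 i := by
  have h1 : pairing x (alpha i) = ∑ k, (x.1 k * 0 + x.2 k * Pi.single (M := fun _ => ℝ) i 1 k) :=
    rfl
  simpa [Pi.single_apply] using h1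

theorem alpha_lie (i : Fin 4) (x : DLie) : ⁅alpha i, x⁆ = 0 :=
  Prod.ext (detForm_zero_left _) rfl

theorem lie_alpha (x : DLie) (i : Fin 4) : ⁅x, alpha i⁆ = 0 :=
  Prod.ext (detForm_zero_right _) rfl

theorem exists_pairing_eq {n : ℕ} {v : Fin n → DLie} (hv : LinearIndependent ℝ v)
    (c : Fin n → ℝ) : ∃ p : DLie, ∀ i, pairing p (v i) = c i := by
  obtain ⟨f, hf⟩ := LinearMap.exists_extend ((Module.Basis.span hv).constr ℝ c)
  refine ⟨(pairing.toDual pairing_nondegenerate).symm f, fun i => ?_⟩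
  rw [← LinearMap.BilinForm.toDual_def pairing_nondegenerate, LinearEquiv.apply_symm_apply]
  have h1 : f (v i) = (f ∘ₗ (Submodule.span ℝ (Set.range v)).subtype) (Module.Basis.span hv i) := by
    rw [LinearMap.comp_apply, Submodule.subtype_apply, Module.Basis.span_apply]
  rw [h1, hf, Module.Basis.constr_basis]

namespace IsInvariantComplexStructure

variable {j : DLie →ₗ[ℝ] DLie}

theorem j_alpha_antisymm (h : IsInvariantComplexStructure j) (i k : Fin 4) :
    (j (alpha i)).2 k = -(j (alpha k)).2 i := by
  rw [← pairing_alpha, ← pairing_alpha, h.skew, pairing_comm]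

/-- On central vectors every term of the Nijenhuis tensor but the bracket of the images vanishes. -/
theorem detForm_j_alpha (h : IsInvariantComplexStructure j) (i k : Fin 4) :
    detForm (j (alpha i)).2 (j (alpha k)).2 = 0 := by
  have h1 := h.nijenhuis (alpha i) (alpha k)
  rw [alpha_lie, alpha_lie, lie_alpha, map_zero, sub_zero, sub_zero, sub_zero] at h1
  exact congrArg Prod.fst h1

/-- These components form an antisymmetric `3 × 3` matrix with parallel rows. Its rank is even and
at most one, hence zero. Concretely, each principal `2 × 2` minor is the square of an off-diagonal
entry. As a consequence `j αⁱ` has no `β`-component except along `β₀`, and so is central. -/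
theorem j_alpha_snd (h : IsInvariantComplexStructure j) {i k : Fin 4} (hi : i ≠ 0) (hk : k ≠ 0) :
    (j (alpha i)).2 k = 0 := by
  have A := h.j_alpha_antisymm
  have D : ∀ i k l, detForm (j (alpha i)).2 (j (alpha k)).2 l = 0 := fun i k l =>
    congrFun (h.detForm_j_alpha i k) l
  have d11 := A 1 1
  have d22 := A 2 2
  have d33 := A 3 3
  have e12 : (j (alpha 1)).2 1 * (j (alpha 2)).2 2 - (j (alpha 1)).2 2 * (j (alpha 2)).2 1 = 0 :=
    D 1 2 3
  have e13 : (j (alpha 1)).2 3 * (j (alpha 3)).2 1 - (j (alpha 1)).2 1 * (j (alpha 3)).2 3 = 0 :=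
    D 1 3 2
  have e23 : (j (alpha 2)).2 2 * (j (alpha 3)).2 3 - (j (alpha 2)).2 3 * (j (alpha 3)).2 2 = 0 :=
    D 2 3 1
  have z11 : (j (alpha 1)).2 1 = 0 := by linarith
  have z22 : (j (alpha 2)).2 2 = 0 := by linarith
  have z33 : (j (alpha 3)).2 3 = 0 := by linarith
  have z12 : (j (alpha 1)).2 2 = 0 := by
    rw [z11, A 2 1] at e12
    exact mul_self_eq_zero.1 (by linarith)
  have z13 : (j (alpha 1)).2 3 = 0 := by
    rw [z11, A 3 1] at e13
    exact mul_self_eq_zero.1 (by linarith)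
  have z23 : (j (alpha 2)).2 3 = 0 := by
    rw [z22, A 3 2] at e23
    exact mul_self_eq_zero.1 (by linarith)
  have z21 := A 2 1
  have z31 := A 3 1
  have z32 := A 3 2
  rw [z12, neg_zero] at z21
  rw [z13, neg_zero] at z31
  rw [z23, neg_zero] at z32
  fin_cases i <;> fin_cases k <;> first | exact absurd rfl hi | exact absurd rfl hk | assumption

theorem j_alpha_lie (h : IsInvariantComplexStructure j) {i : Fin 4} (hi : i ≠ 0) (x : DLie) :
    ⁅j (alpha i), x⁆ = 0 := by
  have h1 := h.j_alpha_snd hi (k := 1) (by decide)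
  have h2 := h.j_alpha_snd hi (k := 2) (by decide)
  have h3 := h.j_alpha_snd hi (k := 3) (by decide)
  refine Prod.ext ?_ rfl
  change detForm (j (alpha i)).2 x.2 = 0
  funext k
  fin_cases k <;> simp [detForm, h1, h2, h3]

/-- With `j` as multiplication by `i`, this is the independence over `ℂ` of a nonzero vector and a
vector outside its complex line. -/
theorem linearIndependent_pair (h : IsInvariantComplexStructure j) {a b : DLie} (ha : a ≠ 0)
    (hb : ∀ s t : ℝ, b ≠ s • a + t • j a) : LinearIndependent ℝ ![a, j a, b, j b] := by
  rw [Fintype.linearIndependent_iff]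
  intro g hg
  simp only [Fin.sum_univ_four, Matrix.cons_val] at hg
  have hj := congrArg j hg
  simp only [map_add, map_smul, h.sq, map_zero] at hj
  have h23 : g 2 ^ 2 + g 3 ^ 2 = 0 := by
    by_contra hne
    refine hb (-(g 2 * g 0 + g 3 * g 1) / (g 2 ^ 2 + g 3 ^ 2))
      ((g 3 * g 0 - g 2 * g 1) / (g 2 ^ 2 + g 3 ^ 2)) ?_
    -- The relation is multiplied by `g 2 - g 3 j`, the conjugate of the coefficient of `b`.
    have h1 : (g 2 ^ 2 + g 3 ^ 2) • b
        = -(g 2 * g 0 + g 3 * g 1) • a + (g 3 * g 0 - g 2 * g 1) • j a := by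
      linear_combination (norm := module) g 2 • hg - g 3 • hj
    rw [div_eq_inv_mul, div_eq_inv_mul, mul_smul, mul_smul, ← smul_add, ← h1, smul_smul,
      inv_mul_cancel₀ hne, one_smul]
  have h2 : g 2 = 0 := by nlinarith [sq_nonneg (g 2), sq_nonneg (g 3)]
  have h3 : g 3 = 0 := by nlinarith [sq_nonneg (g 2), sq_nonneg (g 3)]
  rw [h2, h3] at hg hj
  have h01 : (g 0 ^ 2 + g 1 ^ 2) • a = 0 := by
    linear_combination (norm := module) g 0 • hg - g 1 • hj
  have h01' := (smul_eq_zero.1 h01).resolve_right ha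
  have h0 : g 0 = 0 := by nlinarith [sq_nonneg (g 0), sq_nonneg (g 1)]
  have h1 : g 1 = 0 := by nlinarith [sq_nonneg (g 0), sq_nonneg (g 1)]
  intro i
  fin_cases i <;> assumption

/-- Three independent vectors `α¹, α², α³` do not fit into the span of `α¹` and `j α¹`. -/
theorem exists_alpha_notMem (j : DLie →ₗ[ℝ] DLie) :
    ∃ i : Fin 4, i ≠ 0 ∧ ∀ s t : ℝ, alpha i ≠ s • alpha 1 + t • j (alpha 1) := by
  by_contra! hcon
  obtain ⟨s, t, h2⟩ := hcon 2 (by decide)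
  obtain ⟨s', t', h3⟩ := hcon 3 (by decide)
  have h4 : t' • alpha 2 - t • alpha 3 = (t' * s - t * s') • alpha 1 := by
    rw [h2, h3]; module
  have e : ∀ k, t' * Pi.single (M := fun _ => ℝ) (2 : Fin 4) 1 k
      - t * Pi.single (M := fun _ => ℝ) (3 : Fin 4) 1 k
      = (t' * s - t * s') * Pi.single (M := fun _ => ℝ) (1 : Fin 4) 1 k := fun k =>
    congrFun (congrArg Prod.fst h4) k
  have ht : t = 0 := by simpa using e 3
  have h5 : alpha 2 = s • alpha 1 := by rw [h2, ht]; module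
  have e2 : Pi.single (M := fun _ => ℝ) (2 : Fin 4) 1 2
      = s * Pi.single (M := fun _ => ℝ) (1 : Fin 4) 1 2 :=
    congrFun (congrArg Prod.fst h5) 2
  simp at e2

/-- Two vectors `a`, `b` and dual vectors `p`, `q` such that `a`, `j a`, `b`, `j b` span a central
Lagrangian subspace and `p`, `j p`, `q`, `j q` a complementary Lagrangian subspace. -/
structure IsAdapted (j : DLie →ₗ[ℝ] DLie) (u v : Fin 2 → DLie) : Prop where
  lie : ∀ (i : Fin 2) (x : DLie), ⁅u i, x⁆ = 0
  j_lie : ∀ (i : Fin 2) (x : DLie), ⁅j (u i), x⁆ = 0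
  uu : ∀ i k, pairing (u i) (u k) = 0
  uju : ∀ i k, pairing (u i) (j (u k)) = 0
  vu : ∀ i k, pairing (v i) (u k) = if i = k then 1 else 0
  vju : ∀ i k, pairing (v i) (j (u k)) = 0
  vv : ∀ i k, pairing (v i) (v k) = 0
  vjv : ∀ i k, pairing (v i) (j (v k)) = 0

/-- The vectors `α¹`, `αⁱ` and their images under `j` are central, and mutually orthogonal by
`j_alpha_snd` and orthogonality of `j`. Nondegeneracy provides dual vectors, which are then made
isotropic by corrections inside this subspace; such corrections do not change the pairings with it.
-/
theorem exists_isAdapted (h : IsInvariantComplexStructure j) : ∃ u v, IsAdapted j u v := by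
  obtain ⟨i, hi, hb⟩ := exists_alpha_notMem j
  have ha : alpha 1 ≠ 0 := fun h0 => by
    have := congrFun (congrArg Prod.fst h0) 1
    have h1 : Pi.single (M := fun _ => ℝ) (1 : Fin 4) 1 1 = 0 := this
    simp at h1
  have hli := h.linearIndependent_pair ha hb
  have hjj : ∀ i k : Fin 4, i ≠ 0 → k ≠ 0 → pairing (alpha i) (j (alpha k)) = 0 :=
    fun i k hi hk => by rw [pairing_comm, pairing_alpha, h.j_alpha_snd hk hi]
  have haa : ∀ i k : Fin 4, pairing (alpha i) (alpha k) = 0 := fun i k => pairing_alpha _ _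
  have h1i : (1 : Fin 4) ≠ 0 := by decide
  have jself : ∀ x, pairing x (j x) = 0 := fun x => by rw [pairing_comm, h.pairing_self]
  obtain ⟨a, hai⟩ : ∃ a, a = alpha 1 := ⟨_, rfl⟩
  obtain ⟨b, hbi⟩ : ∃ b, b = alpha i := ⟨_, rfl⟩
  have paa : pairing a a = 0 := hai ▸ haa 1 1
  have pab : pairing a b = 0 := hai ▸ hbi ▸ haa 1 i
  have pbb : pairing b b = 0 := hbi ▸ haa i i
  have pajb : pairing a (j b) = 0 := hai ▸ hbi ▸ hjj 1 i h1i hi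
  have pbja : pairing b (j a) = 0 := hai ▸ hbi ▸ hjj i 1 hi h1i
  have la : ∀ x : DLie, ⁅a, x⁆ = 0 := hai ▸ alpha_lie 1
  have lb : ∀ x : DLie, ⁅b, x⁆ = 0 := hbi ▸ alpha_lie i
  have lja : ∀ x : DLie, ⁅j a, x⁆ = 0 := hai ▸ h.j_alpha_lie h1i
  have ljb : ∀ x : DLie, ⁅j b, x⁆ = 0 := hbi ▸ h.j_alpha_lie hi
  rw [← hai, ← hbi] at hli
  have pba : pairing b a = 0 := by rw [pairing_comm, pab]
  obtain ⟨p, pa, pja, pb, pjb, pp⟩ : ∃ p, pairing p a = 1 ∧ pairing p (j a) = 0 ∧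
      pairing p b = 0 ∧ pairing p (j b) = 0 ∧ pairing p p = 0 := by
    obtain ⟨p, hp⟩ := exists_pairing_eq hli ![1, 0, 0, 0]
    have pa : pairing p a = 1 := hp 0
    have pja : pairing p (j a) = 0 := hp 1
    have pb : pairing p b = 0 := hp 2
    have pjb : pairing p (j b) = 0 := hp 3
    have ap : pairing a p = 1 := by rw [pairing_comm, pa]
    -- Since `(p, a) = 1` and `(a, a) = 0`, this multiple of `a` cancels `(p, p)`.
    refine ⟨p + (-(1 / 2) * pairing p p) • a, ?_, ?_, ?_, ?_, ?_⟩ <;>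
    simp only [map_add, map_smul, LinearMap.add_apply, LinearMap.smul_apply, smul_eq_mul, pa, pja,
      pb, pjb, ap, paa, pab, pajb, jself] <;> ring
  obtain ⟨q, qa, qja, qb, qjb, qq, pq, pjq⟩ : ∃ q, pairing q a = 0 ∧ pairing q (j a) = 0 ∧
      pairing q b = 1 ∧ pairing q (j b) = 0 ∧ pairing q q = 0 ∧ pairing p q = 0 ∧
      pairing p (j q) = 0 := by
    obtain ⟨q, hq⟩ := exists_pairing_eq hli ![0, 0, 1, 0]
    have qa : pairing q a = 0 := hq 0
    have qja : pairing q (j a) = 0 := hq 1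
    have qb : pairing q b = 1 := hq 2
    have qjb : pairing q (j b) = 0 := hq 3
    have aq : pairing a q = 0 := by rw [pairing_comm, qa]
    have bq : pairing b q = 1 := by rw [pairing_comm, qb]
    have jaq : pairing (j a) q = 0 := by rw [pairing_comm, qja]
    have jab : pairing (j a) b = 0 := by rw [pairing_comm, pbja]
    -- The coefficient of `a` cancels `(p, q)`, that of `j a` cancels `(p, j q)` because `j (j a) =
    -- -a`, and that of `b` cancels `(q, q)`.
    refine ⟨q + (-pairing p q) • a + (pairing p (j q)) • j a + (-(1 / 2) * pairing q q) • b,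
      ?_, ?_, ?_, ?_, ?_, ?_, ?_⟩ <;>
    simp only [map_add, map_smul, map_neg, LinearMap.add_apply, LinearMap.smul_apply, smul_eq_mul,
      h.sq, h.orth, h.pairing_self, pa, pja, pb, pjb, paa, pab, pajb, jself, qa, qja, qb, qjb,
      aq, bq, jaq, jab, pba, pbb, pbja] <;> ring
  have qp : pairing q p = 0 := by rw [pairing_comm, pq]
  have qjp : pairing q (j p) = 0 := by rw [pairing_comm, h.skew, pjq, neg_zero]
  refine ⟨![a, b], ![p, q], ?_, ?_, ?_, ?_, ?_, ?_, ?_, ?_⟩ <;>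
  simp [Fin.forall_fin_two, la, lb, lja, ljb, paa, pab, pba, pbb, pajb, pbja, jself, pa, pja, pb,
    pjb, qa, qja, qb, qjb, pp, qq, pq, qp, pjq, qjp]

/-! ### The adapted basis of the complexification -/

/-- The projection of a real vector to the `ε`-eigenspace of `j`, for `ε = ± i`, multiplied
by two. -/
def eigenVec (j : DLie →ₗ[ℝ] DLie) (ε : ℂ) (x : DLie) : DLieC := 1 ⊗ₜ x + (-ε) ⊗ₜ j x

theorem eigenVec_mem (h : IsInvariantComplexStructure j) {ε : ℂ} (hε : ε * ε = -1) (x : DLie) :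
    eigenVec j ε x ∈ Module.End.eigenspace (j.baseChange ℂ) ε := by
  rw [Module.End.mem_eigenspace_iff, eigenVec, map_add, LinearMap.baseChange_tmul,
    LinearMap.baseChange_tmul, h.sq, smul_add, TensorProduct.smul_tmul', TensorProduct.smul_tmul',
    smul_eq_mul, smul_eq_mul, mul_one, mul_neg, hε, neg_neg, TensorProduct.tmul_neg,
    TensorProduct.neg_tmul, neg_neg, add_comm]

theorem pairingC_eigenVec (h : IsInvariantComplexStructure j) (ε δ : ℂ) (x y : DLie) :
    pairingC (eigenVec j ε x) (eigenVec j δ y)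
      = (1 + ε * δ) * pairing x y + (ε - δ) * pairing x (j y) := by
  simp only [eigenVec, map_add, LinearMap.add_apply, pairingC_tmul, h.orth, h.skew,
    Complex.real_smul, Complex.ofReal_neg]
  ring

theorem eigenVec_lie {x : DLie} (hx : ∀ y : DLie, ⁅x, y⁆ = 0) (hjx : ∀ y : DLie, ⁅j x, y⁆ = 0)
    (ε : ℂ) (z : DLieC) : ⁅eigenVec j ε x, z⁆ = 0 := by
  induction z using TensorProduct.induction_on with
  | zero => exact lieC_zero _
  | add y z hy hz => rw [lieC_add, hy, hz, add_zero]
  | tmul a y =>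
    rw [eigenVec, add_lie, LieAlgebra.ExtendScalars.bracket_tmul,
      LieAlgebra.ExtendScalars.bracket_tmul, hx, hjx, TensorProduct.tmul_zero,
      TensorProduct.tmul_zero, add_zero]

end IsInvariantComplexStructure

end DoubledTorus

end

noncomputable section

namespace DoubledTorus

/-! ### Dual Lagrangian frames with charges -/

theorem finrank_DLie : Module.finrank ℝ DLie = 8 := by
  change Module.finrank ℝ ((Fin 4 → ℝ) × (Fin 4 → ℝ)) = 8
  simp

theorem finrank_DLieC : Module.finrank ℂ DLieC = 8 := by
  rw [Module.finrank_baseChange, finrank_DLie]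

/-- Two Lagrangian frames in duality determine a vector by its pairings. -/
theorem eq_zero_of_dualFrames {w d : Fin 4 → DLieC} (ww : ∀ i k, pairingC (w i) (w k) = 0)
    (dd : ∀ i k, pairingC (d i) (d k) = 0)
    (wd : ∀ i k, pairingC (w i) (d k) = if i = k then 1 else 0) {x : DLieC}
    (hw : ∀ k, pairingC x (w k) = 0) (hd : ∀ k, pairingC x (d k) = 0) : x = 0 := by
  have dw : ∀ i k, pairingC (d i) (w k) = if i = k then 1 else 0 := fun i k => by
    rw [pairingC_comm, wd]; simp [eq_comm]
  have hli : LinearIndependent ℂ (Sum.elim w d) := by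
    rw [Fintype.linearIndependent_iff]
    intro g hg
    rw [Fintype.sum_sum_type] at hg
    simp only [Sum.elim_inl, Sum.elim_inr] at hg
    rintro (k | k)
    · have := congrArg (fun x => pairingC x (d k)) hg
      simpa [wd, dd, LinearMap.sum_apply] using this
    · have := congrArg (fun x => pairingC x (w k)) hg
      simpa [ww, dw, LinearMap.sum_apply] using this
  have hspan := hli.span_eq_top_of_card_eq_finrank' (by rw [finrank_DLieC]; rfl)
  refine pairingC_nondegenerate.1 x fun z => ?_
  have hz : z ∈ Submodule.span ℂ (Set.range (Sum.elim w d)) := hspan ▸ Submodule.mem_top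
  induction hz using Submodule.span_induction with
  | mem z hz =>
    obtain ⟨k | k, rfl⟩ := hz
    · exact hw k
    · exact hd k
  | zero => simp
  | add y z _ _ hy hz => rw [map_add, hy, hz, add_zero]
  | smul c z _ hz => rw [map_smul, hz, smul_zero]

/-- The charges of the adapted basis. -/
def chargeSign : Fin 4 → ℂ := ![1, 1, -1, -1]

theorem chargeSign_eq (i : Fin 4) : chargeSign i = 1 ∨ chargeSign i = -1 := by
  fin_cases i <;> simp [chargeSign]

theorem chargeSign_mul_self (i : Fin 4) : chargeSign i * chargeSign i = 1 := by
  rcases chargeSign_eq i with h | h <;> rw [h] <;> norm_num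

theorem chargeSign_I_sq (i : Fin 4) :
    chargeSign i * Complex.I * (chargeSign i * Complex.I) = -1 := by
  rw [mul_mul_mul_comm, chargeSign_mul_self, Complex.I_mul_I, one_mul]

namespace IsInvariantComplexStructure

variable {j : DLie →ₗ[ℝ] DLie}

/-- Each real vector of the adapted frames yields two eigenvectors, one for each sign. The constants
are `F i k l = ([d i, d k], d l)`, totally antisymmetric by invariance of the pairing. -/
theorem exists_adaptedBasis (h : IsInvariantComplexStructure j) :
    ∃ (F : Fin 4 → Fin 4 → Fin 4 → ℂ) (w d : Fin 4 → DLieC),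
      AdaptedBasis pairingC chargeSign F w d ∧
      (∀ i, w i ∈ Module.End.eigenspace (j.baseChange ℂ) (chargeSign i * Complex.I)) ∧
      (∀ i, d i ∈ Module.End.eigenspace (j.baseChange ℂ) (-(chargeSign i * Complex.I))) := by
  obtain ⟨u, v, huv⟩ := h.exists_isAdapted
  let ind : Fin 4 → Fin 2 := ![0, 1, 0, 1]
  let w : Fin 4 → DLieC := fun i => eigenVec j (chargeSign i * Complex.I) (u (ind i))
  -- The unnormalized eigenvectors pair to `1 + σᵢ σₖ` when their real parts are dual: this is `2`
  -- for equal charges and `0` for opposite ones, whence the factor `1 / 2`.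
  let d : Fin 4 → DLieC := fun i =>
    (1 / 2 : ℂ) • eigenVec j (-(chargeSign i * Complex.I)) (v (ind i))
  have sq' : ∀ i, -(chargeSign i * Complex.I) * -(chargeSign i * Complex.I) = -1 := fun i => by
    rw [neg_mul_neg, chargeSign_I_sq]
  have hw : ∀ i, w i ∈ Module.End.eigenspace (j.baseChange ℂ) (chargeSign i * Complex.I) :=
    fun i => h.eigenVec_mem (chargeSign_I_sq i) _
  have hd : ∀ i, d i ∈ Module.End.eigenspace (j.baseChange ℂ) (-(chargeSign i * Complex.I)) :=
    fun i => Submodule.smul_mem _ _ (h.eigenVec_mem (sq' i) _)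
  have ww : ∀ i k, pairingC (w i) (w k) = 0 := fun i k => by
    simp only [w, h.pairingC_eigenVec, huv.uu, huv.uju]
    simp
  have dd : ∀ i k, pairingC (d i) (d k) = 0 := fun i k => by
    simp only [d, map_smul, LinearMap.smul_apply, h.pairingC_eigenVec, huv.vv, huv.vjv]
    simp
  have dw : ∀ i k, pairingC (d i) (w k) = if i = k then 1 else 0 := fun i k => by
    simp only [d, w, map_smul, LinearMap.smul_apply, h.pairingC_eigenVec, huv.vu, huv.vju]
    have hI : chargeSign i * Complex.I * (chargeSign k * Complex.I)
        = -(chargeSign i * chargeSign k) := by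
      rw [mul_mul_mul_comm, Complex.I_mul_I, mul_neg_one]
    rw [neg_mul, hI]
    fin_cases i <;> fin_cases k <;> norm_num [chargeSign, ind]
  have wd : ∀ i k, pairingC (w i) (d k) = if i = k then 1 else 0 := fun i k => by
    rw [pairingC_comm, dw]; simp [eq_comm]
  have lw : ∀ i (x : DLieC), ⁅w i, x⁆ = 0 := fun i =>
    eigenVec_lie (huv.lie _) (huv.j_lie _) _
  have wr : ∀ (x : DLieC) i, ⁅x, w i⁆ = 0 := fun x i => by
    have h1 : ⁅x, w i⁆ = -⁅w i, x⁆ := (lie_skew x (w i)).symm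
    rw [h1, lw, neg_zero]
  refine ⟨fun i k l => pairingC ⁅d i, d k⁆ (d l), w, d, ?_, hw, hd⟩
  have cyc : ∀ i k l, pairingC ⁅d i, d k⁆ (d l) = pairingC ⁅d k, d l⁆ (d i) := fun i k l => by
    rw [pairingC_lie, pairingC_comm]
  refine ⟨lw, wr, fun i k => ?_, ww, dd, wd, dw, fun i k l => ?_, cyc, chargeSign_mul_self,
    fun i k l => ?_⟩
  -- The bracket is determined by its pairings with both frames. Those with the `w l` vanish because
  -- `w l` is central.
  · refine sub_eq_zero.1 (eq_zero_of_dualFrames ww dd wd (fun l => ?_) fun l => ?_)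
    · rw [map_sub, LinearMap.sub_apply, pairingC_lie, wr, map_zero]
      simp [LinearMap.sum_apply, ww]
    · rw [map_sub, LinearMap.sub_apply]
      simp [LinearMap.sum_apply, wd]
  · have h1 : ⁅d i, d k⁆ = -⁅d k, d i⁆ := (lie_skew (d i) (d k)).symm
    rw [h1, map_neg, LinearMap.neg_apply]
  -- For signs, `1 + σᵢ σₖ + σₖ σₗ + σₗ σᵢ` is zero unless all three agree. If they agree, the three
  -- vectors lie in one isotropic subalgebra and the structure constant vanishes.
  · by_cases hik : chargeSign i = chargeSign k
    · by_cases hkl : chargeSign k = chargeSign l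
      · have h1 : pairingC ⁅d i, d k⁆ (d l) = 0 :=
          h.eigenspace_isotropic (sq' l)
            (h.eigenspace_lie_mem (sq' l) (by rw [← hkl, ← hik]; exact hd i)
              (by rw [← hkl]; exact hd k)) (hd l)
        rw [h1, zero_mul]
      · rcases chargeSign_eq i with hi | hi <;> rcases chargeSign_eq k with hk | hk <;>
        rcases chargeSign_eq l with hl | hl <;> rw [hi, hk] at hik <;> rw [hk, hl] at hkl <;>
        rw [hi, hk, hl] <;> norm_num at *
    · rcases chargeSign_eq i with hi | hi <;> rcases chargeSign_eq k with hk | hk <;>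
      rcases chargeSign_eq l with hl | hl <;> rw [hi, hk] at hik <;>
      rw [hi, hk, hl] <;> norm_num at *

/-- Duality makes both families independent, so each eigenspace has dimension at least `4`; the
total dimension `8` forces equality. -/
theorem exists_bases_of_dual (h : IsInvariantComplexStructure j) {e e' : Fin 4 → DLieC}
    (he : ∀ i, e i ∈ Module.End.eigenspace (j.baseChange ℂ) Complex.I)
    (he' : ∀ i, e' i ∈ Module.End.eigenspace (j.baseChange ℂ) (-Complex.I))
    (hee' : ∀ i k, pairingC (e i) (e' k) = if i = k then 1 else 0) :
    ∃ (b : Module.Basis (Fin 4) ℂ (Module.End.eigenspace (j.baseChange ℂ) Complex.I))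
      (b' : Module.Basis (Fin 4) ℂ (Module.End.eigenspace (j.baseChange ℂ) (-Complex.I))),
      (∀ i, (b i : DLieC) = e i) ∧ ∀ i, (b' i : DLieC) = e' i := by
  have hli : LinearIndependent ℂ e := by
    rw [Fintype.linearIndependent_iff]
    intro g hg k
    have := congrArg (fun x => pairingC x (e' k)) hg
    simpa [hee', LinearMap.sum_apply] using this
  have hli' : LinearIndependent ℂ e' := by
    rw [Fintype.linearIndependent_iff]
    intro g hg k
    have := congrArg (fun x => pairingC (e k) x) hg
    simpa [hee'] using this
  let f : Fin 4 → Module.End.eigenspace (j.baseChange ℂ) Complex.I := fun i => ⟨e i, he i⟩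
  let f' : Fin 4 → Module.End.eigenspace (j.baseChange ℂ) (-Complex.I) := fun i => ⟨e' i, he' i⟩
  have hf : LinearIndependent ℂ f := LinearIndependent.of_comp (Submodule.subtype _) hli
  have hf' : LinearIndependent ℂ f' := LinearIndependent.of_comp (Submodule.subtype _) hli'
  have h1 := hf.fintype_card_le_finrank
  have h2 := hf'.fintype_card_le_finrank
  have h3 := Submodule.finrank_add_eq_of_isCompl h.eigenspace_isCompl
  rw [finrank_DLieC] at h3
  rw [Fintype.card_fin] at h1 h2
  refine ⟨basisOfLinearIndependentOfCardEqFinrank hf (by rw [Fintype.card_fin]; omega),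
    basisOfLinearIndependentOfCardEqFinrank hf' (by rw [Fintype.card_fin]; omega),
    fun i => ?_, fun i => ?_⟩ <;> simp [f, f']

end IsInvariantComplexStructure

end DoubledTorus

end

noncomputable section

namespace DoubledTorus

/-! ### Uniqueness -/

section Uniqueness

variable {M : Type*} [AddCommGroup M] [Module ℂ M] {S : ZMod 2 → Submodule ℂ M} {c : ℂ}

/-- `G⁺` and `G⁻` have opposite charges, so the bracket with `J₀` recovers their sum from their
difference. -/
theorem IsN2.lie_J_zero_sub {D : N2Data M} (h : IsN2 S c D) (n : ℤ) :
    D.J 0 * (D.Gm - D.Gp) n - (D.Gm - D.Gp) n * D.J 0 = -(D.Gm n + D.Gp n) := by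
  have h1 := h.JGp 0 n
  have h2 := h.JGm 0 n
  rw [N2Seed.koszul_zero_left, one_smul] at h1 h2
  simp at h1 h2
  rw [Pi.sub_apply, mul_sub, sub_mul]
  linear_combination (norm := abel) h2 - h1

/-- The zero mode sees only the simple pole, which contains `L`. -/
theorem IsN2.anticomm_Gp_zero {D : N2Data M} (h : IsN2 S c D) (n : ℤ) :
    D.Gp 0 * D.Gm n + D.Gm n * D.Gp 0 = D.L n + (1 / 2 : ℂ) • dField D.J n := by
  have h1 := h.GpGm 0 n
  rw [N2Seed.koszul_one_one] at h1
  simp only [List.length_cons, List.length_nil, Fin.sum_univ_succ, Fin.sum_univ_zero] at h1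
  simpa [Ring.choose_zero_right, Ring.choose_zero_succ] using h1

/-- The lowest components `J` and `G⁻ - G⁺` determine a representation of the `N = 2` algebra. -/
theorem IsN2.eq_of_superfield_eq {D D' : N2Data M} (h : IsN2 S c D) (h' : IsN2 S c D')
    (hJ : D.J = D'.J) (hG : D.Gm - D.Gp = D'.Gm - D'.Gp) : D = D' := by
  have hs : ∀ n, D.Gm n + D.Gp n = D'.Gm n + D'.Gp n := fun n => by
    rw [← neg_inj, ← h.lie_J_zero_sub, ← h'.lie_J_zero_sub, hJ, hG]
  have hd : ∀ n, D.Gm n - D.Gp n = D'.Gm n - D'.Gp n := fun n => congrFun hG n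
  have hm : D.Gm = D'.Gm := funext fun n => by
    linear_combination (norm := module) (1 / 2 : ℂ) • hs n + (1 / 2 : ℂ) • hd n
  have hp : D.Gp = D'.Gp := funext fun n => by
    linear_combination (norm := module) (1 / 2 : ℂ) • hs n - (1 / 2 : ℂ) • hd n
  have hL : D.L = D'.L := funext fun n => by
    have h1 := h.anticomm_Gp_zero n
    rw [hm, hp, hJ, h'.anticomm_Gp_zero n] at h1
    exact (add_right_cancel h1).symm
  cases D
  cases D'
  simp_all

end Uniqueness

/-! ### Independence of the choice of dual bases -/

section DualBases

variable {V N : Type*} [AddCommGroup V] [Module ℂ V] [AddCommGroup N] [Module ℂ N]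

theorem eq_sum_of_dual {l : Submodule ℂ V} (b : Module.Basis (Fin 4) ℂ l)
    (f : Fin 4 → V →ₗ[ℂ] ℂ) (hf : ∀ i k, f k (b i : V) = if i = k then 1 else 0)
    (x : l) : (x : V) = ∑ i, f i x • (b i : V) := by
  have h1 : (x : V) = ∑ i, b.repr x i • (b i : V) := by
    have := congrArg (Submodule.subtype l) (b.sum_repr x)
    rw [map_sum] at this
    exact this.symm
  have h2 : ∀ k, f k x = b.repr x k := fun k => by
    conv_lhs => rw [h1]
    simp [hf]
  simp only [h2]
  exact h1

/-- The tensor `∑ b' i ⊗ b i` is canonical: the expansion of `b'` in `c'` and that of `c` in `b`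
have the same matrix `B (c k) (b' i)`. -/
theorem sum_dual_eq {B : LinearMap.BilinForm ℂ V} {l l' : Submodule ℂ V}
    (Φ : V →ₗ[ℂ] V →ₗ[ℂ] N) (b c : Module.Basis (Fin 4) ℂ l) (b' c' : Module.Basis (Fin 4) ℂ l')
    (hb : ∀ i k, B (b i) (b' k) = if i = k then 1 else 0)
    (hc : ∀ i k, B (c i) (c' k) = if i = k then 1 else 0) :
    ∑ i, Φ (b' i) (b i) = ∑ i, Φ (c' i) (c i) := by
  have h1 : ∀ k, (c k : V) = ∑ i, B (c k) (b' i) • (b i : V) := fun k =>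
    eq_sum_of_dual b (fun i => B.flip (b' i)) (fun i k => hb i k) (c k)
  have h2 : ∀ i, (b' i : V) = ∑ k, B (c k) (b' i) • (c' k : V) := fun i =>
    eq_sum_of_dual c' (fun k => B (c k)) (fun i k => by simp [hc, eq_comm]) (b' i)
  calc ∑ i, Φ (b' i) (b i) = ∑ i, ∑ k, B (c k) (b' i) • Φ (c' k) (b i) := by
        refine Finset.sum_congr rfl fun i _ => ?_
        conv_lhs => rw [h2 i]
        simp [LinearMap.sum_apply]
    _ = ∑ k, Φ (c' k) (c k) := by
        rw [Finset.sum_comm]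
        refine Finset.sum_congr rfl fun k _ => ?_
        conv_rhs => rw [h1 k]
        simp

end DualBases

/-! ### The adapted fields on the space of states -/

section Superfield

open QField CurrentSystem

/-- The lowest component of the superfield of a pair of frames. -/
def lowerField (e e' : Fin 4 → DLieC) : QField States :=
  ∑ i, NO (-1) (barField (e' i)) (barField (e i))

/-- The upper component of the superfield of a pair of frames. -/
def upperField (e e' : Fin 4 → DLieC) : QField States :=
  ∑ i, (NO 1 (curField (e' i)) (barField (e i)) - NO 1 (barField (e' i)) (curField (e i)))

theorem isGeneratedBy_iff (D : N2Data States) (e e' : Fin 4 → DLieC) :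
    IsGeneratedBy D e e' ↔ D.J = (lowerField e e').1 ∧ D.Gm - D.Gp = (upperField e e').1 := by
  have h11 : ∀ i n v, normalOrd 1 1 (oddCurrent (e' i)) (oddCurrent (e i)) n v
      = (NO (-1) (barField (e' i)) (barField (e i))).1 n v := fun i n v => by
    rw [← N2Seed.koszul_one_one]
    exact normalOrd_eq_NO 1 1 (barField (e' i)) (barField (e i)) n v
  have h01 : ∀ i n v, normalOrd 0 1 (current (e' i)) (oddCurrent (e i)) n v
      = (NO 1 (curField (e' i)) (barField (e i))).1 n v := fun i n v => by
    rw [← N2Seed.koszul_zero_left 1]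
    exact normalOrd_eq_NO 0 1 (curField (e' i)) (barField (e i)) n v
  have h10 : ∀ i n v, normalOrd 1 0 (oddCurrent (e' i)) (current (e i)) n v
      = (NO 1 (barField (e' i)) (curField (e i))).1 n v := fun i n v => by
    rw [show (1 : ℂ) = koszul 1 0 by simp [koszul]]
    exact normalOrd_eq_NO 1 0 (barField (e' i)) (curField (e i)) n v
  simp only [IsGeneratedBy, h11, h01, h10]
  refine and_congr ?_ ?_
  · rw [funext_iff]
    refine forall_congr' fun n => ?_
    rw [LinearMap.ext_iff]
    simp [lowerField, LinearMap.sum_apply]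
  · rw [funext_iff]
    refine forall_congr' fun n => ?_
    rw [LinearMap.ext_iff]
    simp [upperField, LinearMap.sum_apply]

theorem lowerField_eq {l l' : Submodule ℂ DLieC} (b c : Module.Basis (Fin 4) ℂ l)
    (b' c' : Module.Basis (Fin 4) ℂ l')
    (hb : ∀ i k, pairingC (b i) (b' k) = if i = k then 1 else 0)
    (hc : ∀ i k, pairingC (c i) (c' k) = if i = k then 1 else 0) :
    lowerField (fun i => (b i : DLieC)) (fun i => (b' i : DLieC))
      = lowerField (fun i => (c i : DLieC)) (fun i => (c' i : DLieC)) :=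
  sum_dual_eq ((NO (-1)).compl₁₂ barField barField) b c b' c' hb hc

theorem upperField_eq {l l' : Submodule ℂ DLieC} (b c : Module.Basis (Fin 4) ℂ l)
    (b' c' : Module.Basis (Fin 4) ℂ l')
    (hb : ∀ i k, pairingC (b i) (b' k) = if i = k then 1 else 0)
    (hc : ∀ i k, pairingC (c i) (c' k) = if i = k then 1 else 0) :
    upperField (fun i => (b i : DLieC)) (fun i => (b' i : DLieC))
      = upperField (fun i => (c i : DLieC)) (fun i => (c' i : DLieC)) :=
  sum_dual_eq ((NO 1).compl₁₂ curField barField - (NO 1).compl₁₂ barField curField)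
    b c b' c' hb hc

variable {F : Fin 4 → Fin 4 → Fin 4 → ℂ} {w d : Fin 4 → DLieC}

/-- For charge `1` the vector of the frame of `𝔩` is `w k`, for charge `-1` it is `d k`. In the
second case the two conjugate fermions appear in the other order, and exchanging them produces the
sign `σ k`. -/
theorem jField_eq_lowerField (hb : AdaptedBasis pairingC chargeSign F w d) :
    jField barField chargeSign w d = lowerField ![w 0, w 1, d 2, d 3] ![d 0, d 1, w 2, w 3] := by
  have h : ∀ k, NO (-1) (barField (w k)) (barField (d k))
      = -NO (-1) (barField (d k)) (barField (w k)) := fun k =>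
    NO_swap_of_conj fun m => by
      rw [currentSystem_states.bar_bar, hb.wd, if_pos rfl, one_smul]
  simp [jField, lowerField, Fin.sum_univ_four, chargeSign, h]

/-- As the `w k` are central, the order of the factors is immaterial; the sign `σ k` comes from the
difference of the two products. -/
theorem hField_eq_upperField (hb : AdaptedBasis pairingC chargeSign F w d) :
    hField curField barField chargeSign w d
      = upperField ![w 0, w 1, d 2, d 3] ![d 0, d 1, w 2, w 3] := by
  have hc := currentSystem_states
  have h1 : ∀ k, NO 1 (barField (w k)) (curField (d k))
      = NO 1 (curField (d k)) (barField (w k)) := fun k => by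
    rw [NO_swap_of_comm (mul_one 1) (scomm_of_ad_zero fun m => by
      rw [hc.bar_cur, hb.lie_w_left, map_zero, map_zero]), one_smul]
  have h2 : ∀ k, NO 1 (barField (d k)) (curField (w k))
      = NO 1 (curField (w k)) (barField (d k)) := fun k => by
    rw [NO_swap_of_comm (mul_one 1) (scomm_of_ad_zero fun m => by
      rw [hc.bar_cur, hb.lie_w_right, map_zero, map_zero]), one_smul]
  simp [hField, upperField, Fin.sum_univ_four, chargeSign, h1, h2]
  abel

/-- Up to sign, `K` is a `0`-th product of `J` and `H`, so membership in the vertex algebra and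
parity are inherited from them without examining the cubic terms. -/
theorem kField_eq (hb : AdaptedBasis pairingC chargeSign F w d) :
    kField curField barField chargeSign F w d
      = -ad 1 ((jField barField chargeSign w d).1 0) (hField curField barField chargeSign w d) := by
  rw [currentSystem_states.jField_hField hb 0, shift_zero, neg_neg]

theorem memGenerated_curField (x : DLieC) : MemGenerated current oddCurrent 0 (curField x).1 :=
  .even x

theorem memGenerated_barField (x : DLieC) : MemGenerated current oddCurrent 1 (barField x).1 :=
  .odd x

theorem one_add_one_zmod : (1 + 1 : ZMod 2) = 0 := rfl

theorem memGenerated_jField :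
    MemGenerated current oddCurrent 0 (jField barField chargeSign w d).1 := by
  rw [jField]
  refine MemGenerated.sum _ Finset.univ_nonempty fun k _ => MemGenerated.smul _ ?_
  have := (memGenerated_barField (d k)).normalOrder (memGenerated_barField (w k))
  rwa [N2Seed.koszul_one_one, one_add_one_zmod] at this

theorem memGenerated_hField :
    MemGenerated current oddCurrent 1 (hField curField barField chargeSign w d).1 := by
  have h : ∀ x y, MemGenerated current oddCurrent 1 (NO 1 (curField x) (barField y)).1 :=
    fun x y => by
      have := (memGenerated_curField x).normalOrder (memGenerated_barField y)
      rwa [N2Seed.koszul_zero_left, zero_add] at this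
  rw [hField]
  exact MemGenerated.sum _ Finset.univ_nonempty fun k _ =>
    MemGenerated.smul _ ((h _ _).sub (h _ _))

theorem memGenerated_kField (hb : AdaptedBasis pairingC chargeSign F w d) :
    MemGenerated current oddCurrent 1 (kField curField barField chargeSign F w d).1 := by
  have := (memGenerated_jField (w := w) (d := d)).zeroMode (memGenerated_hField (w := w) (d := d))
  rw [N2Seed.koszul_zero_left, zero_add] at this
  rw [kField_eq hb, ← neg_one_smul ℂ]
  exact this.smul _

theorem memGenerated_sField (hb : AdaptedBasis pairingC chargeSign F w d) :
    MemGenerated current oddCurrent 0 (sField curField barField chargeSign F w d).1 := by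
  have := (memGenerated_kField hb).zeroMode (memGenerated_kField hb)
  rw [N2Seed.koszul_one_one, one_add_one_zmod] at this
  rw [sField]
  exact this.smul _

theorem hasParity_jField : HasParity stateParity 0 (jField barField chargeSign w d).1 := by
  rw [jField]
  refine HasParity.sum _ fun k _ => HasParity.smul _ ?_
  have := (hasParity_barField (d k)).normalOrder (-1) (hasParity_barField (w k))
  rwa [one_add_one_zmod] at this

theorem hasParity_hField :
    HasParity stateParity 1 (hField curField barField chargeSign w d).1 := by
  have h : ∀ x y, HasParity stateParity 1 (NO 1 (curField x) (barField y)).1 := fun x y => by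
    have := (hasParity_curField x).normalOrder 1 (hasParity_barField y)
    rwa [zero_add] at this
  rw [hField]
  exact HasParity.sum _ fun k _ => HasParity.smul _ (HasParity.sub (h _ _) (h _ _))

theorem hasParity_kField (hb : AdaptedBasis pairingC chargeSign F w d) :
    HasParity stateParity 1 (kField curField barField chargeSign F w d).1 := by
  have := (hasParity_jField (w := w) (d := d)).supercomm 1 0 (hasParity_hField (w := w) (d := d))
  rw [zero_add] at this
  rw [kField_eq hb, ← neg_one_smul ℂ]
  exact HasParity.smul _ this

theorem hasParity_sField (hb : AdaptedBasis pairingC chargeSign F w d) :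
    HasParity stateParity 0 (sField curField barField chargeSign F w d).1 := by
  have := (hasParity_kField hb).supercomm (-1) 0 (hasParity_kField hb)
  rw [one_add_one_zmod] at this
  rw [sField]
  exact HasParity.smul _ this

/-- The `N = 2` data of an adapted basis. -/
def adaptedData (F : Fin 4 → Fin 4 → Fin 4 → ℂ) (w d : Fin 4 → DLieC) : N2Data States :=
  N2Seed.data (jField barField chargeSign w d).1 (kField curField barField chargeSign F w d).1
    (hField curField barField chargeSign w d).1 (sField curField barField chargeSign F w d).1

theorem adaptedData_isN2 (hb : AdaptedBasis pairingC chargeSign F w d) :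
    IsN2 stateParity 12 (adaptedData F w d) := by
  have h := (currentSystem_states.seed hb).isN2 stateParity (QField.isQuantumField _)
    (QField.isQuantumField _)
    (((1 / 2 : ℂ) • (kField curField barField chargeSign F w d
      - hField curField barField chargeSign w d)).isQuantumField)
    (((1 / 2 : ℂ) • (kField curField barField chargeSign F w d
      + hField curField barField chargeSign w d)).isQuantumField)
    (hasParity_sField hb) hasParity_jField
    (HasParity.smul _ ((hasParity_kField hb).sub hasParity_hField))
    (HasParity.smul _ ((hasParity_kField hb).add hasParity_hField))
  rw [show (3 * 4 : ℂ) = 12 by norm_num] at h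
  exact h

theorem adaptedData_mem (hb : AdaptedBasis pairingC chargeSign F w d) :
    IsInAffineVertexAlgebra (adaptedData F w d) where
  mem_L := memGenerated_sField hb
  mem_J := memGenerated_jField
  mem_Gp := ((memGenerated_kField hb).sub memGenerated_hField).smul _
  mem_Gm := ((memGenerated_kField hb).add memGenerated_hField).smul _

theorem adaptedData_isGeneratedBy (hb : AdaptedBasis pairingC chargeSign F w d) :
    IsGeneratedBy (adaptedData F w d) ![w 0, w 1, d 2, d 3] ![d 0, d 1, w 2, w 3] := by
  rw [isGeneratedBy_iff, ← jField_eq_lowerField hb, ← hField_eq_upperField hb]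
  refine ⟨rfl, ?_⟩
  change (1 / 2 : ℂ) • ((kField curField barField chargeSign F w d).1
    + (hField curField barField chargeSign w d).1)
    - (1 / 2 : ℂ) • ((kField curField barField chargeSign F w d).1
      - (hField curField barField chargeSign w d).1) = _
  module

end Superfield

end DoubledTorus

end

/-! ### The theorem -/

open DoubledTorus in
theorem mainTheorem2 (𝒥 : DLie → DLie →L[ℝ] DLie)
    (h𝒥 : IsComplexStructure 𝒥) (heq : IsEquivariant 𝒥) (horth : IsOrthogonal 𝒥) :
    IsManinTriple pairingC (eigen 𝒥 Complex.I) (eigen 𝒥 (-Complex.I)) ∧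
    ∃! D : N2Data States,
      IsN2 stateParity 12 D ∧ IsInAffineVertexAlgebra D ∧
      ∀ (e : Module.Basis (Fin 4) ℂ (eigen 𝒥 Complex.I))
        (e' : Module.Basis (Fin 4) ℂ (eigen 𝒥 (-Complex.I))),
        (∀ i j, pairingC (e i) (e' j) = if i = j then 1 else 0) →
        IsGeneratedBy D (fun i => (e i : DLieC)) (fun i => (e' i : DLieC)) := by
  have hj := h𝒥.atIdentity heq horth
  refine ⟨hj.isManinTriple, ?_⟩
  obtain ⟨F, w, d, hb, hw, hd⟩ := hj.exists_adaptedBasis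
  -- The charges are `1, 1, -1, -1`, so `w 0, w 1, d 2, d 3` lie in the `i`-eigenspace and their
  -- duals `d 0, d 1, w 2, w 3` in the `-i`-eigenspace.
  have hdual : ∀ i k, pairingC ((![w 0, w 1, d 2, d 3] : Fin 4 → DLieC) i)
      ((![d 0, d 1, w 2, w 3] : Fin 4 → DLieC) k) = if i = k then 1 else 0 := by
    simp [Fin.forall_fin_succ, hb.wd, hb.dw, hb.ww, hb.dd]
  obtain ⟨b, b', hbe, hbe'⟩ := hj.exists_bases_of_dual
    (e := ![w 0, w 1, d 2, d 3]) (e' := ![d 0, d 1, w 2, w 3])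
    (by
      have h0 := hw 0; have h1 := hw 1; have h2 := hd 2; have h3 := hd 3
      simp only [chargeSign, Matrix.cons_val, one_mul, neg_mul, neg_neg] at h0 h1 h2 h3
      intro i; fin_cases i <;> assumption)
    (by
      have h0 := hd 0; have h1 := hd 1; have h2 := hw 2; have h3 := hw 3
      simp only [chargeSign, Matrix.cons_val, one_mul, neg_mul] at h0 h1 h2 h3
      intro i; fin_cases i <;> assumption) hdual
  have hbb : ∀ i k, pairingC (b i) (b' k) = if i = k then 1 else 0 := fun i k => by
    rw [hbe, hbe', hdual]
  have hgen := adaptedData_isGeneratedBy hb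
  rw [← funext hbe, ← funext hbe'] at hgen
  refine ⟨adaptedData F w d, ⟨adaptedData_isN2 hb, adaptedData_mem hb, fun e e' he => ?_⟩,
    fun D hD => ?_⟩
  · rw [isGeneratedBy_iff] at hgen ⊢
    rw [lowerField_eq e b e' b' he hbb, upperField_eq e b e' b' he hbb]
    exact hgen
  -- Uniqueness only uses the superfield condition for this one pair of dual bases.
  · have h1 := hD.2.2 b b' hbb
    rw [isGeneratedBy_iff] at h1 hgen
    exact hD.1.eq_of_superfield_eq (adaptedData_isN2 hb) (h1.1.trans hgen.1.symm)
      (h1.2.trans hgen.2.symm)
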